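/- **Setting.** A *multi-parameter Bayesian contract design (BCD) instance* with $n\ge 1$ actions, $m$ outcomes and $K$ agent types consists of, for each type $\theta\in\Theta$ ($|\Theta|=K$), a row-stochastic matrix $F^\theta\in\mathbb R_{\ge0}^{n\times m}$ and a cost vector $c^\theta\in\mathbb R_{\ge 0}^n$ with $c^\theta_0=0$ (action $0$ is the opt-out action), together with rewards $r\in\mathbb R_{\ge0}^m$ and type probabilities $\mu(\theta)>0$, $\sum_\theta\mu(\theta)=1$. A *single-parameter* instance is given by one matrix $F$, one vector $c\ge 0$ with $c_0=0$, rewards $r$, distinct real types $\theta\ge0$ and probabilities $\mu(\theta)>0$; it is the special case $F^\theta=F$, $c^\theta=\theta c$. A *menu of contracts* is a pair $(P,a)$ with contracts $p^\theta\in\mathbb R_{\ge0}^m$ and recommended actions $a(\theta)$ that is incentive compatible: $$\langle F^\theta_{a(\theta)},p^\theta\rangle-c^\theta_{a(\theta)}\ \ge\ \langle F^\theta_i,p^{\theta'}\rangle-c^\theta_i\qquad\text{for all actions } i \text{ and all }\theta,\theta'\in\Theta .$$ A *single contract* is a menu all of whose contracts $p^\theta$ are equal. The principal's utility is $U(P,a)=\sum_\theta\mu(\theta)\langle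 F^\theta_{a(\theta)},r-p^\theta\rangle$. A menu (resp. single contract) is a *$\beta$-approximation* if its utility is at least $\beta$ times the supremum of $U$ over all menus (resp. all single contracts) of the instance. Inputs and outputs of algorithms are rational, written as fractions in binary; the bit length of a solution is that of its payments and recommended actions. Running time is the logarithmic (bit) cost on a random access machine. **Theorem 4.1.** Multi-parameter BCD and single-parameter BCD reduce to each other in polynomial time. Specifically: 1. There is an algorithm that, for any $\xi>0$ (given to it as the integer $\max\{0,\lceil\log_2(1/\xi)\rceil\}$), maps any multi-parameter instance $I^M$ with $n$ actions, $m$ outcomes, $K$ types and input bit length $L$, in time $\operatorname{poly}(L,\log(1/\xi))$, to a single-parameter instance $I^S$ with $nK+1$ actions, $m+1$ outcomes and $K+1$ types, such that: for every real $\beta$, any $\beta$-approximation of the optimal menu of contracts (resp. of the optimal single contract) for $I^S$ can be converted to a $(\beta-\xi)$-approximation of the optimal menu of contracts (resp. of the optimal single contract) for $I^M$, by an algorithm that takes $\xi$, $I^M$ and the given solution and runs in time polynomial in $L$, $\log(1/\xi)$ and the bit length of that solution. Here $\log(1/\xi)$ is read as $0$ when $\xi>1$. Moreover, whenever all rewards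 and costs of $I^M$ are at most $B$, so are all rewards and unit costs $c_i$ of $I^S$. 2. Conversely, there is a polynomial-time algorithm that maps any single-parameter instance to a multi-parameter instance with the same numbers of actions, outcomes and types, such that any $\beta$-approximation of the optimal menu (resp. single contract) for the latter can be converted, in time polynomial in the bit lengths of the instance and the solution, to a $\beta$-approximation of the optimal menu (resp. single contract) for the former. -/

import Mathlib

open scoped BigOperators

namespace BCD

/-! ## Bayesian contract design -/

/-- A multi-parameter Bayesian contract design instance with `n` actions, `m` outcomes and `K` agent
types. Type `k` has the action-to-outcome matrix `F k` and the cost vector `c k`; the action of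
index `0` is the opt-out action. -/
structure MultiInstance (n m K : ℕ) where
  /-- `F k i j` is the probability that action `i` of type `k` results in outcome `j`. -/
  F : Fin K → Fin n → Fin m → ℝ
  /-- `c k i` is the cost of action `i` to type `k`. -/
  c : Fin K → Fin n → ℝ
  /-- `r j` is the reward of the principal for outcome `j`. -/
  r : Fin m → ℝ
  /-- `μ k` is the probability of type `k`. -/
  μ : Fin K → ℝ
  F_nonneg : ∀ k i j, 0 ≤ F k i j
  F_sum : ∀ k i, ∑ j, F k i j = 1
  c_nonneg : ∀ k i, 0 ≤ c k i
  r_nonneg : ∀ j, 0 ≤ r j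
  μ_pos : ∀ k, 0 < μ k
  μ_sum : ∑ k, μ k = 1
  n_pos : 0 < n
  opt_out : ∀ k, c k ⟨0, n_pos⟩ = 0

/-- A single-parameter Bayesian contract design instance with `n` actions, `m` outcomes and `K`
agent types. All types share the matrix `F`; the types are `K` distinct reals `θ k ≥ 0`, and type
`θ k` suffers the cost `θ k * c i` for action `i`. -/
structure SingleInstance (n m K : ℕ) where
  F : Fin n → Fin m → ℝ
  /-- `c i` is the number of units of cost of action `i`. -/
  c : Fin n → ℝ
  r : Fin m → ℝ
  /-- The cost per unit of each type. -/
  θ : Fin K → ℝ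
  μ : Fin K → ℝ
  F_nonneg : ∀ i j, 0 ≤ F i j
  F_sum : ∀ i, ∑ j, F i j = 1
  c_nonneg : ∀ i, 0 ≤ c i
  r_nonneg : ∀ j, 0 ≤ r j
  θ_nonneg : ∀ k, 0 ≤ θ k
  θ_injective : Function.Injective θ
  μ_pos : ∀ k, 0 < μ k
  μ_sum : ∑ k, μ k = 1
  n_pos : 0 < n
  opt_out : c ⟨0, n_pos⟩ = 0

/-- The single-parameter setting is the special case `F^θ = F`, `c^θ = θ • c` of the multi-parameter
setting; incentive compatibility, utilities and optima are inherited from there. -/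
def SingleInstance.toMulti {n m K : ℕ} (J : SingleInstance n m K) : MultiInstance n m K where
  F := fun _ => J.F
  c := fun k i => J.θ k * J.c i
  r := J.r
  μ := J.μ
  F_nonneg := fun _ => J.F_nonneg
  F_sum := fun _ => J.F_sum
  c_nonneg := fun k i => mul_nonneg (J.θ_nonneg k) (J.c_nonneg i)
  r_nonneg := J.r_nonneg
  μ_pos := J.μ_pos
  μ_sum := J.μ_sum
  n_pos := J.n_pos
  opt_out := fun k => by rw [J.opt_out, mul_zero]

/-- All rewards and costs are at most `B`. -/
def MultiInstance.BoundedBy {n m K : ℕ} (I : MultiInstance n m K) (B : ℝ) : Prop :=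
  (∀ j, I.r j ≤ B) ∧ ∀ k i, I.c k i ≤ B

/-- All rewards and costs per unit are at most `B`. -/
def SingleInstance.BoundedBy {n m K : ℕ} (J : SingleInstance n m K) (B : ℝ) : Prop :=
  (∀ j, J.r j ≤ B) ∧ ∀ i, J.c i ≤ B

/-- A contract mechanism `(P, a)`: for every type `k` a contract `pay k` (a payment for each outcome)
and a recommended action `act k`. -/
structure Mechanism (n m K : ℕ) where
  pay : Fin K → Fin m → ℝ
  act : Fin K → Fin n

namespace MultiInstance

variable {n m K : ℕ}

/-- Expected utility of type `k` under contract `p` when playing action `i`. -/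
def agentUtility (I : MultiInstance n m K) (k : Fin K) (p : Fin m → ℝ) (i : Fin n) : ℝ :=
  ∑ j, I.F k i j * p j - I.c k i

/-- Incentive compatibility: no type gains by misreporting, disobeying, or both. -/
def IsIC (I : MultiInstance n m K) (S : Mechanism n m K) : Prop :=
  ∀ k k' i, I.agentUtility k (S.pay k') i ≤ I.agentUtility k (S.pay k) (S.act k)

/-- Expected utility of the principal when every type reports honestly and obeys. -/
def principalUtility (I : MultiInstance n m K) (S : Mechanism n m K) : ℝ :=
  ∑ k, I.μ k * ∑ j, I.F k (S.act k) j * (I.r j - S.pay k j)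

/-- Feasible menus of contracts: incentive compatibility and limited liability. -/
def IsMenu (I : MultiInstance n m K) (S : Mechanism n m K) : Prop :=
  I.IsIC S ∧ ∀ k j, 0 ≤ S.pay k j

/-- Feasible single contracts: feasible menus all of whose contracts are equal. -/
def IsSingleContract (I : MultiInstance n m K) (S : Mechanism n m K) : Prop :=
  I.IsMenu S ∧ ∀ k k', S.pay k = S.pay k'

/-- The optimal value over menus of contracts. -/
noncomputable def optMenu (I : MultiInstance n m K) : ℝ :=
  sSup {u | ∃ S, I.IsMenu S ∧ u = I.principalUtility S}

/-- The optimal value over single contracts. -/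
noncomputable def optSingle (I : MultiInstance n m K) : ℝ :=
  sSup {u | ∃ S, I.IsSingleContract S ∧ u = I.principalUtility S}

/-- `S` is a `β`-approximation of the optimal menu of contracts. -/
def IsApproxMenu (I : MultiInstance n m K) (β : ℝ) (S : Mechanism n m K) : Prop :=
  I.IsMenu S ∧ β * I.optMenu ≤ I.principalUtility S

/-- `S` is a `β`-approximation of the optimal single contract. -/
def IsApproxSingle (I : MultiInstance n m K) (β : ℝ) (S : Mechanism n m K) : Prop :=
  I.IsSingleContract S ∧ β * I.optSingle ≤ I.principalUtility S

end MultiInstance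

/-! ## The machine model: a random access machine on integers with logarithmic cost -/

/-- Number of bits of an integer, including one for the sign (so at least `1`). -/
def bits (z : ℤ) : ℕ := z.natAbs.size + 1

/-- Total bit length of a list of integers. -/
def bitLength (xs : List ℤ) : ℕ := (xs.map bits).sum

/-- Memory: every address holds an integer of arbitrary length. -/
abbrev Memory := ℤ → ℤ

inductive Op
  | add | sub | mul | div

/-- Integer operations; `div` is Lean's integer division, with value `0` for divisor `0`. -/
def Op.apply : Op → ℤ → ℤ → ℤ
  | .add, x, y => x + y
  | .sub, x, y => x - y
  | .mul, x, y => x * y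
  | .div, x, y => x / y

/-- Expressions: constants, the content of the memory cell with a computed address, and arithmetic
operations. -/
inductive Expr
  | const (z : ℤ)
  | read (a : Expr)
  | op (o : Op) (a b : Expr)

def Expr.value : Expr → Memory → ℤ
  | .const z, _ => z
  | .read a, M => M (a.value M)
  | .op o a b, M => o.apply (a.value M) (b.value M)

/-- Logarithmic cost: every number that is produced on the way (constants, addresses, cell contents,
operands, results) is charged its bit length. -/
def Expr.cost : Expr → Memory → ℕ
  | .const z, _ => bits z
  | .read a, M => a.cost M + bits (M (a.value M))
  | .op o a b, M => a.cost M + b.cost M + bits (o.apply (a.value M) (b.value M))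

/-- Programs. `write a e` stores the value of `e` in the cell whose address is the value of `a`;
`branch e p q` runs `p` if `e > 0` and `q` otherwise; `loop e p` repeats `p` while `e > 0`. -/
inductive Program
  | skip
  | write (a e : Expr)
  | seq (p q : Program)
  | branch (e : Expr) (p q : Program)
  | loop (e : Expr) (p : Program)

/-- `Exec p M t M'`: the program `p`, started in memory `M`, halts in memory `M'` at total cost `t`.
Every executed instruction and every evaluated test costs `1` plus the cost of its expressions. -/
inductive Exec : Program → Memory → ℕ → Memory → Prop
  | skip (M : Memory) : Exec .skip M 1 M
  | write (a e : Expr) (M : Memory) :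
      Exec (.write a e) M (1 + a.cost M + e.cost M) (Function.update M (a.value M) (e.value M))
  | seq {p q : Program} {M M' M'' : Memory} {s t : ℕ} :
      Exec p M s M' → Exec q M' t M'' → Exec (.seq p q) M (s + t) M''
  | branch_pos {e : Expr} {p q : Program} {M M' : Memory} {t : ℕ} :
      0 < e.value M → Exec p M t M' → Exec (.branch e p q) M (1 + e.cost M + t) M'
  | branch_neg {e : Expr} {p q : Program} {M M' : Memory} {t : ℕ} :
      ¬ 0 < e.value M → Exec q M t M' → Exec (.branch e p q) M (1 + e.cost M + t) M'
  | loop_done {e : Expr} {p : Program} {M : Memory} :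
      ¬ 0 < e.value M → Exec (.loop e p) M (1 + e.cost M) M
  | loop_step {e : Expr} {p : Program} {M M' M'' : Memory} {s t : ℕ} :
      0 < e.value M → Exec p M s M' → Exec (.loop e p) M' t M'' →
      Exec (.loop e p) M (1 + e.cost M + s + t) M''

/-- Initial memory: cell `0` holds the length of the input, the cells `1, 2, …` hold the input, and
all other cells hold `0`. -/
def initMemory (xs : List ℤ) : Memory := fun a =>
  if a = 0 then (xs.length : ℤ) else if 0 < a then xs.getD (a - 1).toNat 0 else 0

/-- The output is read off the memory in the same format. -/
def HasOutput (M : Memory) (ys : List ℤ) : Prop :=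
  M 0 = (ys.length : ℤ) ∧ ∀ (i : ℕ) (h : i < ys.length), M ((i : ℤ) + 1) = ys[i]

/-- On input `xs` the program `p` halts with output `ys`, at cost at most `T`; reading off the output
is charged its bit length. -/
def RunsInTime (p : Program) (xs ys : List ℤ) (T : ℕ) : Prop :=
  ∃ t M, Exec p (initMemory xs) t M ∧ HasOutput M ys ∧ t + bitLength ys ≤ T

/-! ## Codes: rational numbers are given by numerator and denominator in binary -/

/-- The list `xs` codes the real numbers `qs`: it lists, for each of them in turn, the numerator and
the positive denominator of a fraction (not necessarily in lowest terms) with that value. -/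
def CodesReals (qs : List ℝ) (xs : List ℤ) : Prop :=
  ∃ fs : List (ℤ × ℤ), (∀ f ∈ fs, 0 < f.2) ∧ fs.map (fun f => (f.1 : ℝ) / (f.2 : ℝ)) = qs ∧
    xs = fs.flatMap fun f => [f.1, f.2]

/-- The entries of a matrix, row by row. -/
def matrixEntries {a b : ℕ} (A : Fin a → Fin b → ℝ) : List ℝ :=
  (List.ofFn fun i => List.ofFn (A i)).flatten

/-- `xs` codes the multi-parameter instance `I`: the numbers of actions, outcomes and types, followed
by fractions for the transition probabilities, costs, rewards and type probabilities. -/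
def MultiInstance.Codes {n m K : ℕ} (I : MultiInstance n m K) (xs : List ℤ) : Prop :=
  ∃ ys, CodesReals ((List.ofFn fun k => matrixEntries (I.F k)).flatten ++ matrixEntries I.c ++
      List.ofFn I.r ++ List.ofFn I.μ) ys ∧
    xs = (n : ℤ) :: (m : ℤ) :: (K : ℤ) :: ys

/-- `xs` codes the single-parameter instance `J`: the numbers of actions, outcomes and types, followed
by fractions for the transition probabilities, unit costs, rewards, types and type probabilities. -/
def SingleInstance.Codes {n m K : ℕ} (J : SingleInstance n m K) (xs : List ℤ) : Prop :=
  ∃ ys, CodesReals (matrixEntries J.F ++ List.ofFn J.c ++ List.ofFn J.r ++ List.ofFn J.θ ++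
      List.ofFn J.μ) ys ∧
    xs = (n : ℤ) :: (m : ℤ) :: (K : ℤ) :: ys

/-- `xs` codes the mechanism `S`: the indices of the recommended actions, followed by fractions for
the payments. -/
def Mechanism.Codes {n m K : ℕ} (S : Mechanism n m K) (xs : List ℤ) : Prop :=
  ∃ ys, CodesReals (matrixEntries S.pay) ys ∧
    xs = (List.ofFn fun k => ((S.act k : ℕ) : ℤ)) ++ ys

/-- The accuracy `ξ` is handed to the algorithms as the number `⌈log₂ (1/ξ)⌉` (`0` if `ξ ≥ 1`). -/
noncomputable def logInv (ξ : ℝ) : ℕ := ⌈Real.logb 2 (1 / ξ)⌉₊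

end BCD

open scoped BigOperators

namespace BCD

/-! ## Bit lengths -/

/-! From single-parameter to multi-parameter there is nothing to prove beyond computability: the
instance, read as a multi-parameter one, has the same menus and utilities, so a solution is merely
copied (`single_to_multi`).

In the other direction `toSingle` separates the types by scale. Type k has unit cost X^k. Its copies
of the actions produce the outcome they have in I with probability X^-(k+1) and a new null outcome
otherwise, and they cost (c + s)·X^-(2k+1) units. For type k all payoffs from these actions are thus
those in I times X^-(k+1), up to the surcharge s. A slower type pays at least X times the comparable
cost for them, and s makes this prohibitive even for actions that are free in I. To a faster type
they are worth at most a fraction 1/X of its own scale. The type weights contain X^-(K-k), so that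
the profits from all old types enter with the common factor X^-(K+1). The remaining weight, at least
one half, belongs to a new and extremely slow type. It can collect any payment for the null outcome
by opting out, so a menu with nonnegative utility can pay almost nothing for that outcome.

The translation preserves incentives only approximately. The repair is to replace every contract p
by (1-α)p + αr and to let every type choose its best contract and action anew. By `IsMix.profit_ge`,
if the intended option is within ε of optimal for a type, the new choice costs the principal at most
ε/α, while the mixture keeps the fraction 1-α of the profit. This carries both halves of the
comparison, `opt_toSingle_ge` and `profit_of_toSingle`.

The resulting errors are additive. They become multiplicative because the optimum of I is either
zero (`opt_eq_zero`) or bounded below through a linear contract (`le_opt_of_cost_lt`). With an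
integer H above all denominators and magnitudes, the choices X = H^40, s = R/H^20 (R the sum of the
rewards) and α = 2^-ℓ/8 make all errors negligible (`approx_of_toSingle`).

On the machine side, `Comp`, `Small` and `Emits` form a calculus of polynomial-time integer
functions, polynomially bounded numbers and output lists. It is closed under arithmetic, bounded
sums and products, search and concatenation, and `Emits.runsInTime` turns its members into programs.
H stays within polynomially many bits because it is made of sums and products of input numbers and
of 2^ℓ, where ℓ itself counts towards the running time. -/

theorem size_le_of_le {a b : ℕ} (h : a ≤ b) : a.size ≤ b.size := Nat.size_le_size h

theorem one_le_bits (z : ℤ) : 1 ≤ bits z := Nat.le_add_left 1 _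

theorem bits_le_of_natAbs_le {x y : ℤ} (h : x.natAbs ≤ y.natAbs) : bits x ≤ bits y :=
  Nat.succ_le_succ (size_le_of_le h)

theorem bits_natCast_le (a : ℕ) : bits (a : ℤ) ≤ a + 1 := by
  unfold bits
  have : (a : ℤ).natAbs.size ≤ a := by
    rw [Int.natAbs_natCast, Nat.size_le]
    exact Nat.lt_two_pow_self
  omega

theorem size_add_le (a b : ℕ) : (a + b).size ≤ a.size + b.size + 1 := by
  rw [Nat.size_le]
  have ha := Nat.lt_size_self a
  have hb := Nat.lt_size_self b
  have h1 : 2 ^ a.size ≤ 2 ^ (a.size + b.size) := Nat.pow_le_pow_right (by norm_num) (by omega)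
  have h2 : 2 ^ b.size ≤ 2 ^ (a.size + b.size) := Nat.pow_le_pow_right (by norm_num) (by omega)
  rw [pow_succ]
  omega

/-- The carry is paid for by the second sign bit, so no additive constant remains and iterated
operations have linear growth in bits. -/
theorem bits_add_le (x y : ℤ) : bits (x + y) ≤ bits x + bits y := by
  unfold bits
  have h := size_le_of_le (Int.natAbs_add_le x y)
  have := size_add_le x.natAbs y.natAbs
  omega

theorem bits_neg (x : ℤ) : bits (-x) = bits x := by
  unfold bits
  rw [Int.natAbs_neg]

theorem bits_mul_le (x y : ℤ) : bits (x * y) ≤ bits x + bits y := by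
  unfold bits
  have : (x * y).natAbs.size ≤ x.natAbs.size + y.natAbs.size := by
    rw [Nat.size_le, Int.natAbs_mul, pow_add]
    exact Nat.mul_lt_mul_of_lt_of_lt (Nat.lt_size_self _) (Nat.lt_size_self _)
  omega

theorem bits_div_le (x y : ℤ) : bits (x / y) ≤ bits x :=
  bits_le_of_natAbs_le (Int.natAbs_ediv_le_natAbs x y)

theorem bits_apply_le (o : Op) (x y : ℤ) : bits (o.apply x y) ≤ bits x + bits y := by
  cases o with
  | add => exact bits_add_le x y
  | sub =>
    have := bits_add_le x (-y)
    rw [bits_neg] at this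
    simpa [Op.apply, sub_eq_add_neg] using this
  | mul => exact bits_mul_le x y
  | div => exact (bits_div_le x y).trans (Nat.le_add_right _ _)

/-! ## Contexts: a read-only input and finitely many small variables -/

/-- A value `γ : Γ` provides the read-only input cells of a computation and its first `depth`
variables. `ok γ L` says that all cells have at most `L` bits and all variables are at most `L`. -/
class Ctx (Γ : Type) where
  cell : Γ → ℕ → ℤ
  depth : ℕ
  var : Γ → ℕ → ℕ
  ok : Γ → ℕ → Prop
  ok_mono : ∀ {γ L L'}, ok γ L → L ≤ L' → ok γ L'
  ok_cell : ∀ {γ L}, ok γ L → ∀ i, bits (cell γ i) ≤ L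
  ok_var : ∀ {γ L}, ok γ L → ∀ k, k < depth → var γ k ≤ L

/-- The input of a program, the first `h` entries of which are small. -/
structure Input (h : ℕ) where
  entry : ℕ → ℤ

/-- All entries have few bits, but the entries up to `h` are small as numbers. These hold the
dimensions and the accuracy, which serve as loop bounds and exponents. -/
instance (h : ℕ) : Ctx (Input h) where
  cell x := x.entry
  depth := 0
  var _ _ := 0
  ok x L := (∀ i, bits (x.entry i) ≤ L) ∧ ∀ i, i ≤ h → (x.entry i).natAbs ≤ L
  ok_mono h hL := ⟨fun i => (h.1 i).trans hL, fun i hi => (h.2 i hi).trans hL⟩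
  ok_cell h := h.1
  ok_var _ k hk := absurd hk (Nat.not_lt_zero k)

/-- The context of a loop body: the counter is appended as the last variable, so that nested loops
correspond to iterated products with `ℕ`. -/
instance (Γ : Type) [Ctx Γ] : Ctx (Γ × ℕ) where
  cell x := Ctx.cell x.1
  depth := Ctx.depth Γ + 1
  var x k := if k = Ctx.depth Γ then x.2 else Ctx.var x.1 k
  ok x L := Ctx.ok x.1 L ∧ x.2 ≤ L
  ok_mono h hL := ⟨Ctx.ok_mono h.1 hL, h.2.trans hL⟩
  ok_cell h := Ctx.ok_cell h.1
  ok_var {γ L} h k hk := by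
    by_cases hk' : k = Ctx.depth Γ
    · simpa [hk'] using h.2
    · simpa [hk'] using Ctx.ok_var h.1 k (by omega)

/-- The address of register `i`. -/
def reg (i : ℕ) : ℤ := -(2 * i + 1)

/-- The address of cell `i` of the output buffer. -/
def out (i : ℕ) : ℤ := -(2 * i + 2)

theorem reg_injective {i j : ℕ} (h : reg i = reg j) : i = j := by
  unfold reg at h
  omega

theorem out_injective {i j : ℕ} (h : out i = out j) : i = j := by
  unfold out at h
  omega

theorem reg_ne_out (i j : ℕ) : reg i ≠ out j := by
  unfold reg out
  omega

theorem natCast_ne_reg (i j : ℕ) : (i : ℤ) ≠ reg j := by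
  unfold reg
  omega

theorem natCast_ne_out (i j : ℕ) : (i : ℤ) ≠ out j := by
  unfold out
  omega

variable {Γ : Type} [Ctx Γ]

/-- The memory `M` holds the input of `γ`, and variable `k` of `γ` in register `a k`. -/
def Represents (γ : Γ) (a : ℕ → ℕ) (M : Memory) : Prop :=
  (∀ i : ℕ, M i = Ctx.cell γ i) ∧ ∀ k, k < Ctx.depth Γ → M (reg (a k)) = Ctx.var γ k

/-- `M'` differs from `M` at most in the registers from `s` on. -/
def AgreeBelow (s : ℕ) (M M' : Memory) : Prop :=
  ∀ z, (∀ i, s ≤ i → z ≠ reg i) → M' z = M z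

theorem AgreeBelow.trans {s : ℕ} {M M' M'' : Memory} (h : AgreeBelow s M M')
    (h' : AgreeBelow s M' M'') : AgreeBelow s M M'' :=
  fun z hz => (h' z hz).trans (h z hz)

theorem AgreeBelow.mono {s s' : ℕ} {M M' : Memory} (h : AgreeBelow s' M M') (hs : s ≤ s') :
    AgreeBelow s M M' :=
  fun z hz => h z fun i hi => hz i (hs.trans hi)

theorem AgreeBelow.reg_eq {s i : ℕ} {M M' : Memory} (h : AgreeBelow s M M') (hi : i < s) :
    M' (reg i) = M (reg i) :=
  h _ fun j hj e => by
    have := reg_injective e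
    omega

theorem agreeBelow_update {s i : ℕ} (M : Memory) (v : ℤ) (hi : s ≤ i) :
    AgreeBelow s M (Function.update M (reg i) v) :=
  fun _ hz => Function.update_of_ne (hz i hi) _ _

/-- The frame rule: scratch registers lie above all allocated ones and away from the input, so a
subcomputation cannot destroy the context. -/
theorem AgreeBelow.represents {γ : Γ} {a : ℕ → ℕ} {s : ℕ} {M M' : Memory}
    (h : AgreeBelow s M M') (ha : ∀ k, k < Ctx.depth Γ → a k < s) (hM : Represents γ a M) :
    Represents γ a M' := by
  refine ⟨fun i => ?_, fun k hk => ?_⟩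
  · rw [h _ fun j _ => natCast_ne_reg i j, hM.1]
  · rw [h.reg_eq (ha k hk), hM.2 k hk]

/-- `f` can be computed in polynomial time, and its values have polynomially many bits: for every
allocation `a` of registers to variables and every `s` above it, some program that uses only the
registers from `s` on leaves the value of `f` in register `s`. -/
def Comp (f : Γ → ℤ) : Prop :=
  ∀ (a : ℕ → ℕ) (s : ℕ), (∀ k, k < Ctx.depth Γ → a k < s) →
    ∃ (p : Program) (q : Polynomial ℕ), ∀ (L : ℕ) (γ : Γ) (M : Memory), Ctx.ok γ L →
      Represents γ a M → ∃ t M', Exec p M t M' ∧ t ≤ q.eval L ∧ bits (f γ) ≤ q.eval L ∧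
        M' (reg s) = f γ ∧ AgreeBelow s M M'

/-- Natural numbers that can be computed in polynomial time and are polynomially bounded. -/
def Small (g : Γ → ℕ) : Prop :=
  Comp (fun γ => (g γ : ℤ)) ∧ ∃ q : Polynomial ℕ, ∀ L γ, Ctx.ok γ L → g γ ≤ q.eval L

theorem Comp.congr {f g : Γ → ℤ} (hf : Comp f) (h : ∀ γ, f γ = g γ) : Comp g := by
  rwa [← funext h]

theorem comp_const (z : ℤ) : Comp (fun _ : Γ => z) := by
  intro a s _
  refine ⟨.write (.const (reg s)) (.const z), Polynomial.C (1 + bits (reg s) + bits z),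
    fun L γ M _ _ => ⟨_, _, Exec.write _ _ _, ?_, ?_, ?_, ?_⟩⟩
  · simp [Expr.cost]
  · simp
  · simp [Expr.value]
  · exact agreeBelow_update M z le_rfl

theorem Comp.op {f g : Γ → ℤ} (o : Op) (hf : Comp f) (hg : Comp g) :
    Comp (fun γ => o.apply (f γ) (g γ)) := by
  intro a s ha
  obtain ⟨p, q, hp⟩ := hf a s ha
  -- The second operand is computed from register `s + 1` on, which protects the first one in
  -- register `s`.
  obtain ⟨p', q', hp'⟩ := hg a (s + 1) fun k hk => (ha k hk).trans (Nat.lt_succ_self s)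
  refine ⟨.seq p (.seq p' (.write (.const (reg s))
      (.op o (.read (.const (reg s))) (.read (.const (reg (s + 1))))))),
    3 * q + 3 * q' + Polynomial.C (1 + 2 * bits (reg s) + bits (reg (s + 1))),
    fun L γ M hL hM => ?_⟩
  obtain ⟨t, M₁, hx, ht, hb, hv, hag⟩ := hp L γ M hL hM
  obtain ⟨t', M₂, hx', ht', hb', hv', hag'⟩ := hp' L γ M₁ hL (hag.represents ha hM)
  have h0 : M₂ (reg s) = f γ := by rw [hag'.reg_eq (Nat.lt_succ_self s), hv]
  have hbo := bits_apply_le o (f γ) (g γ)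
  refine ⟨_, _, hx.seq (hx'.seq (Exec.write _ _ _)), ?_, ?_, ?_, ?_⟩
  · simp only [Expr.cost, Expr.value, h0, hv', Polynomial.eval_add, Polynomial.eval_mul,
      Polynomial.eval_C, Polynomial.eval_ofNat]
    omega
  · simp only [Polynomial.eval_add, Polynomial.eval_mul, Polynomial.eval_C, Polynomial.eval_ofNat]
    omega
  · simp [Expr.value, h0, hv']
  · exact (hag.trans (hag'.mono (Nat.le_succ s))).trans (agreeBelow_update M₂ _ le_rfl)

theorem Comp.add {f g : Γ → ℤ} (hf : Comp f) (hg : Comp g) : Comp (fun γ => f γ + g γ) :=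
  hf.op .add hg

theorem Comp.sub {f g : Γ → ℤ} (hf : Comp f) (hg : Comp g) : Comp (fun γ => f γ - g γ) :=
  hf.op .sub hg

theorem Comp.mul {f g : Γ → ℤ} (hf : Comp f) (hg : Comp g) : Comp (fun γ => f γ * g γ) :=
  hf.op .mul hg

theorem Comp.div {f g : Γ → ℤ} (hf : Comp f) (hg : Comp g) : Comp (fun γ => f γ / g γ) :=
  hf.op .div hg

theorem Comp.ite_pos {e f g : Γ → ℤ} (he : Comp e) (hf : Comp f) (hg : Comp g) :
    Comp (fun γ => if 0 < e γ then f γ else g γ) := by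
  intro a s ha
  obtain ⟨p, q, hp⟩ := he a s ha
  obtain ⟨p₁, q₁, hp₁⟩ := hf a s ha
  obtain ⟨p₂, q₂, hp₂⟩ := hg a s ha
  refine ⟨.seq p (.branch (.read (.const (reg s))) p₁ p₂),
    2 * q + q₁ + q₂ + Polynomial.C (1 + bits (reg s)), fun L γ M hL hM => ?_⟩
  obtain ⟨t, M₁, hx, ht, hb, hv, hag⟩ := hp L γ M hL hM
  have hM₁ := hag.represents ha hM
  by_cases h : 0 < e γ
  · obtain ⟨t₁, M₂, hx₁, ht₁, hb₁, hv₁, hag₁⟩ := hp₁ L γ M₁ hL hM₁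
    refine ⟨_, _, hx.seq (.branch_pos (by simpa [Expr.value, hv] using h) hx₁), ?_, ?_, ?_,
      hag.trans hag₁⟩
    · simp only [Expr.cost, Expr.value, hv, Polynomial.eval_add, Polynomial.eval_mul,
        Polynomial.eval_C, Polynomial.eval_ofNat]
      omega
    · simp only [h, if_true, Polynomial.eval_add, Polynomial.eval_mul, Polynomial.eval_C,
        Polynomial.eval_ofNat]
      omega
    · simp [h, hv₁]
  · obtain ⟨t₁, M₂, hx₁, ht₁, hb₁, hv₁, hag₁⟩ := hp₂ L γ M₁ hL hM₁
    refine ⟨_, _, hx.seq (.branch_neg (by simpa [Expr.value, hv] using h) hx₁), ?_, ?_, ?_,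
      hag.trans hag₁⟩
    · simp only [Expr.cost, Expr.value, hv, Polynomial.eval_add, Polynomial.eval_mul,
        Polynomial.eval_C, Polynomial.eval_ofNat]
      omega
    · simp only [h, if_false, Polynomial.eval_add, Polynomial.eval_mul, Polynomial.eval_C,
        Polynomial.eval_ofNat]
      omega
    · simp [h, hv₁]

theorem Comp.cell {g : Γ → ℕ} (hg : Comp (fun γ => (g γ : ℤ))) :
    Comp (fun γ => Ctx.cell γ (g γ)) := by
  intro a s ha
  obtain ⟨p, q, hp⟩ := hg a s ha
  refine ⟨.seq p (.write (.const (reg s)) (.read (.read (.const (reg s))))),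
    2 * q + Polynomial.X + Polynomial.C (1 + 2 * bits (reg s)), fun L γ M hL hM => ?_⟩
  obtain ⟨t, M₁, hx, ht, hb, hv, hag⟩ := hp L γ M hL hM
  have hM₁ := hag.represents ha hM
  have hc := Ctx.ok_cell hL (g γ)
  dsimp only at hb hv
  refine ⟨_, _, hx.seq (Exec.write _ _ _), ?_, ?_, ?_, ?_⟩
  · simp only [Expr.cost, Expr.value, hv, hM₁.1, Polynomial.eval_add, Polynomial.eval_mul,
      Polynomial.eval_C, Polynomial.eval_ofNat, Polynomial.eval_X]
    omega
  · simp only [Polynomial.eval_add, Polynomial.eval_mul, Polynomial.eval_C, Polynomial.eval_ofNat,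
      Polynomial.eval_X]
    omega
  · simp [Expr.value, hv, hM₁.1]
  · exact hag.trans (agreeBelow_update M₁ _ le_rfl)

theorem comp_var {k : ℕ} (hk : k < Ctx.depth Γ) : Comp (fun γ : Γ => (Ctx.var γ k : ℤ)) := by
  intro a s ha
  refine ⟨.write (.const (reg s)) (.read (.const (reg (a k)))),
    2 * Polynomial.X + Polynomial.C (3 + bits (reg s) + bits (reg (a k))), fun L γ M hL hM => ?_⟩
  have hb := bits_natCast_le (Ctx.var γ k)
  have hb' := Ctx.ok_var hL k hk
  refine ⟨_, _, Exec.write _ _ _, ?_, ?_, ?_, agreeBelow_update M _ le_rfl⟩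
  · simp only [Expr.cost, Expr.value, hM.2 k hk, Polynomial.eval_add, Polynomial.eval_mul,
      Polynomial.eval_ofNat, Polynomial.eval_C, Polynomial.eval_X]
    omega
  · simp only [Polynomial.eval_add, Polynomial.eval_mul, Polynomial.eval_ofNat, Polynomial.eval_C,
      Polynomial.eval_X]
    omega
  · simp [Expr.value, hM.2 k hk]

theorem small_snd : Small (fun x : Γ × ℕ => x.2) := by
  refine ⟨(comp_var (Γ := Γ × ℕ) (k := Ctx.depth Γ) (Nat.lt_succ_self _)).congr fun x => ?_,
    Polynomial.X, fun L x h => by simpa using h.2⟩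
  simp [Ctx.var]

theorem Represents.fst {x : Γ × ℕ} {a : ℕ → ℕ} {M : Memory} (h : Represents x a M) :
    Represents x.1 a M := by
  refine ⟨h.1, fun k hk => ?_⟩
  have := h.2 k (Nat.lt_succ_of_lt hk)
  rw [this]
  simp [Ctx.var, Nat.ne_of_lt hk]

/-- Entering a loop body: the register of the counter becomes the register of the new last variable.
-/
theorem Represents.snoc {γ : Γ} {a : ℕ → ℕ} {M : Memory} (h : Represents γ a M) {s i : ℕ}
    (hi : M (reg s) = i) :
    Represents (γ, i) (Function.update a (Ctx.depth Γ) s) M := by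
  refine ⟨h.1, fun k hk => ?_⟩
  by_cases hk' : k = Ctx.depth Γ
  · simp [hk', Ctx.var, hi]
  · have : k < Ctx.depth Γ + 1 := hk
    simp [hk', Ctx.var, h.2 k (by omega)]

theorem update_depth_lt {a : ℕ → ℕ} {s s' : ℕ} (ha : ∀ k, k < Ctx.depth Γ → a k < s)
    (hs : s ≤ s') (j : ℕ) (hj : j < s') :
    ∀ k, k < Ctx.depth (Γ × ℕ) → Function.update a (Ctx.depth Γ) j k < s' := by
  intro k hk
  by_cases hk' : k = Ctx.depth Γ
  · simpa [hk'] using hj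
  · have h1 : k < Ctx.depth Γ + 1 := hk
    have := ha k (by omega)
    simp [hk']
    omega

theorem Comp.fst {f : Γ → ℤ} (hf : Comp f) : Comp (fun x : Γ × ℕ => f x.1) := by
  intro a s ha
  obtain ⟨p, q, hp⟩ := hf a s fun k hk => ha k (Nat.lt_succ_of_lt hk)
  exact ⟨p, q, fun L x M hL hM => hp L x.1 M hL.1 hM.fst⟩

theorem Small.fst {g : Γ → ℕ} (hg : Small g) : Small (fun x : Γ × ℕ => g x.1) := by
  obtain ⟨hc, q, hq⟩ := hg
  exact ⟨hc.fst, q, fun L x hL => hq L x.1 hL.1⟩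

theorem small_const (n : ℕ) : Small (fun _ : Γ => n) :=
  ⟨comp_const _, Polynomial.C n, fun L γ _ => by simp⟩

theorem Small.add {f g : Γ → ℕ} (hf : Small f) (hg : Small g) : Small (fun γ => f γ + g γ) := by
  obtain ⟨hf, q, hq⟩ := hf
  obtain ⟨hg, q', hq'⟩ := hg
  refine ⟨(hf.add hg).congr fun γ => by push_cast; rfl, q + q', fun L γ h => ?_⟩
  simpa using add_le_add (hq L γ h) (hq' L γ h)

theorem Small.mul {f g : Γ → ℕ} (hf : Small f) (hg : Small g) : Small (fun γ => f γ * g γ) := by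
  obtain ⟨hf, q, hq⟩ := hf
  obtain ⟨hg, q', hq'⟩ := hg
  refine ⟨(hf.mul hg).congr fun γ => by push_cast; rfl, q * q', fun L γ h => ?_⟩
  simpa using Nat.mul_le_mul (hq L γ h) (hq' L γ h)

theorem Small.div {f g : Γ → ℕ} (hf : Small f) (hg : Small g) : Small (fun γ => f γ / g γ) := by
  obtain ⟨hf, q, hq⟩ := hf
  obtain ⟨hg, _⟩ := hg
  refine ⟨(hf.div hg).congr fun γ => by push_cast; rfl, q, fun L γ h => ?_⟩
  exact (Nat.div_le_self _ _).trans (hq L γ h)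

theorem Small.mod {f g : Γ → ℕ} (hf : Small f) (hg : Small g) : Small (fun γ => f γ % g γ) := by
  refine ⟨(hf.1.sub (hg.1.mul (hf.div hg).1)).congr fun γ => ?_, hf.2.choose, fun L γ h => ?_⟩
  · push_cast
    rw [Int.emod_def]
  · exact (Nat.mod_le _ _).trans (hf.2.choose_spec L γ h)

theorem Small.sub {f g : Γ → ℕ} (hf : Small f) (hg : Small g) : Small (fun γ => f γ - g γ) := by
  refine ⟨((hf.1.sub hg.1).ite_pos (hf.1.sub hg.1) (comp_const 0)).congr fun γ => ?_,
    hf.2.choose, fun L γ h => ?_⟩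
  · dsimp only
    split_ifs <;> omega
  · exact (Nat.sub_le _ _).trans (hf.2.choose_spec L γ h)

theorem Comp.small_toNat {f : Γ → ℤ} (hf : Comp f) (q : Polynomial ℕ)
    (hq : ∀ L γ, Ctx.ok γ L → (f γ).toNat ≤ q.eval L) : Small (fun γ => (f γ).toNat) :=
  ⟨(hf.ite_pos hf (comp_const 0)).congr fun γ => by dsimp only; split_ifs <;> omega, q, hq⟩

/-! ## Loops -/

/-- Total correctness by induction on the number of remaining iterations. The test is evaluated once
more than the body, which gives the factor `N + 1`. -/
theorem exec_loop {e : Expr} {p : Program} {N c T : ℕ} (Inv : ℕ → Memory → Prop)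
    (hstep : ∀ i M, i < N → Inv i M → 0 < e.value M ∧ e.cost M ≤ c ∧
      ∃ t M', Exec p M t M' ∧ t ≤ T ∧ Inv (i + 1) M')
    (hend : ∀ M, Inv N M → ¬ 0 < e.value M ∧ e.cost M ≤ c) {M : Memory} (h0 : Inv 0 M) :
    ∃ t M', Exec (.loop e p) M t M' ∧ t ≤ (N + 1) * (1 + c + T) ∧ Inv N M' := by
  have key : ∀ r i M, i + r = N → Inv i M →
      ∃ t M', Exec (.loop e p) M t M' ∧ t ≤ (r + 1) * (1 + c + T) ∧ Inv N M' := by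
    intro r
    induction r with
    | zero =>
      intro i M hi hM
      obtain rfl : i = N := by omega
      obtain ⟨h1, h2⟩ := hend M hM
      exact ⟨_, _, .loop_done h1, by omega, hM⟩
    | succ r ih =>
      intro i M hi hM
      obtain ⟨h1, h2, t, M', hx, ht, hM'⟩ := hstep i M (by omega) hM
      obtain ⟨t', M'', hx', ht', hM''⟩ := ih (i + 1) M' (by omega) hM'
      refine ⟨_, _, .loop_step h1 hx hx', ?_, hM''⟩
      have : (r + 1 + 1) * (1 + c + T) = (r + 1) * (1 + c + T) + (1 + c + T) := by ring
      omega
  exact key N 0 M (by omega) h0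

end BCD

namespace BCD

variable {Γ : Type} [Ctx Γ]

/-- The values of the accumulator of a loop that combines it with `b 0, b 1, …` in turn. -/
def foldOp (o : Op) (init : ℤ) (b : ℕ → ℤ) : ℕ → ℤ
  | 0 => init
  | i + 1 => o.apply (foldOp o init b i) (b i)

/-- Since `bits` is subadditive under all four operations, the accumulator gains at most `B` bits
per step. This keeps even products of polynomially many factors polynomially long. -/
theorem bits_foldOp_le (o : Op) (init : ℤ) (b : ℕ → ℤ) {B : ℕ} (N : ℕ)
    (hb : ∀ i, i < N → bits (b i) ≤ B) : bits (foldOp o init b N) ≤ bits init + N * B := by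
  induction N with
  | zero => simp [foldOp]
  | succ N ih =>
    have h1 := ih fun i hi => hb i (by omega)
    have h2 := bits_apply_le o (foldOp o init b N) (b N)
    have h3 := hb N (by omega)
    rw [foldOp, Nat.succ_mul]
    omega

/-- Reading register `i`. -/
def readReg (i : ℕ) : Expr := .read (.const (reg i))

/-- Storing in register `i`. -/
def writeReg (i : ℕ) (e : Expr) : Program := .write (.const (reg i)) e

theorem value_readReg (i : ℕ) (M : Memory) : (readReg i).value M = M (reg i) := rfl

theorem cost_readReg (i : ℕ) (M : Memory) :
    (readReg i).cost M = bits (reg i) + bits (M (reg i)) := rfl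

theorem exec_writeReg (i : ℕ) (e : Expr) (M : Memory) :
    Exec (writeReg i e) M (1 + bits (reg i) + e.cost M)
      (Function.update M (reg i) (e.value M)) :=
  Exec.write _ _ _

theorem update_reg_of_ne {i j : ℕ} (h : i ≠ j) (M : Memory) (v : ℤ) :
    Function.update M (reg j) v (reg i) = M (reg i) :=
  Function.update_of_ne (fun e => h (reg_injective e)) _ _

/-- `reg i := reg i + 1`. -/
def incrReg (i : ℕ) : Program := writeReg i (.op .add (readReg i) (.const 1))

theorem exec_incrReg (i v : ℕ) (M : Memory) (hv : M (reg i) = v) :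
    ∃ t, Exec (incrReg i) M t (Function.update M (reg i) ((v + 1 : ℕ) : ℤ)) ∧
      t ≤ 2 * bits (reg i) + 2 * v + 7 := by
  have h := exec_writeReg i (.op .add (readReg i) (.const 1)) M
  have hval : (Expr.op .add (readReg i) (.const 1)).value M = ((v + 1 : ℕ) : ℤ) := by
    simp [Expr.value, value_readReg, hv, Op.apply]
  have hcost : (Expr.op .add (readReg i) (.const 1)).cost M ≤ bits (reg i) + 2 * v + 6 := by
    have h1 := bits_natCast_le v
    have h2 := bits_natCast_le (v + 1)
    have h3 : bits 1 = 2 := rfl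
    have h4 : Op.add.apply (M (reg i)) 1 = ((v + 1 : ℕ) : ℤ) := by simp [Op.apply, hv]
    simp only [Expr.cost, cost_readReg, Expr.value, value_readReg, h4, h3]
    rw [hv]
    omega
  rw [hval] at h
  exact ⟨_, h, by omega⟩

/-- The test `reg i < reg j`. -/
def lessReg (i j : ℕ) : Expr := .op .sub (readReg j) (readReg i)

theorem value_lessReg {i j v w : ℕ} {M : Memory} (hv : M (reg i) = v) (hw : M (reg j) = w) :
    (lessReg i j).value M = (w : ℤ) - v := by
  simp [lessReg, Expr.value, value_readReg, hv, hw, Op.apply]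

theorem cost_lessReg {i j v w : ℕ} {M : Memory} (hv : M (reg i) = v) (hw : M (reg j) = w) :
    (lessReg i j).cost M ≤ bits (reg i) + bits (reg j) + 2 * v + 2 * w + 4 := by
  have h1 := bits_natCast_le v
  have h2 := bits_natCast_le w
  have h3 := bits_apply_le .sub (w : ℤ) v
  simp only [lessReg, Expr.cost, cost_readReg, value_readReg, hv, hw]
  omega

theorem Comp.foldOp {N : Γ → ℕ} {b : Γ → ℕ → ℤ} (o : Op) (init : ℤ) (hN : Small N)
    (hb : Comp fun x : Γ × ℕ => b x.1 x.2) :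
    Comp (fun γ => BCD.foldOp o init (b γ) (N γ)) := by
  intro a s ha
  obtain ⟨hNc, qB, hqB⟩ := hN
  obtain ⟨pN, qN, hpN⟩ := hNc a (s + 1) fun k hk => (ha k hk).trans (Nat.lt_succ_self s)
  obtain ⟨pb, qb, hpb⟩ := hb (Function.update a (Ctx.depth Γ) (s + 2)) (s + 3)
    (update_depth_lt ha (by omega) _ (by omega))
  -- The counter may reach `qB.eval L`, so the body runs with the size parameter `L + qB.eval L`.
  set Q : Polynomial ℕ := qb.comp (Polynomial.X + qB) with hQ
  set QA : Polynomial ℕ := Polynomial.C (bits init) + qB * Q with hQA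
  set c : ℕ := 1 + bits init + bits 0 + 2 * bits (reg s) + 4 * bits (reg (s + 2)) +
    bits (reg (s + 1)) + bits (reg (s + 3)) + 30 with hc
  -- Register `s` holds the accumulator, `s + 1` the number of iterations and `s + 2` the counter;
  -- the body works from `s + 3` on.
  refine ⟨.seq (writeReg s (.const init)) (.seq pN (.seq (writeReg (s + 2) (.const 0))
      (.loop (lessReg (s + 2) (s + 1)) (.seq pb (.seq
        (writeReg s (.op o (readReg s) (readReg (s + 3)))) (incrReg (s + 2))))))),
    2 * Polynomial.C c + qN + QA + (qB + 1) * (1 + (Polynomial.C c + 4 * qB) +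
      (3 * Q + 2 * QA + 2 * qB + Polynomial.C c)), fun L γ M hL hM => ?_⟩
  have hx0 := exec_writeReg s (.const init) M
  have hag0 : AgreeBelow s M (Function.update M (reg s) init) := agreeBelow_update M _ le_rfl
  obtain ⟨tN, M₁, hxN, htN, -, hvN, hagN⟩ :=
    hpN L γ _ hL (hag0.represents ha hM)
  have hx1 := exec_writeReg (s + 2) (.const 0) M₁
  have hag1 : AgreeBelow (s + 2) M₁ (Function.update M₁ (reg (s + 2)) 0) :=
    agreeBelow_update M₁ _ le_rfl
  have hNB := hqB L γ hL
  have hbB : ∀ i, i < N γ → bits (b γ i) ≤ Q.eval L := by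
    intro i hi
    have hok : Ctx.ok ((γ, i) : Γ × ℕ) (L + qB.eval L) :=
      ⟨Ctx.ok_mono hL (Nat.le_add_right _ _), by dsimp only; omega⟩
    -- The body is applied to a fictitious memory with counter `i`, only to extract the bound on the
    -- bits of its value.
    obtain ⟨-, -, -, -, h, -⟩ := hpb _ _ _ hok
      (((agreeBelow_update M (i : ℤ) (by omega : s ≤ s + 2)).represents ha hM).snoc (by simp))
    simpa [hQ] using h
  have hfold : ∀ i, i ≤ N γ → bits (BCD.foldOp o init (b γ) i) ≤ QA.eval L := by
    intro i hi
    have h := bits_foldOp_le o init (b γ) i fun j hj => hbB j (by omega)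
    have h' : i * Q.eval L ≤ qB.eval L * Q.eval L := Nat.mul_le_mul_right _ (by omega)
    simp only [hQA, Polynomial.eval_add, Polynomial.eval_mul, Polynomial.eval_C]
    omega
  obtain ⟨t, M', hx, ht, hI⟩ := exec_loop (e := lessReg (s + 2) (s + 1))
    (p := .seq pb (.seq (writeReg s (.op o (readReg s) (readReg (s + 3)))) (incrReg (s + 2))))
    (N := N γ) (c := c + 4 * qB.eval L) (T := 3 * Q.eval L + 2 * QA.eval L + 2 * qB.eval L + c)
    (M := Function.update M₁ (reg (s + 2)) 0)
    (fun i M' => M' (reg s) = BCD.foldOp o init (b γ) i ∧ M' (reg (s + 1)) = N γ ∧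
      M' (reg (s + 2)) = i ∧ AgreeBelow s M M')
    (by
      rintro i M' hi ⟨h1, h2, h3, h4⟩
      refine ⟨by rw [value_lessReg h3 h2]; omega, ?_, ?_⟩
      · have := cost_lessReg h3 h2
        omega
      · have hok : Ctx.ok ((γ, i) : Γ × ℕ) (L + qB.eval L) :=
          ⟨Ctx.ok_mono hL (Nat.le_add_right _ _), by dsimp only; omega⟩
        obtain ⟨t, M₂, hx, ht, hbb, hv, hag⟩ := hpb (L + qB.eval L) (γ, i) M' hok
          ((h4.represents ha hM).snoc h3)
        have e0 : M₂ (reg s) = BCD.foldOp o init (b γ) i := by rw [hag.reg_eq (by omega), h1]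
        have e1 : M₂ (reg (s + 1)) = N γ := by rw [hag.reg_eq (by omega), h2]
        have e2 : M₂ (reg (s + 2)) = i := by rw [hag.reg_eq (by omega), h3]
        have hw := exec_writeReg s (.op o (readReg s) (readReg (s + 3))) M₂
        obtain ⟨t', hx', ht'⟩ := exec_incrReg (s + 2) i
          (Function.update M₂ (reg s) ((Expr.op o (readReg s) (readReg (s + 3))).value M₂))
          (by rw [update_reg_of_ne (by omega), e2])
        refine ⟨_, _, hx.seq (hw.seq hx'), ?_, ?_, ?_, ?_, ?_⟩
        · have hQe : qb.eval (L + qB.eval L) = Q.eval L := by simp [hQ]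
          have hf := hfold i hi.le
          have hf' := hfold (i + 1) hi
          rw [BCD.foldOp] at hf'
          rw [hQe] at ht hbb
          dsimp only at hv hbb
          simp only [Expr.cost, cost_readReg, value_readReg, e0, hv]
          omega
        · rw [update_reg_of_ne (by omega), Function.update_self, BCD.foldOp]
          simp [Expr.value, value_readReg, e0, hv]
        · rw [update_reg_of_ne (by omega), update_reg_of_ne (by omega), e1]
        · simp
        · exact ((h4.trans (hag.mono (by omega))).trans (agreeBelow_update _ _ le_rfl)).trans
            (agreeBelow_update _ _ (by omega)))
    (by
      rintro M' ⟨-, h2, h3, -⟩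
      refine ⟨by rw [value_lessReg h3 h2]; omega, ?_⟩
      have := cost_lessReg h3 h2
      omega)
    (by
      refine ⟨?_, ?_, by simp, ?_⟩
      · rw [hag1.reg_eq (by omega), hagN.reg_eq (by omega), Function.update_self, BCD.foldOp]
      · rw [hag1.reg_eq (by omega), hvN]
      · exact (hag0.trans (hagN.mono (by omega))).trans (hag1.mono (by omega)))
  obtain ⟨hI1, -, -, hI4⟩ := hI
  refine ⟨_, M', hx0.seq (hxN.seq (hx1.seq hx)), ?_, ?_, hI1, hI4⟩
  · have hT := Nat.mul_le_mul_right (1 + (c + 4 * qB.eval L) +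
      (3 * Q.eval L + 2 * QA.eval L + 2 * qB.eval L + c)) (Nat.succ_le_succ hNB)
    simp only [Polynomial.eval_add, Polynomial.eval_mul, Polynomial.eval_C, Polynomial.eval_ofNat,
      Polynomial.eval_one, Expr.cost]
    simp only [Nat.succ_eq_add_one] at hT
    omega
  · have := hfold _ le_rfl
    simp only [Polynomial.eval_add, Polynomial.eval_mul, Polynomial.eval_C, Polynomial.eval_ofNat,
      Polynomial.eval_one]
    omega

theorem foldOp_add (b : ℕ → ℤ) (N : ℕ) : foldOp .add 0 b N = ∑ i ∈ Finset.range N, b i := by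
  induction N with
  | zero => rfl
  | succ N ih => rw [Finset.sum_range_succ, ← ih]; rfl

theorem foldOp_mul (b : ℕ → ℤ) (N : ℕ) : foldOp .mul 1 b N = ∏ i ∈ Finset.range N, b i := by
  induction N with
  | zero => rfl
  | succ N ih => rw [Finset.prod_range_succ, ← ih]; rfl

theorem Comp.sum {N : Γ → ℕ} {b : Γ → ℕ → ℤ} (hN : Small N)
    (hb : Comp fun x : Γ × ℕ => b x.1 x.2) :
    Comp (fun γ => ∑ i ∈ Finset.range (N γ), b γ i) :=
  (Comp.foldOp .add 0 hN hb).congr fun _ => foldOp_add _ _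

theorem Comp.prod {N : Γ → ℕ} {b : Γ → ℕ → ℤ} (hN : Small N)
    (hb : Comp fun x : Γ × ℕ => b x.1 x.2) :
    Comp (fun γ => ∏ i ∈ Finset.range (N γ), b γ i) :=
  (Comp.foldOp .mul 1 hN hb).congr fun _ => foldOp_mul _ _

theorem Comp.pow {f : Γ → ℤ} {N : Γ → ℕ} (hf : Comp f) (hN : Small N) :
    Comp (fun γ => f γ ^ N γ) :=
  (Comp.prod (b := fun γ _ => f γ) hN hf.fst).congr fun γ => by simp

end BCD

namespace BCD

/-! ### Emitting lists to the output -/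

variable {Γ : Type} [Ctx Γ]

/-- `f` can be appended to the output in polynomial time. Register `0` holds the current length of
the output. -/
def Emits (f : Γ → List ℤ) : Prop :=
  ∀ (a : ℕ → ℕ) (s : ℕ), 0 < s → (∀ k, k < Ctx.depth Γ → 0 < a k ∧ a k < s) →
    ∃ (p : Program) (q : Polynomial ℕ), ∀ (L : ℕ) (γ : Γ) (M : Memory) (w : ℕ), Ctx.ok γ L →
      Represents γ a M → M (reg 0) = w → w ≤ L → ∃ t M', Exec p M t M' ∧ t ≤ q.eval L ∧
        (f γ).length ≤ q.eval L ∧ (∀ z ∈ f γ, bits z ≤ q.eval L) ∧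
        M' (reg 0) = ((w + (f γ).length : ℕ) : ℤ) ∧
        (∀ i (h : i < (f γ).length), M' (out (w + i)) = (f γ)[i]) ∧
        ∀ z, z ≠ reg 0 → (∀ i, s ≤ i → z ≠ reg i) → (∀ i, w ≤ i → z ≠ out i) → M' z = M z

theorem Emits.congr {f g : Γ → List ℤ} (hf : Emits f) (h : ∀ γ, f γ = g γ) : Emits g := by
  rwa [← funext h]

theorem represents_of_eq {γ : Γ} {a : ℕ → ℕ} {s w : ℕ} {M M' : Memory}
    (ha : ∀ k, k < Ctx.depth Γ → 0 < a k ∧ a k < s) (hM : Represents γ a M)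
    (h : ∀ z, z ≠ reg 0 → (∀ i, s ≤ i → z ≠ reg i) → (∀ i, w ≤ i → z ≠ out i) → M' z = M z) :
    Represents γ a M' := by
  refine ⟨fun i => ?_, fun k hk => ?_⟩
  · rw [h _ (natCast_ne_reg i 0) (fun j _ => natCast_ne_reg i j) (fun j _ => natCast_ne_out i j),
      hM.1]
  · have := ha k hk
    rw [h _ (fun e => ?_) (fun j hj e => ?_) (fun j _ => reg_ne_out _ j), hM.2 k hk]
    · have := reg_injective e
      omega
    · have := reg_injective e
      omega

theorem Comp.emits {f : Γ → ℤ} (hf : Comp f) : Emits (fun γ => [f γ]) := by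
  intro a s hs ha
  obtain ⟨p, q, hp⟩ := hf a s fun k hk => (ha k hk).2
  -- The next free buffer cell `out w` has address -2 - (w + w), where w is read from register `0`.
  refine ⟨.seq p (.seq (.write (.op .sub (.const (-2)) (.op .add (readReg 0) (readReg 0)))
    (readReg s)) (incrReg 0)), 3 * q + 20 * Polynomial.X +
      Polynomial.C (4 * bits (reg 0) + bits (reg s) + 40), fun L γ M w hL hM h0 hw => ?_⟩
  obtain ⟨t, M₁, hx, ht, hb, hv, hag⟩ := hp L γ M hL hM
  have e0 : M₁ (reg 0) = w := by rw [hag.reg_eq hs, h0]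
  have hw' := Exec.write (.op .sub (.const (-2)) (.op .add (readReg 0) (readReg 0)))
    (readReg s) M₁
  have haddr : (Expr.op .sub (.const (-2)) (.op .add (readReg 0) (readReg 0))).value M₁ = out w := by
    simp only [Expr.value, value_readReg, e0, Op.apply, out]
    ring
  have hcost : (Expr.op .sub (.const (-2)) (.op .add (readReg 0) (readReg 0))).cost M₁ ≤
      2 * bits (reg 0) + 10 * L + 20 := by
    have h1 := bits_natCast_le w
    have h2 := bits_apply_le .add (w : ℤ) w
    have h3 := bits_apply_le .sub (-2 : ℤ) (Op.add.apply (w : ℤ) w)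
    have h4 : bits (-2) = 3 := rfl
    simp only [Expr.cost, Expr.value, cost_readReg, value_readReg, e0]
    omega
  rw [haddr, value_readReg, hv] at hw'
  obtain ⟨t', hx', ht'⟩ := exec_incrReg 0 w (Function.update M₁ (out w) (f γ))
    (by rw [Function.update_of_ne (reg_ne_out _ _), e0])
  refine ⟨_, _, hx.seq (hw'.seq hx'), ?_, ?_, ?_, ?_, ?_, ?_⟩
  · simp only [cost_readReg, hv, Polynomial.eval_add, Polynomial.eval_mul, Polynomial.eval_C,
      Polynomial.eval_ofNat, Polynomial.eval_X]
    omega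
  · simp only [List.length_singleton, Polynomial.eval_add, Polynomial.eval_mul, Polynomial.eval_C,
      Polynomial.eval_ofNat, Polynomial.eval_X]
    omega
  · simp only [List.mem_singleton, forall_eq, Polynomial.eval_add, Polynomial.eval_mul,
      Polynomial.eval_C, Polynomial.eval_ofNat, Polynomial.eval_X]
    omega
  · simp
  · intro i hi
    obtain rfl : i = 0 := by simpa using hi
    rw [Function.update_of_ne (reg_ne_out _ _).symm]
    simp
  · intro z h1 h2 h3
    rw [Function.update_of_ne h1, Function.update_of_ne (h3 w le_rfl), hag z h2]

theorem Emits.append {f g : Γ → List ℤ} (hf : Emits f) (hg : Emits g) :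
    Emits (fun γ => f γ ++ g γ) := by
  intro a s hs ha
  obtain ⟨p, q, hp⟩ := hf a s hs ha
  obtain ⟨p', q', hp'⟩ := hg a s hs ha
  -- The size parameter must dominate the current output length, so the second program runs with `L
  -- + q.eval L`.
  refine ⟨.seq p p', q + q'.comp (Polynomial.X + q), fun L γ M w hL hM h0 hw => ?_⟩
  obtain ⟨t, M₁, hx, ht, hlen, hb, hl, ho, hag⟩ := hp L γ M w hL hM h0 hw
  obtain ⟨t', M₂, hx', ht', hlen', hb', hl', ho', hag'⟩ := hp' (L + q.eval L) γ M₁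
    (w + (f γ).length) (Ctx.ok_mono hL (Nat.le_add_right _ _)) (represents_of_eq ha hM hag) hl
    (by omega)
  have hev : (q + q'.comp (Polynomial.X + q)).eval L = q.eval L + q'.eval (L + q.eval L) := by simp
  rw [hev]
  refine ⟨_, _, hx.seq hx', by omega, ?_, ?_, ?_, ?_, ?_⟩
  · rw [List.length_append]
    omega
  · intro z hz
    rcases List.mem_append.1 hz with h | h
    · exact (hb z h).trans (Nat.le_add_right _ _)
    · exact (hb' z h).trans (Nat.le_add_left _ _)
  · rw [hl', List.length_append, Nat.add_assoc]
  · intro i hi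
    rw [List.length_append] at hi
    by_cases h : i < (f γ).length
    · rw [List.getElem_append_left h, ← ho i h]
      refine hag' _ (reg_ne_out _ _).symm (fun j _ => (reg_ne_out _ _).symm) fun j hj e => ?_
      have := out_injective e
      omega
    · rw [List.getElem_append_right (by omega), ← ho' _ (by omega)]
      congr 2
      omega
  · intro z h1 h2 h3
    rw [hag' z h1 h2 fun i hi => h3 i (by omega), hag z h1 h2 h3]

theorem length_flatMap_range_le {f : ℕ → List ℤ} {B N : ℕ} (h : ∀ i, i < N → (f i).length ≤ B) :
    ((List.range N).flatMap f).length ≤ N * B := by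
  induction N with
  | zero => simp
  | succ N ih =>
    have h1 := ih fun i hi => h i (by omega)
    have h2 := h N (by omega)
    rw [List.range_succ, List.flatMap_append, List.length_append, Nat.succ_mul]
    simp only [List.flatMap_cons, List.flatMap_nil, List.append_nil]
    omega

theorem Emits.flatMap {N : Γ → ℕ} {f : Γ → ℕ → List ℤ} (hN : Small N)
    (hf : Emits fun x : Γ × ℕ => f x.1 x.2) :
    Emits (fun γ => (List.range (N γ)).flatMap (f γ)) := by
  intro a s hs ha
  obtain ⟨hNc, qB, hqB⟩ := hN
  obtain ⟨pN, qN, hpN⟩ := hNc a s fun k hk => (ha k hk).2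
  obtain ⟨pb, qb, hpb⟩ := hf (Function.update a (Ctx.depth Γ) (s + 1)) (s + 2) (by omega) (by
    intro k hk
    refine ⟨?_, update_depth_lt (fun k hk => (ha k hk).2) (by omega) _ (by omega) k hk⟩
    by_cases hk' : k = Ctx.depth Γ
    · simp [hk']
    · have : k < Ctx.depth Γ + 1 := hk
      simpa [hk'] using (ha k (by omega)).1)
  -- Bounding each piece by the output length before it would be circular across iterations. The
  -- piece does not depend on that length, so `ℓ` bounds it as if the output were still empty; `L'`
  -- then dominates the output length throughout the loop.
  set ℓ : Polynomial ℕ := qb.comp (Polynomial.X + qB) with hℓ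
  set L' : Polynomial ℕ := Polynomial.X + qB + qB * ℓ with hL'
  set Q : Polynomial ℕ := qb.comp L' with hQ
  set c : ℕ := 1 + bits 0 + 4 * bits (reg s) + 4 * bits (reg (s + 1)) + 30 with hc
  refine ⟨.seq pN (.seq (writeReg (s + 1) (.const 0)) (.loop (lessReg (s + 1) s)
      (.seq pb (incrReg (s + 1))))),
    2 * Polynomial.C c + qN + qB * ℓ + Q + (qB + 1) * (1 + (Polynomial.C c + 4 * qB) +
      (Q + 2 * qB + Polynomial.C c)), fun L γ M w hL hM h0 hw => ?_⟩
  obtain ⟨tN, M₁, hxN, htN, -, hvN, hagN⟩ := hpN L γ M hL hM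
  have hx1 := exec_writeReg (s + 1) (.const 0) M₁
  have hag1 : AgreeBelow (s + 1) M₁ (Function.update M₁ (reg (s + 1)) 0) :=
    agreeBelow_update M₁ _ le_rfl
  have hNB := hqB L γ hL
  have hlen : ∀ i, i < N γ → (f γ i).length ≤ ℓ.eval L := by
    intro i hi
    have hok : Ctx.ok ((γ, i) : Γ × ℕ) (L + qB.eval L) :=
      ⟨Ctx.ok_mono hL (Nat.le_add_right _ _), by dsimp only; omega⟩
    have hM' : Represents γ a (Function.update (Function.update M (reg (s + 1)) (i : ℤ))
        (reg 0) 0) := by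
      refine represents_of_eq (s := s) (w := 0) ha hM fun z h1 h2 _ => ?_
      rw [Function.update_of_ne h1, Function.update_of_ne (h2 _ (by omega))]
    obtain ⟨-, -, -, -, h, -⟩ := hpb _ _ _ 0 hok
      (hM'.snoc (by rw [update_reg_of_ne (by omega), Function.update_self])) (by simp)
      (Nat.zero_le _)
    simpa [hℓ] using h
  have hlen' : ∀ i, i ≤ N γ → ((List.range i).flatMap (f γ)).length ≤ qB.eval L * ℓ.eval L := by
    intro i hi
    exact (length_flatMap_range_le fun j hj => hlen j (by omega)).trans
      (Nat.mul_le_mul_right _ (by omega))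
  have hLe : L'.eval L = L + qB.eval L + qB.eval L * ℓ.eval L := by simp [hL']
  have hQe : qb.eval (L'.eval L) = Q.eval L := by simp [hQ]
  obtain ⟨t, M', hx, ht, hI⟩ := exec_loop (e := lessReg (s + 1) s)
    (p := .seq pb (incrReg (s + 1)))
    (N := N γ) (c := c + 4 * qB.eval L) (T := Q.eval L + 2 * qB.eval L + c)
    (M := Function.update M₁ (reg (s + 1)) 0)
    (fun i M' => M' (reg s) = N γ ∧ M' (reg (s + 1)) = i ∧
      M' (reg 0) = ((w + ((List.range i).flatMap (f γ)).length : ℕ) : ℤ) ∧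
      (∀ j (h : j < ((List.range i).flatMap (f γ)).length),
        M' (out (w + j)) = ((List.range i).flatMap (f γ))[j]) ∧
      (∀ z ∈ (List.range i).flatMap (f γ), bits z ≤ Q.eval L) ∧
      ∀ z, z ≠ reg 0 → (∀ i, s ≤ i → z ≠ reg i) → (∀ i, w ≤ i → z ≠ out i) → M' z = M z)
    (by
      rintro i M' hi ⟨h1, h2, h3, h4, hbits, h5⟩
      refine ⟨by rw [value_lessReg h2 h1]; omega, ?_, ?_⟩
      · have := cost_lessReg h2 h1
        omega
      · have hok : Ctx.ok ((γ, i) : Γ × ℕ) (L'.eval L) :=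
          ⟨Ctx.ok_mono hL (by omega), by dsimp only; omega⟩
        have hli := hlen' i hi.le
        obtain ⟨t, M₂, hx, ht, -, hb, hl, ho, hag⟩ := hpb _ (γ, i) M' _ hok
          ((represents_of_eq ha hM h5).snoc h2) h3 (by omega)
        rw [hQe] at ht hb
        dsimp only at hb hl ho
        have e1 : M₂ (reg s) = N γ := by
          rw [hag _ (fun e => by have := reg_injective e; omega)
            (fun j hj e => by have := reg_injective e; omega) (fun j _ => reg_ne_out _ _), h1]
        have e2 : M₂ (reg (s + 1)) = i := by
          rw [hag _ (fun e => by have := reg_injective e; omega)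
            (fun j hj e => by have := reg_injective e; omega) (fun j _ => reg_ne_out _ _), h2]
        obtain ⟨t', hx', ht'⟩ := exec_incrReg (s + 1) i M₂ e2
        have hr : (List.range (i + 1)).flatMap (f γ) =
            (List.range i).flatMap (f γ) ++ f γ i := by
          rw [List.range_succ, List.flatMap_append]
          simp
        refine ⟨_, _, hx.seq hx', by omega, ?_, ?_, ?_, ?_, ?_, ?_⟩
        · rw [update_reg_of_ne (by omega), e1]
        · simp
        · rw [update_reg_of_ne (by omega), hl, hr, List.length_append, Nat.add_assoc]
        · rw [hr]
          intro j hj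
          rw [Function.update_of_ne (reg_ne_out _ _).symm]
          rw [List.length_append] at hj
          by_cases h : j < ((List.range i).flatMap (f γ)).length
          · rw [List.getElem_append_left h, ← h4 j h]
            refine hag _ (reg_ne_out _ _).symm (fun j _ => (reg_ne_out _ _).symm) fun j hj e => ?_
            have := out_injective e
            omega
          · rw [List.getElem_append_right (by omega), ← ho _ (by omega)]
            congr 2
            omega
        · rw [hr]
          intro z hz
          rcases List.mem_append.1 hz with h | h
          · exact hbits z h
          · exact hb z h
        · intro z z1 z2 z3
          rw [Function.update_of_ne (z2 _ (by omega)), hag z z1 (fun j hj => z2 j (by omega))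
            (fun j hj => z3 j (by omega)), h5 z z1 z2 z3])
    (by
      rintro M' ⟨h1, h2, -⟩
      refine ⟨by rw [value_lessReg h2 h1]; omega, ?_⟩
      have := cost_lessReg h2 h1
      omega)
    (by
      refine ⟨?_, by simp, ?_, by simp, by simp, ?_⟩
      · rw [hag1.reg_eq (by omega), hvN]
      · rw [hag1.reg_eq (by omega), hagN.reg_eq (by omega), h0]
        simp
      · intro z h1 h2 h3
        rw [hag1 z fun j hj => h2 j (by omega), hagN z h2])
  obtain ⟨-, -, h3, h4, hbits, h5⟩ := hI
  refine ⟨_, M', hxN.seq (hx1.seq hx), ?_, ?_, ?_, h3, h4, h5⟩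
  · have hT := Nat.mul_le_mul_right (1 + (c + 4 * qB.eval L) +
      (Q.eval L + 2 * qB.eval L + c)) (Nat.succ_le_succ hNB)
    simp only [Polynomial.eval_add, Polynomial.eval_mul, Polynomial.eval_C, Polynomial.eval_ofNat,
      Polynomial.eval_one, Expr.cost]
    simp only [Nat.succ_eq_add_one] at hT
    omega
  · have := hlen' _ le_rfl
    simp only [Polynomial.eval_add, Polynomial.eval_mul, Polynomial.eval_C, Polynomial.eval_ofNat,
      Polynomial.eval_one]
    omega
  · intro z hz
    have := hbits z hz
    simp only [Polynomial.eval_add, Polynomial.eval_mul, Polynomial.eval_C, Polynomial.eval_ofNat,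
      Polynomial.eval_one]
    omega

/-- The input cells of the machine that is started on `xs`. -/
def inputOf (h : ℕ) (xs : List ℤ) : Input h where
  entry i := if i = 0 then (xs.length : ℤ) else xs.getD (i - 1) 0

theorem initMemory_natCast (h : ℕ) (xs : List ℤ) (i : ℕ) :
    initMemory xs i = (inputOf h xs).entry i := by
  unfold initMemory inputOf
  rcases Nat.eq_zero_or_pos i with rfl | hi
  · simp
  · have h3 : ((i : ℤ) - 1).toNat = i - 1 := by omega
    simp [h3, hi.ne']

theorem initMemory_of_neg (xs : List ℤ) {z : ℤ} (hz : z < 0) : initMemory xs z = 0 := by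
  unfold initMemory
  rw [if_neg (by omega), if_neg (by omega)]

/-- Move the output from the buffer to its final place. -/
def copyOut : Program :=
  .seq (.loop (lessReg 1 0) (.seq (.write (.op .add (readReg 1) (.const 1))
    (.read (.op .sub (.const (-2)) (.op .add (readReg 1) (readReg 1))))) (incrReg 1)))
    (.write (.const 0) (readReg 0))

theorem bitLength_le {xs : List ℤ} {B : ℕ} (h : ∀ z ∈ xs, bits z ≤ B) :
    bitLength xs ≤ xs.length * B := by
  unfold bitLength
  have := List.sum_le_card_nsmul (xs.map bits) B (by simpa using h)
  simpa using this

/-- Copying overwrites the input, which is no longer needed. The buffer and the registers have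
negative addresses and are not hit; the length goes to cell `0` last. -/
theorem exec_copyOut {ys : List ℤ} {B : ℕ} {M : Memory} (h0 : M (reg 0) = ys.length)
    (h1 : M (reg 1) = 0) (hlen : ys.length ≤ B) (hb : ∀ z ∈ ys, bits z ≤ B)
    (ho : ∀ i (h : i < ys.length), M (out i) = ys[i]) :
    ∃ t M', Exec copyOut M t M' ∧ HasOutput M' ys ∧ t ≤ 500 * (B + 1) * (B + 1) := by
  have b0 : bits (reg 0) = 2 := rfl
  have b1 : bits (reg 1) = 3 := rfl
  have b2 : bits (-2) = 3 := rfl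
  have b3 : bits 1 = 2 := rfl
  have b4 : bits 0 = 1 := rfl
  obtain ⟨t, M', hx, ht, hI⟩ := exec_loop (e := lessReg 1 0)
    (p := .seq (.write (.op .add (readReg 1) (.const 1))
      (.read (.op .sub (.const (-2)) (.op .add (readReg 1) (readReg 1))))) (incrReg 1))
    (N := ys.length) (c := 4 * B + 20) (T := 40 * B + 100) (M := M)
    (fun i M' => M' (reg 0) = ys.length ∧ M' (reg 1) = i ∧
      (∀ j (h : j < ys.length), M' (out j) = ys[j]) ∧
      ∀ j (h : j < ys.length), j < i → M' ((j : ℤ) + 1) = ys[j])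
    (by
      rintro i M' hi ⟨h1, h2, h3, h4⟩
      refine ⟨by rw [value_lessReg h2 h1]; omega, ?_, ?_⟩
      · have := cost_lessReg h2 h1
        omega
      · have hw := Exec.write (.op .add (readReg 1) (.const 1))
          (.read (.op .sub (.const (-2)) (.op .add (readReg 1) (readReg 1)))) M'
        have ha : (Expr.op .add (readReg 1) (.const 1)).value M' = ((i + 1 : ℕ) : ℤ) := by
          simp [Expr.value, value_readReg, h2, Op.apply]
        have ha' : (Expr.op .sub (.const (-2)) (.op .add (readReg 1) (readReg 1))).value M' =
            out i := by
          simp only [Expr.value, value_readReg, h2, Op.apply, out]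
          ring
        have hr : (Expr.read (.op .sub (.const (-2)) (.op .add (readReg 1) (readReg 1)))).value M' =
            ys[i] := by
          rw [Expr.value, ha', h3 i hi]
        obtain ⟨t', hx', ht'⟩ := exec_incrReg 1 i (Function.update M' ((i + 1 : ℕ) : ℤ) ys[i])
          (by rw [Function.update_of_ne (natCast_ne_reg _ _).symm, h2])
        have c1 : (Expr.op .add (readReg 1) (.const 1)).cost M' ≤ 3 * i + 20 := by
          have q1 := bits_natCast_le i
          have q2 := bits_apply_le .add (i : ℤ) 1
          simp only [Expr.cost, cost_readReg, Expr.value, value_readReg, h2]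
          omega
        have c2 : (Expr.read (.op .sub (.const (-2)) (.op .add (readReg 1)
            (readReg 1)))).cost M' ≤ 6 * i + 40 + B := by
          have q1 := bits_natCast_le i
          have q2 := bits_apply_le .add (i : ℤ) i
          have q3 := bits_apply_le .sub (-2 : ℤ) (Op.add.apply (i : ℤ) i)
          have q4 := hb ys[i] (List.getElem_mem hi)
          rw [Expr.cost, ha', h3 i hi]
          simp only [Expr.cost, cost_readReg, Expr.value, value_readReg, h2]
          omega
        rw [ha, hr] at hw
        refine ⟨_, _, hw.seq hx', by omega, ?_, by simp, ?_, ?_⟩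
        · rw [update_reg_of_ne (by omega), Function.update_of_ne (natCast_ne_reg _ _).symm, h1]
        · intro j hj
          rw [Function.update_of_ne (reg_ne_out _ _).symm,
            Function.update_of_ne (natCast_ne_out _ _).symm, h3 j hj]
        · intro j hj hji
          have hc : (j : ℤ) + 1 = ((j + 1 : ℕ) : ℤ) := by push_cast; rfl
          rw [hc, Function.update_of_ne (natCast_ne_reg _ _)]
          by_cases hji' : j = i
          · subst hji'
            simp
          · rw [Function.update_of_ne (by omega), ← hc, h4 j hj (by omega)])
    (by
      rintro M' ⟨h1, h2, -⟩
      refine ⟨by rw [value_lessReg h2 h1]; omega, ?_⟩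
      have := cost_lessReg h2 h1
      omega)
    ⟨h0, h1, ho, by omega⟩
  obtain ⟨e0, -, -, e3⟩ := hI
  refine ⟨_, _, hx.seq (Exec.write (.const 0) (readReg 0) M'), ⟨?_, ?_⟩, ?_⟩
  · simp [Expr.value, value_readReg, e0]
  · intro i hi
    rw [Function.update_of_ne (by simp only [Expr.value]; omega), e3 i hi hi]
  · have q1 := bits_natCast_le ys.length
    simp only [Expr.cost, cost_readReg, e0]
    have h3 := Nat.mul_le_mul (Nat.succ_le_succ hlen) (le_refl (1 + (4 * B + 20) + (40 * B + 100)))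
    simp only [Nat.succ_eq_add_one] at h3
    nlinarith

theorem Emits.runsInTime {h : ℕ} {f : Input h → List ℤ} (hf : Emits f) :
    ∃ (p : Program) (q : Polynomial ℕ), ∀ (xs : List ℤ) (L : ℕ), Ctx.ok (inputOf h xs) L →
      RunsInTime p xs (f (inputOf h xs)) (q.eval L) := by
  -- There are no variables yet, so the allocation is irrelevant. Scratch space starts at register
  -- `1`, because register `0` is the output length, which initial memory correctly sets to `0`.
  obtain ⟨p, q, hp⟩ := hf (fun _ => 0) 1 Nat.one_pos fun k hk => absurd hk (Nat.not_lt_zero k)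
  -- Register `1` may contain scratch data and is cleared before it serves as the copy counter.
  refine ⟨.seq p (.seq (writeReg 1 (.const 0)) copyOut),
    q + Polynomial.C (2 + bits (reg 1)) + 500 * (q + 1) * (q + 1) + q * q, fun xs L hL => ?_⟩
  obtain ⟨t, M, hx, ht, hlen, hb, hl, ho, -⟩ := hp L (inputOf h xs) (initMemory xs) 0 hL
    ⟨initMemory_natCast h xs, fun k hk => absurd hk (Nat.not_lt_zero k)⟩
    (initMemory_of_neg xs (by unfold reg; omega)) (Nat.zero_le _)
  obtain ⟨t', M', hx', hM', ht'⟩ := exec_copyOut (ys := f (inputOf h xs)) (B := q.eval L)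
    (M := Function.update M (reg 1) 0) (by rw [update_reg_of_ne (by omega), hl, Nat.zero_add])
    (by simp) hlen hb (fun i hi => by
      rw [Function.update_of_ne (reg_ne_out _ _).symm, ← ho i hi, Nat.zero_add])
  refine ⟨_, M', hx.seq ((exec_writeReg 1 (.const 0) M).seq hx'), hM', ?_⟩
  have h1 := (bitLength_le hb).trans (Nat.mul_le_mul_right _ hlen)
  have b0 : bits 0 = 1 := rfl
  simp only [Expr.cost, Polynomial.eval_add, Polynomial.eval_mul, Polynomial.eval_C,
    Polynomial.eval_ofNat, Polynomial.eval_one]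
  omega

end BCD

namespace BCD

/-! ## Reading codes -/

theorem CodesReals.length_eq {qs : List ℝ} {ys : List ℤ} (h : CodesReals qs ys) :
    ys.length = 2 * qs.length := by
  obtain ⟨fs, -, rfl, rfl⟩ := h
  induction fs with
  | nil => rfl
  | cons f fs ih =>
    simp only [List.flatMap_cons, List.length_append, List.length_cons, List.length_nil,
      List.map_cons] at ih ⊢
    omega

theorem CodesReals.getD {qs : List ℝ} {ys : List ℤ} (h : CodesReals qs ys) {p : ℕ}
    (hp : p < qs.length) :
    0 < ys.getD (2 * p + 1) 0 ∧
      qs.getD p 0 = (ys.getD (2 * p) 0 : ℝ) / (ys.getD (2 * p + 1) 0 : ℝ) := by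
  obtain ⟨fs, hfs, rfl, rfl⟩ := h
  induction fs generalizing p with
  | nil => simp at hp
  | cons f fs ih =>
    cases p with
    | zero => simpa using hfs f (by simp)
    | succ p =>
      have := ih (fun g hg => hfs g (List.mem_cons_of_mem _ hg)) (p := p) (by simpa using hp)
      have e1 : 2 * (p + 1) = 2 * p + 1 + 1 := by ring
      have e2 : 2 * (p + 1) + 1 = 2 * p + 1 + 1 + 1 := by ring
      rw [e1]
      simpa only [List.flatMap_cons, List.map_cons, List.getD_cons_succ, List.cons_append,
        List.nil_append] using this

theorem getD_ofFn {α : Type*} {a : ℕ} (f : Fin a → α) (i : Fin a) (d : α) :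
    (List.ofFn f).getD i d = f i := by
  rw [List.getD_eq_getElem _ _ (by simp)]
  simp

theorem length_flatten_ofFn {α : Type*} {a w : ℕ} (f : Fin a → List α)
    (hf : ∀ i, (f i).length = w) : (List.ofFn f).flatten.length = a * w := by
  rw [List.length_flatten, List.map_ofFn, List.sum_ofFn]
  simp [hf]

theorem getD_flatten_ofFn {α : Type*} {a w : ℕ} (f : Fin a → List α)
    (hf : ∀ i, (f i).length = w) (i : Fin a) {j : ℕ} (hj : j < w) (d : α) :
    (List.ofFn f).flatten.getD (i * w + j) d = (f i).getD j d := by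
  induction a with
  | zero => exact i.elim0
  | succ a ih =>
    rw [List.ofFn_succ, List.flatten_cons]
    cases i using Fin.cases with
    | zero =>
      rw [List.getD_append _ _ _ _ (by simp [hf, hj])]
      simp
    | succ i =>
      have e : ((i.succ : Fin (a + 1)) : ℕ) * w + j = w + (i * w + j) := by
        rw [Fin.val_succ]
        ring
      rw [e, List.getD_append_right _ _ _ _ (by rw [hf]; omega), hf, Nat.add_sub_cancel_left]
      exact ih (fun i => f i.succ) (fun i => hf _) i

theorem length_matrixEntries {a b : ℕ} (A : Fin a → Fin b → ℝ) :
    (matrixEntries A).length = a * b :=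
  length_flatten_ofFn _ fun i => by simp

theorem getD_matrixEntries {a b : ℕ} (A : Fin a → Fin b → ℝ) (i : Fin a) (j : Fin b) :
    (matrixEntries A).getD (i * b + j) 0 = A i j := by
  rw [matrixEntries, getD_flatten_ofFn _ (fun i => by simp) i j.2, getD_ofFn]

theorem mul_add_lt {a b i j : ℕ} (hi : i < a) (hj : j < b) : i * b + j < a * b := by
  calc i * b + j < i * b + b := by omega
    _ = (i + 1) * b := by ring
    _ ≤ a * b := Nat.mul_le_mul_right _ hi

/-- The value of fraction `p` of a list of fractions that starts in cell `b`. -/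
noncomputable def frac (cell : ℕ → ℤ) (b p : ℕ) : ℝ :=
  (cell (b + 2 * p) : ℝ) / (cell (b + 2 * p + 1) : ℝ)

/-- The input `cell` contains a code of `I` from cell `b` on. -/
structure MultiInstance.At {n m K : ℕ} (I : MultiInstance n m K) (cell : ℕ → ℤ) (b : ℕ) :
    Prop where
  n_eq : cell b = n
  m_eq : cell (b + 1) = m
  K_eq : cell (b + 2) = K
  den_pos : ∀ p, p < K * (n * m) + K * n + m + K → 0 < cell (b + 3 + 2 * p + 1)
  F_eq : ∀ (k : Fin K) (i : Fin n) (j : Fin m),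
    I.F k i j = frac cell (b + 3) (k * (n * m) + (i * m + j))
  c_eq : ∀ (k : Fin K) (i : Fin n), I.c k i = frac cell (b + 3) (K * (n * m) + (k * n + i))
  r_eq : ∀ j : Fin m, I.r j = frac cell (b + 3) (K * (n * m) + K * n + j)
  μ_eq : ∀ k : Fin K, I.μ k = frac cell (b + 3) (K * (n * m) + K * n + m + k)

/-- The input `cell` contains a code of `J` from cell `b` on. -/
structure SingleInstance.At {n m K : ℕ} (J : SingleInstance n m K) (cell : ℕ → ℤ) (b : ℕ) :
    Prop where
  n_eq : cell b = n
  m_eq : cell (b + 1) = m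
  K_eq : cell (b + 2) = K
  den_pos : ∀ p, p < n * m + n + m + K + K → 0 < cell (b + 3 + 2 * p + 1)
  F_eq : ∀ (i : Fin n) (j : Fin m), J.F i j = frac cell (b + 3) (i * m + j)
  c_eq : ∀ i : Fin n, J.c i = frac cell (b + 3) (n * m + i)
  r_eq : ∀ j : Fin m, J.r j = frac cell (b + 3) (n * m + n + j)
  θ_eq : ∀ k : Fin K, J.θ k = frac cell (b + 3) (n * m + n + m + k)
  μ_eq : ∀ k : Fin K, J.μ k = frac cell (b + 3) (n * m + n + m + K + k)

/-- The input `cell` contains a code of `S` from cell `b` on (of which only the payments are read). -/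
structure Mechanism.At {n m K : ℕ} (S : Mechanism n m K) (cell : ℕ → ℤ) (b : ℕ) : Prop where
  den_pos : ∀ p, p < K * m → 0 < cell (b + K + 2 * p + 1)
  pay_eq : ∀ (k : Fin K) (j : Fin m), S.pay k j = frac cell (b + K) (k * m + j)

theorem frac_eq_of_codesReals {qs : List ℝ} {ys : List ℤ} (h : CodesReals qs ys)
    {cell : ℕ → ℤ} {b : ℕ} (hc : ∀ q, q < ys.length → cell (b + q) = ys.getD q 0) {p : ℕ}
    (hp : p < qs.length) : 0 < cell (b + 2 * p + 1) ∧ frac cell b p = qs.getD p 0 := by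
  have hl := h.length_eq
  obtain ⟨h1, h2⟩ := h.getD hp
  rw [frac, Nat.add_assoc, hc _ (by omega), hc _ (by omega), h2]
  exact ⟨h1, rfl⟩

theorem MultiInstance.Codes.length_eq {n m K : ℕ} {I : MultiInstance n m K} {xs : List ℤ}
    (h : I.Codes xs) : xs.length = 3 + 2 * (K * (n * m) + K * n + m + K) := by
  obtain ⟨ys, hy, rfl⟩ := h
  have := hy.length_eq
  simp only [List.length_append, List.length_ofFn, length_matrixEntries,
    length_flatten_ofFn _ (fun k => length_matrixEntries (I.F k))] at this
  simp only [List.length_cons, this]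
  ring

theorem SingleInstance.Codes.length_eq {n m K : ℕ} {J : SingleInstance n m K} {xs : List ℤ}
    (h : J.Codes xs) : xs.length = 3 + 2 * (n * m + n + m + K + K) := by
  obtain ⟨ys, hy, rfl⟩ := h
  have := hy.length_eq
  simp only [List.length_append, List.length_ofFn, length_matrixEntries] at this
  simp only [List.length_cons, this]
  ring

theorem Mechanism.Codes.length_eq {n m K : ℕ} {S : Mechanism n m K} {xs : List ℤ}
    (h : S.Codes xs) : xs.length = K + 2 * (K * m) := by
  obtain ⟨ys, hy, rfl⟩ := h
  have := hy.length_eq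
  simp only [length_matrixEntries] at this
  simp [this]

/-- Replaces the concatenated list by explicit cell addresses, the form in which programs access an
instance. The offset `b` allows the code to stand behind the accuracy parameter. -/
theorem MultiInstance.Codes.at {n m K : ℕ} {I : MultiInstance n m K} {xs : List ℤ}
    (h : I.Codes xs) {cell : ℕ → ℤ} {b : ℕ}
    (hc : ∀ q, q < xs.length → cell (b + q) = xs.getD q 0) : I.At cell b := by
  obtain ⟨ys, hy, rfl⟩ := h
  have hys : ∀ q, q < ys.length → cell (b + 3 + q) = ys.getD q 0 := by
    intro q hq
    have := hc (q + 3) (by simpa using hq)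
    rw [show b + (q + 3) = b + 3 + q by ring] at this
    simpa using this
  have hf := fun {p} => frac_eq_of_codesReals hy hys (p := p)
  have hl : ((List.ofFn fun k => matrixEntries (I.F k)).flatten).length = K * (n * m) :=
    length_flatten_ofFn _ fun k => length_matrixEntries (I.F k)
  have hl' := length_matrixEntries I.c
  simp only [List.length_append, hl, hl', List.length_ofFn] at hf
  refine ⟨by simpa using hc 0 (by simp), by simpa using hc 1 (by simp),
    by simpa using hc 2 (by simp), fun p hp => (hf hp).1, fun k i j => ?_, fun k i => ?_,
    fun j => ?_, fun k => ?_⟩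
  · have hp := mul_add_lt k.2 (mul_add_lt i.2 j.2)
    rw [(hf (by omega)).2, List.getD_append _ _ _ _ (by simp only [List.length_append, hl]; omega),
      List.getD_append _ _ _ _ (by simp only [List.length_append, hl]; omega),
      List.getD_append _ _ _ _ (by simp only [hl]; omega),
      getD_flatten_ofFn _ (fun k => length_matrixEntries (I.F k)) k (mul_add_lt i.2 j.2),
      getD_matrixEntries]
  · have hp := mul_add_lt k.2 i.2
    rw [(hf (by omega)).2,
      List.getD_append _ _ _ _ (by simp only [List.length_append, hl, hl']; omega),
      List.getD_append _ _ _ _ (by simp only [List.length_append, hl, hl']; omega),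
      List.getD_append_right _ _ _ _ (by simp only [hl]; omega), hl, Nat.add_sub_cancel_left,
      getD_matrixEntries]
  · have hp := j.2
    rw [(hf (by omega)).2,
      List.getD_append _ _ _ _ (by simp only [List.length_append, hl, hl', List.length_ofFn]; omega),
      List.getD_append_right _ _ _ _ (by simp only [List.length_append, hl, hl']; omega),
      List.length_append, hl, hl', Nat.add_sub_cancel_left, getD_ofFn]
  · have hp := k.2
    rw [(hf (by omega)).2, List.getD_append_right _ _ _ _
        (by simp only [List.length_append, hl, hl', List.length_ofFn]; omega),
      List.length_append, List.length_append, hl, hl', List.length_ofFn, Nat.add_sub_cancel_left,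
      getD_ofFn]

theorem SingleInstance.Codes.at {n m K : ℕ} {J : SingleInstance n m K} {xs : List ℤ}
    (h : J.Codes xs) {cell : ℕ → ℤ} {b : ℕ}
    (hc : ∀ q, q < xs.length → cell (b + q) = xs.getD q 0) : J.At cell b := by
  obtain ⟨ys, hy, rfl⟩ := h
  have hys : ∀ q, q < ys.length → cell (b + 3 + q) = ys.getD q 0 := by
    intro q hq
    have := hc (q + 3) (by simpa using hq)
    rw [show b + (q + 3) = b + 3 + q by ring] at this
    simpa using this
  have hf := fun {p} => frac_eq_of_codesReals hy hys (p := p)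
  have hl := length_matrixEntries J.F
  simp only [List.length_append, hl, List.length_ofFn] at hf
  refine ⟨by simpa using hc 0 (by simp), by simpa using hc 1 (by simp),
    by simpa using hc 2 (by simp), fun p hp => (hf hp).1, fun i j => ?_, fun i => ?_,
    fun j => ?_, fun k => ?_, fun k => ?_⟩
  · have hp := mul_add_lt i.2 j.2
    rw [(hf (by omega)).2,
      List.getD_append _ _ _ _ (by simp only [List.length_append, hl, List.length_ofFn]; omega),
      List.getD_append _ _ _ _ (by simp only [List.length_append, hl, List.length_ofFn]; omega),
      List.getD_append _ _ _ _ (by simp only [List.length_append, hl, List.length_ofFn]; omega),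
      List.getD_append _ _ _ _ (by simp only [hl]; omega), getD_matrixEntries]
  · have hp := i.2
    rw [(hf (by omega)).2,
      List.getD_append _ _ _ _ (by simp only [List.length_append, hl, List.length_ofFn]; omega),
      List.getD_append _ _ _ _ (by simp only [List.length_append, hl, List.length_ofFn]; omega),
      List.getD_append _ _ _ _ (by simp only [List.length_append, hl, List.length_ofFn]; omega),
      List.getD_append_right _ _ _ _ (by simp only [hl]; omega), hl, Nat.add_sub_cancel_left,
      getD_ofFn]
  · have hp := j.2
    rw [(hf (by omega)).2,
      List.getD_append _ _ _ _ (by simp only [List.length_append, hl, List.length_ofFn]; omega),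
      List.getD_append _ _ _ _ (by simp only [List.length_append, hl, List.length_ofFn]; omega),
      List.getD_append_right _ _ _ _ (by simp only [List.length_append, hl, List.length_ofFn]; omega),
      List.length_append, hl, List.length_ofFn, Nat.add_sub_cancel_left, getD_ofFn]
  · have hp := k.2
    rw [(hf (by omega)).2,
      List.getD_append _ _ _ _ (by simp only [List.length_append, hl, List.length_ofFn]; omega),
      List.getD_append_right _ _ _ _ (by simp only [List.length_append, hl, List.length_ofFn]; omega),
      List.length_append, List.length_append, hl, List.length_ofFn, List.length_ofFn,
      Nat.add_sub_cancel_left, getD_ofFn]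
  · have hp := k.2
    rw [(hf (by omega)).2,
      List.getD_append_right _ _ _ _ (by simp only [List.length_append, hl, List.length_ofFn]; omega),
      List.length_append, List.length_append, List.length_append, hl, List.length_ofFn,
      List.length_ofFn, List.length_ofFn, Nat.add_sub_cancel_left, getD_ofFn]

theorem Mechanism.Codes.at {n m K : ℕ} {S : Mechanism n m K} {xs : List ℤ}
    (h : S.Codes xs) {cell : ℕ → ℤ} {b : ℕ}
    (hc : ∀ q, q < xs.length → cell (b + q) = xs.getD q 0) : S.At cell b := by
  obtain ⟨ys, hy, rfl⟩ := h
  have hys : ∀ q, q < ys.length → cell (b + K + q) = ys.getD q 0 := by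
    intro q hq
    have := hc (K + q) (by simpa using hq)
    rw [← Nat.add_assoc] at this
    rw [this, List.getD_append_right _ _ _ _ (by simp)]
    simp
  have hf := fun {p} => frac_eq_of_codesReals hy hys (p := p)
  simp only [length_matrixEntries] at hf
  refine ⟨fun p hp => (hf hp).1, fun k j => ?_⟩
  rw [(hf (mul_add_lt k.2 j.2)).2, getD_matrixEntries]

/-! ## Writing codes -/

theorem CodesReals.append {qs qs' : List ℝ} {ys ys' : List ℤ} (h : CodesReals qs ys)
    (h' : CodesReals qs' ys') : CodesReals (qs ++ qs') (ys ++ ys') := by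
  obtain ⟨fs, h1, rfl, rfl⟩ := h
  obtain ⟨fs', h1', rfl, rfl⟩ := h'
  refine ⟨fs ++ fs', fun f hf => ?_, by simp, by simp⟩
  rcases List.mem_append.1 hf with h | h
  · exact h1 f h
  · exact h1' f h

theorem codesReals_singleton {q : ℝ} {a b : ℤ} (hb : 0 < b) (h : q = (a : ℝ) / b) :
    CodesReals [q] [a, b] :=
  ⟨[(a, b)], by simpa using hb, by simp [h], by simp⟩

theorem codesReals_nil : CodesReals [] [] := ⟨[], by simp, rfl, rfl⟩

theorem codesReals_flatten_ofFn {a : ℕ} {f : Fin a → List ℝ} {g : ℕ → List ℤ}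
    (h : ∀ i : Fin a, CodesReals (f i) (g i)) :
    CodesReals (List.ofFn f).flatten ((List.range a).flatMap g) := by
  induction a with
  | zero => simpa using codesReals_nil
  | succ a ih =>
    rw [List.ofFn_succ_last, List.range_succ, List.flatten_append, List.flatMap_append]
    refine (ih fun i => h i.castSucc).append ?_
    simpa using h (Fin.last a)

theorem flatten_ofFn_singleton {α : Type*} {a : ℕ} (f : Fin a → α) :
    (List.ofFn fun i => [f i]).flatten = List.ofFn f := by
  have e : (List.ofFn fun i => [f i]) = (List.ofFn f).map fun x => [x] := by
    rw [List.map_ofFn]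
    rfl
  rw [e, ← List.flatMap_def, List.flatMap_singleton']

theorem codesReals_ofFn {a : ℕ} {f : Fin a → ℝ} {g : ℕ → List ℤ}
    (h : ∀ i : Fin a, CodesReals [f i] (g i)) :
    CodesReals (List.ofFn f) ((List.range a).flatMap g) := by
  rw [← flatten_ofFn_singleton]
  exact codesReals_flatten_ofFn h

theorem codesReals_matrixEntries {a b : ℕ} {A : Fin a → Fin b → ℝ} {g : ℕ → ℕ → List ℤ}
    (h : ∀ (i : Fin a) (j : Fin b), CodesReals [A i j] (g i j)) :
    CodesReals (matrixEntries A) ((List.range a).flatMap fun i => (List.range b).flatMap (g i)) :=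
  codesReals_flatten_ofFn fun i => codesReals_ofFn (h i)

end BCD

namespace BCD

/-! ### Utilities, optima and mixtures with the rewards -/

namespace MultiInstance

variable {n m K : ℕ} (I : MultiInstance n m K)

/-- Feasible menus, or feasible single contracts if `single` holds. -/
def Feasible (single : Prop) (S : Mechanism n m K) : Prop :=
  I.IsMenu S ∧ (single → ∀ k k', S.pay k = S.pay k')

/-- The optimal value over the mechanisms that are feasible in the sense of `Feasible`. -/
noncomputable def opt (single : Prop) : ℝ :=
  sSup {u | ∃ S, I.Feasible single S ∧ u = I.principalUtility S}

/-- Treating "single" as a proposition lets one argument cover menus and single contracts; all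
constructions below send equal contracts to equal contracts. -/
theorem isApproxMenu_iff (β : ℝ) (S : Mechanism n m K) :
    I.IsApproxMenu β S ↔ I.Feasible False S ∧ β * I.opt False ≤ I.principalUtility S := by
  simp [IsApproxMenu, Feasible, opt, optMenu]

theorem isApproxSingle_iff (β : ℝ) (S : Mechanism n m K) :
    I.IsApproxSingle β S ↔ I.Feasible True S ∧ β * I.opt True ≤ I.principalUtility S := by
  simp [IsApproxSingle, Feasible, opt, optSingle, IsSingleContract]

/-- The expected reward of an action. -/
def reward (k : Fin K) (i : Fin n) : ℝ := ∑ j, I.F k i j * I.r j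

/-- The expected payment of a contract for an action. -/
def payment (k : Fin K) (i : Fin n) (p : Fin m → ℝ) : ℝ := ∑ j, I.F k i j * p j

/-- An upper bound on all rewards. -/
def totalReward : ℝ := ∑ j, I.r j

/-- An upper bound on all costs. -/
def totalCost : ℝ := ∑ k, ∑ i, I.c k i

theorem agentUtility_eq (k : Fin K) (p : Fin m → ℝ) (i : Fin n) :
    I.agentUtility k p i = I.payment k i p - I.c k i := rfl

theorem principalUtility_eq (S : Mechanism n m K) : I.principalUtility S =
    ∑ k, I.μ k * (I.reward k (S.act k) - I.payment k (S.act k) (S.pay k)) := by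
  simp only [principalUtility, reward, payment, mul_sub, Finset.sum_sub_distrib]

theorem F_le_one (k : Fin K) (i : Fin n) (j : Fin m) : I.F k i j ≤ 1 := by
  rw [← I.F_sum k i]
  exact Finset.single_le_sum (fun j _ => I.F_nonneg k i j) (Finset.mem_univ j)

theorem reward_nonneg (k : Fin K) (i : Fin n) : 0 ≤ I.reward k i :=
  Finset.sum_nonneg fun j _ => mul_nonneg (I.F_nonneg k i j) (I.r_nonneg j)

theorem reward_le (k : Fin K) (i : Fin n) : I.reward k i ≤ I.totalReward :=
  Finset.sum_le_sum fun j _ => mul_le_of_le_one_left (I.r_nonneg j) (I.F_le_one k i j)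

theorem totalReward_nonneg : 0 ≤ I.totalReward := Finset.sum_nonneg fun j _ => I.r_nonneg j

theorem totalCost_nonneg : 0 ≤ I.totalCost :=
  Finset.sum_nonneg fun k _ => Finset.sum_nonneg fun i _ => I.c_nonneg k i

theorem c_le_totalCost (k : Fin K) (i : Fin n) : I.c k i ≤ I.totalCost :=
  (Finset.single_le_sum (fun i _ => I.c_nonneg k i) (Finset.mem_univ i)).trans
    (Finset.single_le_sum (f := fun k => ∑ i, I.c k i)
      (fun k _ => Finset.sum_nonneg fun i _ => I.c_nonneg k i) (Finset.mem_univ k))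

theorem payment_nonneg (k : Fin K) (i : Fin n) {p : Fin m → ℝ} (hp : ∀ j, 0 ≤ p j) :
    0 ≤ I.payment k i p :=
  Finset.sum_nonneg fun j _ => mul_nonneg (I.F_nonneg k i j) (hp j)

theorem payment_le (k : Fin K) (i : Fin n) {p : Fin m → ℝ} {P : ℝ} (hp : ∀ j, p j ≤ P) :
    I.payment k i p ≤ P := by
  calc I.payment k i p ≤ ∑ j, I.F k i j * P :=
        Finset.sum_le_sum fun j _ => mul_le_mul_of_nonneg_left (hp j) (I.F_nonneg k i j)
    _ = P := by rw [← Finset.sum_mul, I.F_sum, one_mul]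

theorem payment_mix (k : Fin K) (i : Fin n) (α : ℝ) (p : Fin m → ℝ) :
    I.payment k i (fun j => (1 - α) * p j + α * I.r j) =
      (1 - α) * I.payment k i p + α * I.reward k i := by
  simp only [payment, reward, Finset.mul_sum, ← Finset.sum_add_distrib]
  exact Finset.sum_congr rfl fun j _ => by ring

theorem weighted_sum_le {f : Fin K → ℝ} {B : ℝ} (h : ∀ k, f k ≤ B) : ∑ k, I.μ k * f k ≤ B := by
  calc ∑ k, I.μ k * f k ≤ ∑ k, I.μ k * B :=
        Finset.sum_le_sum fun k _ => mul_le_mul_of_nonneg_left (h k) (I.μ_pos k).le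
    _ = B := by rw [← Finset.sum_mul, I.μ_sum, one_mul]

theorem weighted_sum_sub (f : Fin K → ℝ) (e : ℝ) :
    ∑ k, I.μ k * (f k - e) = ∑ k, I.μ k * f k - e := by
  simp only [mul_sub, Finset.sum_sub_distrib]
  rw [← Finset.sum_mul, I.μ_sum, one_mul]

theorem weighted_sum_mono {f g : Fin K → ℝ} (h : ∀ k, f k ≤ g k) :
    ∑ k, I.μ k * f k ≤ ∑ k, I.μ k * g k :=
  Finset.sum_le_sum fun k _ => mul_le_mul_of_nonneg_left (h k) (I.μ_pos k).le

/-- If a weighted mean of numbers at most `B` is nonnegative, none of them is very negative. -/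
theorem neg_le_of_weighted_sum_nonneg {f : Fin K → ℝ} {B d : ℝ} (hB : 0 ≤ B) (hd : 0 ≤ d)
    (hμ : ∀ k, 1 ≤ d * I.μ k) (h : ∀ k, f k ≤ B) (h0 : 0 ≤ ∑ k, I.μ k * f k) (k : Fin K) :
    -(B * d) ≤ f k := by
  by_contra! hk
  have hfk : f k < 0 := lt_of_lt_of_le hk (by nlinarith)
  have hrest : ∑ k' ∈ Finset.univ.erase k, I.μ k' * f k' ≤ B := by
    calc _ ≤ ∑ k' ∈ Finset.univ.erase k, I.μ k' * B :=
          Finset.sum_le_sum fun k _ => mul_le_mul_of_nonneg_left (h k) (I.μ_pos k).le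
      _ ≤ ∑ k', I.μ k' * B := Finset.sum_le_sum_of_subset_of_nonneg (Finset.erase_subset _ _)
          fun k _ _ => mul_nonneg (I.μ_pos k).le hB
      _ = B := by rw [← Finset.sum_mul, I.μ_sum, one_mul]
  rw [← Finset.add_sum_erase _ _ (Finset.mem_univ k)] at h0
  have h2 : 0 ≤ d * (I.μ k * f k + B) := mul_nonneg hd (by linarith)
  have h3 := mul_le_mul_of_nonneg_right (hμ k) (neg_nonneg.2 hfk.le)
  nlinarith

theorem principalUtility_le {S : Mechanism n m K} (hS : I.IsMenu S) :
    I.principalUtility S ≤ I.totalReward := by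
  rw [principalUtility_eq]
  refine I.weighted_sum_le fun k => ?_
  have h1 := I.reward_le k (S.act k)
  have h2 := I.payment_nonneg k (S.act k) (hS.2 k)
  linarith

theorem le_opt {single : Prop} {S : Mechanism n m K} (hS : I.Feasible single S) :
    I.principalUtility S ≤ I.opt single := by
  refine le_csSup ⟨I.totalReward, ?_⟩ ⟨S, hS, rfl⟩
  rintro _ ⟨S', hS', rfl⟩
  exact I.principalUtility_le hS'.1

/-- Paying nothing and recommending the opt-out action. -/
def zeroMechanism : Mechanism n m K where
  pay _ _ := 0
  act _ := ⟨0, I.n_pos⟩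

theorem feasible_zeroMechanism (single : Prop) : I.Feasible single I.zeroMechanism := by
  refine ⟨⟨fun k k' i => ?_, fun _ _ => le_rfl⟩, fun _ _ _ => rfl⟩
  simp [agentUtility, zeroMechanism, I.opt_out, I.c_nonneg]

theorem principalUtility_zeroMechanism_nonneg : 0 ≤ I.principalUtility I.zeroMechanism := by
  rw [principalUtility_eq]
  refine Finset.sum_nonneg fun k _ => mul_nonneg (I.μ_pos k).le ?_
  have := I.reward_nonneg k (I.zeroMechanism.act k)
  simpa [payment, zeroMechanism] using this

theorem opt_nonneg (single : Prop) : 0 ≤ I.opt single :=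
  I.principalUtility_zeroMechanism_nonneg.trans (I.le_opt (I.feasible_zeroMechanism single))

/-- The zero mechanism makes the set of utilities nonempty, without which the real supremum would be
a default value. -/
theorem opt_le {single : Prop} {B : ℝ}
    (h : ∀ S, I.Feasible single S → I.principalUtility S ≤ B) : I.opt single ≤ B := by
  refine csSup_le ⟨_, I.zeroMechanism, I.feasible_zeroMechanism single, rfl⟩ ?_
  rintro _ ⟨S, hS, rfl⟩
  exact h S hS

theorem agentUtility_nonneg {S : Mechanism n m K} (hS : I.IsMenu S) (k : Fin K) :
    0 ≤ I.agentUtility k (S.pay k) (S.act k) := by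
  refine le_trans ?_ (hS.1 k k ⟨0, I.n_pos⟩)
  rw [agentUtility_eq, I.opt_out, sub_zero]
  exact I.payment_nonneg k _ (hS.2 k)

/-- The contracts of `S` are mixtures of contracts `P k'` and the rewards, and every type is assigned
one of the mixtures and an action that are optimal for it. -/
structure IsMix (α : ℝ) (P : Fin K → Fin m → ℝ) (σ : Fin K → Fin K) (S : Mechanism n m K) :
    Prop where
  pay_eq : ∀ k j, S.pay k j = (1 - α) * P (σ k) j + α * I.r j
  best : ∀ k k' i, (1 - α) * I.payment k i (P k') + α * I.reward k i - I.c k i ≤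
    (1 - α) * I.payment k (S.act k) (P (σ k)) + α * I.reward k (S.act k) - I.c k (S.act k)

variable {I} {α : ℝ} {P : Fin K → Fin m → ℝ} {σ : Fin K → Fin K} {S : Mechanism n m K}

theorem IsMix.pay_eq' (h : I.IsMix α P σ S) (k : Fin K) :
    S.pay k = fun j => (1 - α) * P (σ k) j + α * I.r j := funext (h.pay_eq k)

/-- Each type chooses among all mixtures and all actions, so misreports and disobedience are already
among the options that it rejected. -/
theorem IsMix.feasible (h : I.IsMix α P σ S) {single : Prop} (h0 : 0 ≤ α) (h1 : α ≤ 1)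
    (hP : ∀ k j, 0 ≤ P k j) (hs : single → ∀ k k', P k = P k') : I.Feasible single S := by
  refine ⟨⟨fun k k' i => ?_, fun k j => ?_⟩, fun hsing k k' => ?_⟩
  · rw [agentUtility_eq, agentUtility_eq, h.pay_eq', h.pay_eq', payment_mix, payment_mix]
    exact h.best k (σ k') i
  · rw [h.pay_eq]
    exact add_nonneg (mul_nonneg (by linarith) (hP _ _)) (mul_nonneg h0 (I.r_nonneg j))
  · rw [h.pay_eq', h.pay_eq', hs hsing (σ k) (σ k')]

/-- Mixing gives away a fraction `α` of the principal's margin, since r - ((1-α)p + αr) = (1-α)(r -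
p). -/
theorem IsMix.principalUtility_eq (h : I.IsMix α P σ S) : I.principalUtility S =
    (1 - α) * ∑ k, I.μ k * (I.reward k (S.act k) - I.payment k (S.act k) (P (σ k))) := by
  rw [MultiInstance.principalUtility_eq, Finset.mul_sum]
  refine Finset.sum_congr rfl fun k _ => ?_
  rw [h.pay_eq', payment_mix]
  ring

variable (I) in
-- A type has finitely many pairs of contract and action, so a best one exists.
theorem exists_isMix (α : ℝ) (P : Fin K → Fin m → ℝ) : ∃ σ S, I.IsMix α P σ S := by
  have : ∀ k : Fin K, ∃ o : Fin K × Fin n, ∀ o' : Fin K × Fin n,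
      (1 - α) * I.payment k o'.2 (P o'.1) + α * I.reward k o'.2 - I.c k o'.2 ≤
        (1 - α) * I.payment k o.2 (P o.1) + α * I.reward k o.2 - I.c k o.2 := by
    intro k
    have : Nonempty (Fin K × Fin n) := ⟨(k, ⟨0, I.n_pos⟩)⟩
    exact Finite.exists_max fun o : Fin K × Fin n =>
      (1 - α) * I.payment k o.2 (P o.1) + α * I.reward k o.2 - I.c k o.2
  choose o ho using this
  exact ⟨fun k => (o k).1, ⟨fun k j => (1 - α) * P (o k).1 j + α * I.r j, fun k => (o k).2⟩,
    fun _ _ => rfl, fun k k' i => ho k (k', i)⟩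

/-- Compared with another option of the same type, the assigned one does not decrease the profit of
the principal by much, unless the other option is much worse for the type. -/
theorem IsMix.profit_ge (h : I.IsMix α P σ S) (k k' : Fin K) (i : Fin n) :
    α * (I.reward k i - I.payment k i (P k')) + I.agentUtility k (P k') i ≤
      α * (I.reward k (S.act k) - I.payment k (S.act k) (P (σ k))) +
        I.agentUtility k (P (σ k)) (S.act k) := by
  have := h.best k k' i
  rw [agentUtility_eq, agentUtility_eq]
  linarith

theorem K_pos (I : MultiInstance n m K) : 0 < K := by
  rcases Nat.eq_zero_or_pos K with rfl | h
  · have := I.μ_sum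
    simp at this
  · exact h

theorem m_pos (I : MultiInstance n m K) : 0 < m := by
  rcases Nat.eq_zero_or_pos m with rfl | h
  · have := I.F_sum ⟨0, I.K_pos⟩ ⟨0, I.n_pos⟩
    simp at this
  · exact h

/-- A type of probability at least 1/d that received a huge expected payment would cause a loss that
the others, each worth at most the total reward, could not make up for. -/
theorem payment_le_of_utility_nonneg (I : MultiInstance n m K) {single : Prop} {S : Mechanism n m K}
    (hS : I.Feasible single S) (hU : 0 ≤ I.principalUtility S) {d : ℝ} (hd : 0 ≤ d)
    (hμ : ∀ k, 1 ≤ d * I.μ k) (k : Fin K) :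
    I.payment k (S.act k) (S.pay k) ≤ I.totalReward * (1 + d) := by
  rw [MultiInstance.principalUtility_eq] at hU
  have := I.neg_le_of_weighted_sum_nonneg I.totalReward_nonneg hd hμ (fun k => by
    have h1 := I.reward_le k (S.act k)
    have h2 := I.payment_nonneg k (S.act k) (hS.1.2 k)
    linarith) hU k
  have h1 := I.reward_le k (S.act k)
  linarith

/-- Very large payments can be cut: they are never made. -/
theorem exists_bounded (I : MultiInstance n m K) {single : Prop} {S : Mechanism n m K}
    (hS : I.Feasible single S) (hU : 0 ≤ I.principalUtility S) {d : ℝ} (hd : 0 ≤ d)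
    (hμ : ∀ k, 1 ≤ d * I.μ k) (hF : ∀ k i j, I.F k i j ≠ 0 → 1 ≤ d * I.F k i j) :
    ∃ S', I.Feasible single S' ∧ I.principalUtility S' = I.principalUtility S ∧
      ∀ k j, S'.pay k j ≤ I.totalReward * (1 + d) * d := by
  set B := I.totalReward * (1 + d) * d with hB
  have hB0 : 0 ≤ B := mul_nonneg (mul_nonneg I.totalReward_nonneg (by linarith)) hd
  -- An outcome of positive probability has probability at least 1/d, so its payment is at most d
  -- times the expected payment and lies below the cutoff; outcomes of probability zero do not
  -- count.
  have hcut : ∀ k j, I.F k (S.act k) j * min (S.pay k j) B = I.F k (S.act k) j * S.pay k j := by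
    intro k j
    by_cases hz : I.F k (S.act k) j = 0
    · simp [hz]
    · congr 1
      refine min_eq_left ?_
      have h1 : I.F k (S.act k) j * S.pay k j ≤ I.payment k (S.act k) (S.pay k) :=
        Finset.single_le_sum (f := fun j => I.F k (S.act k) j * S.pay k j)
          (fun j _ => mul_nonneg (I.F_nonneg _ _ _) (hS.1.2 k j)) (Finset.mem_univ j)
      have h2 := I.payment_le_of_utility_nonneg hS hU hd hμ k
      have h3 := mul_le_mul_of_nonneg_right (hF k _ j hz) (hS.1.2 k j)
      have h4 := mul_le_mul_of_nonneg_left (h1.trans h2) hd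
      rw [hB]
      linarith
  have hpay : ∀ k, I.payment k (S.act k) (fun j => min (S.pay k j) B) =
      I.payment k (S.act k) (S.pay k) := fun k => Finset.sum_congr rfl fun j _ => hcut k j
  refine ⟨⟨fun k j => min (S.pay k j) B, S.act⟩, ⟨⟨fun k k' i => ?_, fun k j =>
    le_min (hS.1.2 k j) hB0⟩, fun hs k k' => ?_⟩, ?_, fun k j => min_le_right _ _⟩
  -- Cutting payments can only make deviations less attractive, while the recommended options keep
  -- their values.
  · rw [agentUtility_eq, agentUtility_eq, hpay]
    refine le_trans ?_ (hS.1.1 k k' i)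
    rw [agentUtility_eq]
    exact sub_le_sub_right (Finset.sum_le_sum fun j _ =>
      mul_le_mul_of_nonneg_left (min_le_left _ _) (I.F_nonneg _ _ _)) _
  · dsimp only
    rw [hS.2 hs k k']
  · rw [MultiInstance.principalUtility_eq, MultiInstance.principalUtility_eq]
    exact Finset.sum_congr rfl fun k _ => by rw [hpay]

/-- If no action is worth more than its cost, the principal cannot make a profit. -/
theorem opt_eq_zero (I : MultiInstance n m K) (single : Prop)
    (h : ∀ k i, I.reward k i ≤ I.c k i) : I.opt single = 0 := by
  refine le_antisymm (I.opt_le fun S hS => ?_) (I.opt_nonneg single)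
  rw [MultiInstance.principalUtility_eq]
  refine I.weighted_sum_le fun k => ?_
  have h1 := I.agentUtility_nonneg hS.1 k
  rw [agentUtility_eq] at h1
  have := h k (S.act k)
  linarith

/-- If some action is worth more than its cost, a linear contract makes a profit. -/
theorem le_opt_of_cost_lt (I : MultiInstance n m K) (single : Prop) (k : Fin K) (i : Fin n)
    (h : I.c k i < I.reward k i) :
    I.μ k * (I.reward k i - I.c k i) ^ 2 ≤ 4 * I.totalReward * I.opt single := by
  set w := I.reward k i with hw
  have hc := I.c_nonneg k i
  have hw0 : 0 < w := lt_of_le_of_lt hc h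
  -- Halfway between the break-even share c/w of the agent and the full share 1: the agent gains
  -- half of the gap w - c, and the principal keeps the share (w - c)/(2w).
  set α := (w + I.c k i) / (2 * w) with hα
  have hα0 : 0 ≤ α := by positivity
  have hα1 : α ≤ 1 := by
    rw [hα, div_le_one (by positivity)]
    linarith
  -- The linear contract α·r, as a mixture of the zero contract and the rewards.
  obtain ⟨σ, S, hS⟩ := I.exists_isMix α (fun _ _ => 0)
  have hf : I.Feasible single S := hS.feasible hα0 hα1 (fun _ _ => le_rfl) fun _ _ _ => rfl
  have hU := I.le_opt hf
  rw [hS.principalUtility_eq] at hU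
  have hz : ∀ k i, I.payment k i (fun _ => 0) = 0 := by simp [payment]
  simp only [hz, sub_zero] at hU
  have h1 : I.μ k * I.reward k (S.act k) ≤ ∑ k, I.μ k * I.reward k (S.act k) :=
    Finset.single_le_sum (f := fun k => I.μ k * I.reward k (S.act k))
      (fun k _ => mul_nonneg (I.μ_pos k).le (I.reward_nonneg _ _)) (Finset.mem_univ k)
  have h2 := hS.best k k i
  simp only [hz, mul_zero, zero_add] at h2
  have h3 : α * w - I.c k i = (w - I.c k i) / 2 := by
    rw [hα]
    field_simp
    ring
  have h4 : 1 - α = (w - I.c k i) / (2 * w) := by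
    rw [hα]
    field_simp
    ring
  rw [← hw, h3] at h2
  -- Whichever action the type prefers gives it at least (w - c)/2 out of a share of the reward, so
  -- the reward of that action is at least as large.
  have h5 : (w - I.c k i) / 2 ≤ I.reward k (S.act k) := by
    have := I.c_nonneg k (S.act k)
    have := mul_le_of_le_one_left (I.reward_nonneg k (S.act k)) hα1
    linarith
  have h6 : (1 - α) * (I.μ k * ((w - I.c k i) / 2)) ≤ I.opt single := by
    refine le_trans ?_ hU
    refine mul_le_mul_of_nonneg_left (le_trans ?_ h1) (by linarith)
    exact mul_le_mul_of_nonneg_left h5 (I.μ_pos k).le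
  rw [h4] at h6
  have h7 : I.μ k * (w - I.c k i) ^ 2 ≤ 4 * w * I.opt single := by
    have := mul_le_mul_of_nonneg_left h6 (by positivity : 0 ≤ 4 * w)
    calc I.μ k * (w - I.c k i) ^ 2 = 4 * w *
          ((w - I.c k i) / (2 * w) * (I.μ k * ((w - I.c k i) / 2))) := by
          field_simp
          ring
      _ ≤ _ := this
  refine h7.trans ?_
  have := I.reward_le k i
  exact mul_le_mul_of_nonneg_right (by linarith) (I.opt_nonneg single)

end MultiInstance

end BCD

namespace BCD

/-! ### The single-parameter instance and the simulation of mechanisms in it -/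

namespace MultiInstance

variable {n m K : ℕ}

/-- Action `i` of type `k`, as an action of the single-parameter instance. -/
def block (i : Fin n) (k : Fin K) : Fin (n * K + 1) := (finProdFinEquiv (i, k)).succ

/-- The single-parameter instance that simulates `I`. Outcome `0`, action `0` and type `0` are new.
The actions of type `k` are slowed down by the factor `X⁻¹ ^ (k + 1)`, and type `k` is too slow for the
actions of the types before it, while the actions of the types after it are not worth its time. -/
noncomputable def toSingle (I : MultiInstance n m K) (X s : ℝ) (hX : 2 ≤ X) (hs : 0 ≤ s) :
    SingleInstance (n * K + 1) (m + 1) (K + 1) where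
  F := Fin.cons (α := fun _ => Fin (m + 1) → ℝ) (Fin.cons (α := fun _ => ℝ) 1 0) fun x =>
    Fin.cons (α := fun _ => ℝ) (1 - (X ^ ((finProdFinEquiv.symm x).2 + 1 : ℕ))⁻¹) fun j =>
      (X ^ ((finProdFinEquiv.symm x).2 + 1 : ℕ))⁻¹ *
        I.F (finProdFinEquiv.symm x).2 (finProdFinEquiv.symm x).1 j
  c := Fin.cons (α := fun _ => ℝ) 0 fun x =>
    (I.c (finProdFinEquiv.symm x).2 (finProdFinEquiv.symm x).1 + s) *
      (X ^ (2 * (finProdFinEquiv.symm x).2 + 1 : ℕ))⁻¹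
  r := Fin.cons (α := fun _ => ℝ) 0 I.r
  θ := Fin.cons (α := fun _ => ℝ) (X ^ (2 * K + 1)) fun k => X ^ (k : ℕ)
  μ := Fin.cons (α := fun _ => ℝ) (1 - ∑ k, I.μ k * (X ^ (K - k : ℕ))⁻¹) fun k =>
    I.μ k * (X ^ (K - k : ℕ))⁻¹
  F_nonneg a j := by
    have hX0 : (0 : ℝ) ≤ X := by linarith
    cases a using Fin.cases with
    | zero =>
      cases j using Fin.cases with
      | zero => simp
      | succ j => simp
    | succ x =>
      cases j using Fin.cases with
      | zero =>
        simp only [Fin.cons_succ, Fin.cons_zero, sub_nonneg]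
        exact inv_le_one_of_one_le₀ (one_le_pow₀ (by linarith))
      | succ j =>
        simp only [Fin.cons_succ]
        exact mul_nonneg (by positivity) (I.F_nonneg _ _ _)
  F_sum a := by
    cases a using Fin.cases with
    | zero => simp [Fin.sum_univ_succ]
    | succ x => simp [Fin.sum_univ_succ, ← Finset.mul_sum, I.F_sum]
  c_nonneg a := by
    have hX0 : (0 : ℝ) ≤ X := by linarith
    cases a using Fin.cases with
    | zero => simp
    | succ x =>
      simp only [Fin.cons_succ]
      exact mul_nonneg (add_nonneg (I.c_nonneg _ _) hs) (by positivity)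
  r_nonneg j := by
    cases j using Fin.cases with
    | zero => simp
    | succ j => simpa using I.r_nonneg j
  θ_nonneg k := by
    have hX0 : (0 : ℝ) ≤ X := by linarith
    cases k using Fin.cases with
    | zero => simp only [Fin.cons_zero]; positivity
    | succ k => simp only [Fin.cons_succ]; positivity
  θ_injective := by
    have hX1 : (1 : ℝ) < X := by linarith
    have hinj := pow_right_injective₀ (by linarith : (0 : ℝ) < X) hX1.ne'
    rw [Fin.cons_injective_iff]
    refine ⟨?_, fun k k' h => Fin.ext (hinj h)⟩
    rintro ⟨k, hk⟩
    have := hinj hk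
    have := k.2
    omega
  μ_pos k := by
    have hX0 : (0 : ℝ) < X := by linarith
    cases k using Fin.cases with
    | zero =>
      simp only [Fin.cons_zero, sub_pos]
      -- The exponent K - k is at least 1 and X is at least 2, so the old types take up at most half
      -- of the weight.
      refine lt_of_le_of_lt (I.weighted_sum_le (B := 1 / 2) fun k => ?_) (by norm_num)
      rw [one_div]
      refine inv_anti₀ (by norm_num) (hX.trans (le_self_pow₀ (by linarith) ?_))
      have := k.2
      omega
    | succ k =>
      simp only [Fin.cons_succ]
      exact mul_pos (I.μ_pos k) (by positivity)
  μ_sum := by simp [Fin.sum_univ_succ]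
  n_pos := Nat.succ_pos _
  opt_out := rfl

section

variable (I : MultiInstance n m K) {X s : ℝ} (hX : 2 ≤ X) (hs : 0 ≤ s)

theorem toSingle_reward_zero (κ : Fin (K + 1)) : (I.toSingle X s hX hs).toMulti.reward κ 0 = 0 := by
  simp [reward, toSingle, SingleInstance.toMulti, Fin.sum_univ_succ]

theorem toSingle_payment_zero (κ : Fin (K + 1)) (p : Fin (m + 1) → ℝ) :
    (I.toSingle X s hX hs).toMulti.payment κ 0 p = p 0 := by
  simp [payment, toSingle, SingleInstance.toMulti, Fin.sum_univ_succ]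

theorem toSingle_cost_zero (κ : Fin (K + 1)) : (I.toSingle X s hX hs).toMulti.c κ 0 = 0 := by
  simp [toSingle, SingleInstance.toMulti]

theorem toSingle_reward_block (κ : Fin (K + 1)) (i : Fin n) (k : Fin K) :
    (I.toSingle X s hX hs).toMulti.reward κ (block i k) =
      (X ^ (k + 1 : ℕ))⁻¹ * I.reward k i := by
  simp [reward, toSingle, SingleInstance.toMulti, Fin.sum_univ_succ, block, Finset.mul_sum,
    mul_assoc, -finProdFinEquiv_symm_apply]

theorem toSingle_payment_block (κ : Fin (K + 1)) (i : Fin n) (k : Fin K) (p : Fin (m + 1) → ℝ) :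
    (I.toSingle X s hX hs).toMulti.payment κ (block i k) p =
      (X ^ (k + 1 : ℕ))⁻¹ * I.payment k i (fun j => p j.succ) +
        (1 - (X ^ (k + 1 : ℕ))⁻¹) * p 0 := by
  simp [payment, toSingle, SingleInstance.toMulti, Fin.sum_univ_succ, block, Finset.mul_sum,
    mul_assoc, add_comm, -finProdFinEquiv_symm_apply]

theorem toSingle_cost_block_zero (i : Fin n) (k : Fin K) :
    (I.toSingle X s hX hs).toMulti.c 0 (block i k) =
      X ^ (2 * K + 1) * ((I.c k i + s) * (X ^ (2 * k + 1 : ℕ))⁻¹) := by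
  simp [toSingle, SingleInstance.toMulti, block, -finProdFinEquiv_symm_apply]

theorem toSingle_cost_block_succ (k' : Fin K) (i : Fin n) (k : Fin K) :
    (I.toSingle X s hX hs).toMulti.c k'.succ (block i k) =
      X ^ (k' : ℕ) * ((I.c k i + s) * (X ^ (2 * k + 1 : ℕ))⁻¹) := by
  simp [toSingle, SingleInstance.toMulti, block, -finProdFinEquiv_symm_apply]

theorem action_cases {Q : Fin (n * K + 1) → Prop} (h0 : Q 0) (h1 : ∀ i k, Q (block i k)) (a) :
    Q a := by
  cases a using Fin.cases with
  | zero => exact h0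
  | succ x =>
    have := h1 (finProdFinEquiv.symm x).1 (finProdFinEquiv.symm x).2
    rwa [block, Prod.mk.eta, Equiv.apply_symm_apply] at this

/-- The reason for the exponent 2k + 1 in the unit costs: for the type that owns the block, costs
are scaled by the same factor as probabilities. -/
theorem pow_scale {X : ℝ} (hX : 2 ≤ X) {k : ℕ} :
    X ^ k * (X ^ (2 * k + 1))⁻¹ = (X ^ (k + 1))⁻¹ := by
  have : X ≠ 0 := by linarith
  field_simp
  ring

/-- Why blocks of later types are uninteresting: they lie a factor X below the scale of type k. -/
theorem scale_le {X : ℝ} (hX : 2 ≤ X) {k k' : ℕ} (h : k < k') :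
    (X ^ (k' + 1))⁻¹ ≤ (X ^ (k + 1))⁻¹ * X⁻¹ := by
  rw [← mul_inv, ← pow_succ]
  exact inv_anti₀ (by positivity) (pow_le_pow_right₀ (by linarith) (by omega))

/-- Why blocks of earlier types are prohibitive: relative to the scale of the block, its cost is
multiplied by at least X for any larger type exponent. -/
theorem le_slow_cost {X y : ℝ} (hX : 2 ≤ X) (hy : 0 ≤ y) {k k' : ℕ} (h : k' < k) :
    (X ^ (k' + 1))⁻¹ * (X * y) ≤ X ^ k * (y * (X ^ (2 * k' + 1))⁻¹) := by
  rw [← pow_scale hX]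
  have h1 : X ^ k' * X ≤ X ^ k := by
    rw [← pow_succ]
    exact pow_le_pow_right₀ (by linarith) h
  have h2 : 0 ≤ y * (X ^ (2 * k' + 1))⁻¹ := by positivity
  calc X ^ k' * (X ^ (2 * k' + 1))⁻¹ * (X * y)
      = X ^ k' * X * (y * (X ^ (2 * k' + 1))⁻¹) := by ring
    _ ≤ _ := mul_le_mul_of_nonneg_right h1 h2

/-- The weights of the old types in the single-parameter instance, in units of the weights of `I`. -/
theorem toSingle_weighted_sum (g : Fin (K + 1) → ℝ) :
    ∑ κ, (I.toSingle X s hX hs).toMulti.μ κ * g κ =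
      (1 - ∑ k, I.μ k * (X ^ (K - k : ℕ))⁻¹) * g 0 +
        (X ^ (K + 1))⁻¹ * ∑ k, I.μ k * (X ^ (k + 1 : ℕ) * g k.succ) := by
  have hX0 : X ≠ 0 := by linarith
  rw [Fin.sum_univ_succ]
  congr 1
  rw [Finset.mul_sum]
  refine Finset.sum_congr rfl fun k _ => ?_
  have hk : X ^ (K + 1) = X ^ (k + 1 : ℕ) * X ^ (K - k : ℕ) := by
    rw [← pow_add]
    congr 1
    have := k.2
    omega
  change I.μ k * (X ^ (K - k : ℕ))⁻¹ * g k.succ = _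
  rw [hk]
  field_simp

/-- Makes payments to the new type expensive for the principal, at a rate bounded away from zero. -/
theorem half_le_extra_weight (I : MultiInstance n m K) {X : ℝ} (hX : 2 ≤ X) :
    1 / 2 ≤ 1 - ∑ k, I.μ k * (X ^ (K - k : ℕ))⁻¹ := by
  have := I.weighted_sum_le (f := fun k => (X ^ (K - k : ℕ))⁻¹) (B := 1 / 2) fun k => by
    rw [one_div]
    refine inv_anti₀ (by norm_num) (hX.trans (le_self_pow₀ (by linarith) ?_))
    have := k.2
    omega
  linarith

end

/-- Mechanisms for `I` can be simulated with little loss. -/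
theorem opt_toSingle_ge (I : MultiInstance n m K) {X s α d : ℝ} (hX : 2 ≤ X) (hs : 0 ≤ s)
    (hα : 0 < α) (hα1 : α ≤ 1) (hd : 0 ≤ d) (hμ : ∀ k, 1 ≤ d * I.μ k)
    (hF : ∀ k i j, I.F k i j ≠ 0 → 1 ≤ d * I.F k i j)
    (hP : I.totalReward * (1 + d) * d ≤ X * s) (single : Prop) :
    (X ^ (K + 1))⁻¹ * ((1 - α) *
        (I.opt single - (s + I.totalReward * (1 + d) * d * X⁻¹) / α)) ≤
      (I.toSingle X s hX hs).toMulti.opt single := by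
  set J := (I.toSingle X s hX hs).toMulti with hJ
  set P := I.totalReward * (1 + d) * d with hPdef
  have hX0 : (0 : ℝ) < X := by linarith
  have hP0 : 0 ≤ P := mul_nonneg (mul_nonneg I.totalReward_nonneg (by linarith)) hd
  have key : ∀ S, I.Feasible single S → 0 ≤ I.principalUtility S →
      (X ^ (K + 1))⁻¹ * ((1 - α) * (I.principalUtility S - (s + P * X⁻¹) / α)) ≤ J.opt single := by
    intro S₀ hS₀ hU₀
    obtain ⟨S, hS, hUS, hbd⟩ := I.exists_bounded hS₀ hU₀ hd hμ hF
    rw [← hUS]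
    -- The null outcome is never paid. The new type is offered a copy of an existing contract, so
    -- that a single contract stays single.
    let Q : Fin (K + 1) → Fin (m + 1) → ℝ := Fin.cons (α := fun _ => Fin (m + 1) → ℝ)
      (Fin.cons (α := fun _ => ℝ) 0 (S.pay ⟨0, I.K_pos⟩))
      (fun k => Fin.cons (α := fun _ => ℝ) 0 (S.pay k))
    have hQ : ∀ κ, ∃ k, Q κ = Fin.cons (α := fun _ => ℝ) 0 (S.pay k) := by
      intro κ
      cases κ using Fin.cases with
      | zero => exact ⟨_, rfl⟩
      | succ k => exact ⟨k, rfl⟩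
    have hQ0 : ∀ κ, Q κ 0 = 0 := fun κ => by
      obtain ⟨k, hk⟩ := hQ κ
      rw [hk, Fin.cons_zero]
    obtain ⟨σ, T, hT⟩ := J.exists_isMix α Q
    have hfeas : J.Feasible single T := by
      refine hT.feasible hα.le hα1 (fun κ j => ?_) fun hsing κ κ' => ?_
      · obtain ⟨k, hk⟩ := hQ κ
        rw [hk]
        cases j using Fin.cases with
        | zero => simp
        | succ j => simpa using hS.1.2 k j
      · obtain ⟨k, hk⟩ := hQ κ
        obtain ⟨k', hk'⟩ := hQ κ'
        rw [hk, hk', hS.2 hsing k k']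
    refine le_trans ?_ (J.le_opt hfeas)
    rw [hT.principalUtility_eq, MultiInstance.principalUtility_eq, toSingle_weighted_sum]
    set net : Fin (K + 1) → ℝ := fun κ =>
      J.reward κ (T.act κ) - J.payment κ (T.act κ) (Q (σ κ)) with hnet
    have hpay : ∀ κ κ' i k, ∃ k'', J.payment κ (block i k) (Q κ') =
        (X ^ (k + 1 : ℕ))⁻¹ * I.payment k i (S.pay k'') := by
      intro κ κ' i k
      obtain ⟨k'', hk''⟩ := hQ κ'
      refine ⟨k'', ?_⟩
      rw [hJ, toSingle_payment_block, hk'']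
      simp
    have hle : ∀ k i k'', I.payment k i (S.pay k'') ≤ P := fun k i k'' =>
      I.payment_le k i (hbd k'')
    -- Payments are at most X·s, the least cost of such an action on the scale of its block. The
    -- exponent `t` is that of the acting type, which may be the new one.
    have hslow : ∀ κ κ' (i : Fin n) (k : Fin K) (t : ℕ), k < t →
        J.c κ (block i k) = X ^ t * ((I.c k i + s) * (X ^ (2 * k + 1 : ℕ))⁻¹) →
        J.agentUtility κ (Q κ') (block i k) ≤ 0 := by
      intro κ κ' i k t hkt hc
      obtain ⟨k'', hk''⟩ := hpay κ κ' i k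
      rw [agentUtility_eq, hk'', hc]
      have h1 := le_slow_cost hX (add_nonneg (I.c_nonneg k i) hs) hkt
      have h2 : I.payment k i (S.pay k'') ≤ X * (I.c k i + s) := by
        have := mul_nonneg hX0.le (I.c_nonneg k i)
        linarith [hle k i k'']
      have h3 := mul_le_mul_of_nonneg_left h2
        (by positivity : 0 ≤ (X ^ (k + 1 : ℕ))⁻¹)
      linarith
    -- Opting out is worth zero to the new type and nothing is worth more before mixing. So the
    -- mixture induces it to change only if this does not hurt the principal.
    have hextra : 0 ≤ net 0 := by
      have h1 := hT.profit_ge 0 0 0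
      have h2 : J.agentUtility 0 (Q (σ 0)) (T.act 0) ≤ 0 := by
        refine action_cases (Q := fun a => J.agentUtility 0 (Q (σ 0)) a ≤ 0) ?_ (fun i k => ?_)
          (T.act 0)
        · rw [agentUtility_eq, hJ, toSingle_payment_zero, toSingle_cost_zero, hQ0, sub_zero]
        · refine hslow 0 _ i k (2 * K + 1) (by have := k.2; omega) ?_
          rw [hJ, toSingle_cost_block_zero]
      rw [agentUtility_eq J 0 (Q 0), hJ, toSingle_payment_zero, toSingle_cost_zero,
        toSingle_reward_zero, hQ0, ← hJ] at h1
      have h3 : 0 ≤ α * net 0 := by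
        simp only [hnet]
        linarith
      exact nonneg_of_mul_nonneg_right h3 hα
    have htype : ∀ k : Fin K, (I.reward k (S.act k) - I.payment k (S.act k) (S.pay k)) -
        (s + P * X⁻¹) / α ≤ X ^ (k + 1 : ℕ) * net k.succ := by
      intro k
      set δ := (X ^ (k + 1 : ℕ))⁻¹ with hδ
      have hδ0 : 0 < δ := by positivity
      -- The benchmark is the recommended action from the type's own block, worth δ·(w - s) to it.
      -- The bound `h2` shows that no option exceeds δ·(w + P/X), so the principal's loss is at most
      -- δ·(s + P/X)/α.
      have h1 := hT.profit_ge k.succ k.succ (block (S.act k) k)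
      have hw := I.agentUtility_nonneg hS.1 k
      set w := I.agentUtility k (S.pay k) (S.act k) with hwdef
      have hPX : 0 ≤ P * X⁻¹ := by positivity
      have h2 : J.agentUtility k.succ (Q (σ k.succ)) (T.act k.succ) ≤ δ * (w + P * X⁻¹) := by
        refine action_cases
          (Q := fun a => J.agentUtility k.succ (Q (σ k.succ)) a ≤ δ * (w + P * X⁻¹)) ?_
          (fun i k' => ?_) (T.act k.succ)
        · rw [agentUtility_eq, hJ, toSingle_payment_zero, toSingle_cost_zero, hQ0, sub_zero]
          positivity
        · rcases lt_trichotomy k' k with hk' | rfl | hk'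
          · refine (hslow _ _ i k' k hk' ?_).trans (by positivity)
            rw [hJ, toSingle_cost_block_succ]
          · obtain ⟨k'', hk''⟩ := hpay k'.succ (σ k'.succ) i k'
            rw [agentUtility_eq, hk'', hJ, toSingle_cost_block_succ, mul_left_comm, pow_scale hX,
              ← hδ]
            have h3 := hS.1.1 k' k'' i
            rw [← hwdef, agentUtility_eq] at h3
            have h4 : I.payment k' i (S.pay k'') - (I.c k' i + s) ≤ w + P * X⁻¹ := by linarith
            have := mul_le_mul_of_nonneg_left h4 hδ0.le
            linarith
          · obtain ⟨k'', hk''⟩ := hpay k.succ (σ k.succ) i k'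
            have h3 := scale_le hX hk'
            rw [← hδ] at h3
            have h4 : 0 ≤ J.c k.succ (block i k') := J.c_nonneg _ _
            rw [agentUtility_eq, hk'']
            have h5 : (X ^ (k' + 1 : ℕ))⁻¹ * I.payment k' i (S.pay k'') ≤ δ * X⁻¹ * P :=
              mul_le_mul h3 (hle _ _ _) (I.payment_nonneg _ _ (hS.1.2 k'')) (by positivity)
            have h6 := mul_nonneg hδ0.le hw
            linarith
      have hQk : (fun j : Fin m => Q k.succ j.succ) = S.pay k := by
        funext j
        simp [Q]
      rw [agentUtility_eq J k.succ (Q k.succ), hJ, toSingle_payment_block, toSingle_cost_block_succ,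
        toSingle_reward_block, hQ0, hQk, mul_left_comm (X ^ (k : ℕ)), pow_scale hX, ← hJ, ← hδ] at h1
      rw [agentUtility_eq] at hwdef
      have h3 : δ * (α * ((I.reward k (S.act k) - I.payment k (S.act k) (S.pay k)))) -
          δ * (s + P * X⁻¹) ≤ α * net k.succ := by
        simp only [hnet]
        have : δ * w = δ * I.payment k (S.act k) (S.pay k) - δ * I.c k (S.act k) := by
          rw [hwdef, mul_sub]
        linarith
      have hδX : X ^ (k + 1 : ℕ) * δ = 1 := mul_inv_cancel₀ (by positivity)
      have h4 := mul_le_mul_of_nonneg_left h3 (by positivity : 0 ≤ X ^ (k + 1 : ℕ))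
      rw [mul_sub, ← mul_assoc, ← mul_assoc _ δ, hδX, one_mul, one_mul] at h4
      rw [sub_le_iff_le_add, ← sub_le_iff_le_add', le_div_iff₀ hα]
      linarith
    have hw0 := half_le_extra_weight I hX
    have hsum := I.weighted_sum_mono htype
    rw [I.weighted_sum_sub] at hsum
    have h1 : 0 ≤ (1 - ∑ k, I.μ k * (X ^ (K - k : ℕ))⁻¹) * net 0 :=
      mul_nonneg (by linarith) hextra
    have h2 := mul_le_mul_of_nonneg_left hsum (by positivity : 0 ≤ (X ^ (K + 1))⁻¹)
    have h3 := mul_le_mul_of_nonneg_left (h2.trans (le_add_of_nonneg_left h1))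
      (by linarith : 0 ≤ 1 - α)
    linarith
  have hτ : 0 < (X ^ (K + 1))⁻¹ := by positivity
  rcases eq_or_lt_of_le hα1 with rfl | hα1'
  · simpa using J.opt_nonneg single
  have h1α : 0 < 1 - α := by linarith
  -- The bound is solved for the utility so that the supremum can be taken; mechanisms with negative
  -- utility satisfy it trivially.
  have : I.opt single ≤ X ^ (K + 1) * J.opt single / (1 - α) + (s + P * X⁻¹) / α := by
    refine I.opt_le fun S hS => ?_
    by_cases hU : 0 ≤ I.principalUtility S
    · have := key S hS hU
      rw [inv_mul_le_iff₀ (by positivity)] at this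
      rw [← sub_le_iff_le_add, le_div_iff₀ h1α]
      linarith
    · have := J.opt_nonneg single
      have : 0 ≤ X ^ (K + 1) * J.opt single / (1 - α) + (s + P * X⁻¹) / α := by positivity
      linarith
  rw [← sub_le_iff_le_add, le_div_iff₀ h1α] at this
  rw [inv_mul_le_iff₀ (by positivity)]
  linarith

end MultiInstance

end BCD

namespace BCD

/-! ### Recovering mechanisms from the single-parameter instance -/

namespace MultiInstance

variable {n m K : ℕ}

/-- Profitable menus of the single-parameter instance can be turned into mechanisms for `I` with
little loss. -/
theorem profit_of_toSingle (I : MultiInstance n m K) {X s α d : ℝ} (hX : 2 ≤ X) (hs : 0 ≤ s)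
    (hα : 0 < α) (hα1 : α ≤ 1) (hd : 0 ≤ d) (hμ : ∀ k, 1 ≤ d * I.μ k)
    (hR : I.totalReward ≤ X * s)
    (hbig : I.totalReward * (1 + d) + 2 * I.totalReward * X⁻¹ < (X - 1) * s)
    {T : Mechanism (n * K + 1) (m + 1) (K + 1)} (hT : (I.toSingle X s hX hs).toMulti.IsMenu T)
    (hU : 0 ≤ (I.toSingle X s hX hs).toMulti.principalUtility T)
    {σ : Fin K → Fin K} {S : Mechanism n m K}
    (hS : I.IsMix α (fun k j => T.pay k.succ j.succ) σ S) :
    X ^ (K + 1) * (I.toSingle X s hX hs).toMulti.principalUtility T -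
        (I.totalReward * X⁻¹ + ((I.totalCost + I.totalReward * (1 + d) + s +
          2 * I.totalReward) * X⁻¹ + s) / α) ≤
      ∑ k, I.μ k * (I.reward k (S.act k) -
        I.payment k (S.act k) (fun j => T.pay (σ k).succ j.succ)) := by
  set J := (I.toSingle X s hX hs).toMulti with hJ
  set R := I.totalReward with hRdef
  set C := I.totalCost with hCdef
  set W := R * (1 + d) with hW
  have hX0 : (0 : ℝ) < X := by linarith
  have hX1 : X⁻¹ ≤ 1 := inv_le_one_of_one_le₀ (by linarith)
  have hXi : 0 < X⁻¹ := by positivity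
  have hR0 : 0 ≤ R := I.totalReward_nonneg
  have hC0 : 0 ≤ C := I.totalCost_nonneg
  have hW0 : 0 ≤ W := mul_nonneg hR0 (by linarith)
  set δ : ℕ → ℝ := fun k => (X ^ (k + 1))⁻¹ with hδ
  have hδ0 : ∀ k, 0 < δ k := fun k => by positivity
  have hδ1 : ∀ k, δ k ≤ X⁻¹ := fun k => inv_anti₀ hX0 (le_self_pow₀ (by linarith) (by omega))
  have hδX : ∀ k, X ^ (k + 1) * δ k = 1 := fun k => mul_inv_cancel₀ (by positivity)
  set u : Fin (K + 1) → ℝ := fun κ => J.agentUtility κ (T.pay κ) (T.act κ) with hu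
  set g : Fin (K + 1) → ℝ := fun κ => J.reward κ (T.act κ) - J.payment κ (T.act κ) (T.pay κ)
    with hg
  have hu0 : ∀ κ, 0 ≤ u κ := fun κ => J.agentUtility_nonneg hT κ
  have hgu : ∀ κ, g κ + u κ = J.reward κ (T.act κ) - J.c κ (T.act κ) := by
    intro κ
    simp only [hg, hu, agentUtility_eq]
    ring
  -- payments for the new outcome are small, because they are paid to the new type
  have hp0 : ∀ κ, 0 ≤ T.pay κ 0 := fun κ => hT.2 κ 0
  have hpu : ∀ κ, T.pay κ 0 ≤ u 0 := by
    intro κ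
    have := hT.1 0 κ 0
    rwa [agentUtility_eq, hJ, toSingle_payment_zero, toSingle_cost_zero, sub_zero] at this
  have hslow : ∀ (i : Fin n) (k : Fin K) (t : ℕ), k < t →
      δ k * I.reward k i ≤ X ^ t * ((I.c k i + s) * (X ^ (2 * k + 1 : ℕ))⁻¹) := by
    intro i k t hkt
    refine le_trans ?_ (le_slow_cost hX (add_nonneg (I.c_nonneg k i) hs) hkt)
    refine mul_le_mul_of_nonneg_left ((I.reward_le k i).trans ?_) (hδ0 k).le
    have := mul_nonneg hX0.le (I.c_nonneg k i)
    linarith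
  have hextra : g 0 + u 0 ≤ 0 := by
    rw [hgu]
    refine action_cases (Q := fun a => J.reward 0 a - J.c 0 a ≤ 0) ?_ (fun i k => ?_) (T.act 0)
    · rw [hJ, toSingle_reward_zero, toSingle_cost_zero, sub_zero]
    · rw [hJ, toSingle_reward_block, toSingle_cost_block_zero, sub_nonpos]
      exact hslow i k _ (by have := k.2; omega)
  -- Profit and agent utility add up to the surplus of the action. Earlier blocks produce no surplus
  -- for this type, and its own and later blocks have scale at most δ_k.
  have hsurplus : ∀ k : Fin K, g k.succ + u k.succ ≤ δ k * R := by
    intro k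
    rw [hgu]
    have hδR : 0 ≤ δ k * R := mul_nonneg (hδ0 k).le hR0
    refine action_cases (Q := fun a => J.reward k.succ a - J.c k.succ a ≤ δ k * R) ?_
      (fun i k' => ?_) (T.act k.succ)
    · rwa [hJ, toSingle_reward_zero, toSingle_cost_zero, sub_zero]
    · have hc : 0 ≤ J.c k.succ (block i k') := J.c_nonneg _ _
      rcases lt_trichotomy k' k with hk' | rfl | hk'
      · rw [hJ, toSingle_reward_block, toSingle_cost_block_succ]
        linarith [hslow i k' k hk']
      · have h1 : J.reward k'.succ (block i k') = δ k' * I.reward k' i :=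
          toSingle_reward_block I hX hs _ _ _
        have := mul_le_mul_of_nonneg_left (I.reward_le k' i) (hδ0 k').le
        linarith
      · have h1 : J.reward k.succ (block i k') = δ k' * I.reward k' i :=
          toSingle_reward_block I hX hs _ _ _
        have h2 : δ k' ≤ δ k := inv_anti₀ (by positivity)
          (pow_le_pow_right₀ (by linarith) (by have : (k : ℕ) < k' := hk'; omega))
        have := mul_le_mul h2 (I.reward_le k' i) (I.reward_nonneg _ _) (hδ0 k).le
        linarith
  set γ : Fin K → ℝ := fun k => X ^ (k + 1 : ℕ) * g k.succ with hγ
  set v : Fin K → ℝ := fun k => X ^ (k + 1 : ℕ) * u k.succ with hv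
  have hv0 : ∀ k, 0 ≤ v k := fun k => mul_nonneg (by positivity) (hu0 _)
  have hγv : ∀ k, γ k + v k ≤ R := by
    intro k
    have h := mul_le_mul_of_nonneg_left (hsurplus k) (by positivity : 0 ≤ X ^ (k + 1 : ℕ))
    rw [← mul_assoc, hδX, one_mul, mul_add] at h
    exact h
  have hUJ : J.principalUtility T = (1 - ∑ k, I.μ k * (X ^ (K - k : ℕ))⁻¹) * g 0 +
      (X ^ (K + 1))⁻¹ * ∑ k, I.μ k * γ k := by
    rw [MultiInstance.principalUtility_eq]
    exact toSingle_weighted_sum I hX hs g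
  have hhalf := half_le_extra_weight I hX
  -- The new type creates no surplus, so its utility is entirely a loss to the principal, incurred
  -- with weight at least one half.
  have hg0 : (1 - ∑ k, I.μ k * (X ^ (K - k : ℕ))⁻¹) * g 0 ≤ -(u 0 / 2) := by
    have h1 : g 0 ≤ -u 0 := by linarith
    have h2 := mul_le_mul_of_nonneg_left h1 (by linarith :
      0 ≤ 1 - ∑ k, I.μ k * (X ^ (K - k : ℕ))⁻¹)
    have h3 := mul_le_mul_of_nonneg_right hhalf (hu0 0)
    linarith
  set τ := (X ^ (K + 1))⁻¹ with hτ
  have hτ0 : 0 < τ := by positivity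
  have hsumR : ∑ k, I.μ k * γ k ≤ R := I.weighted_sum_le fun k => by linarith [hγv k, hv0 k]
  -- This loss must be covered by the old types, whose total contribution is at most τ·R.
  have hu0R : u 0 ≤ 2 * (τ * R) := by
    have := mul_le_mul_of_nonneg_left hsumR hτ0.le
    linarith
  have hsumU : X ^ (K + 1) * J.principalUtility T ≤ ∑ k, I.μ k * γ k := by
    have h1 : J.principalUtility T ≤ τ * ∑ k, I.μ k * γ k := by linarith [hu0 0]
    rwa [hτ, le_inv_mul_iff₀ (by positivity)] at h1
  have hsum0 : 0 ≤ ∑ k, I.μ k * γ k :=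
    (mul_nonneg (by positivity) hU).trans hsumU
  -- The rescaled profits have nonnegative mean and are at most R, so none is below -R·d. The
  -- rescaled utility is at most R minus the profit.
  have hvW : ∀ k, v k ≤ W := by
    intro k
    have := I.neg_le_of_weighted_sum_nonneg hR0 hd hμ
      (fun k => by linarith [hγv k, hv0 k]) hsum0 k
    have := hγv k
    rw [hW]
    linarith
  -- Since k + 1 ≤ K, one factor X of τ is left even on the finest scale that is used.
  have hpX : ∀ κ (k : Fin K), X ^ (k + 1 : ℕ) * T.pay κ 0 ≤ 2 * R * X⁻¹ := by
    intro κ k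
    have h1 : X ^ (k + 1 : ℕ) ≤ X ^ K := pow_le_pow_right₀ (by linarith) k.2
    have h2 : X ^ K * τ = X⁻¹ := by
      rw [hτ, pow_succ, mul_inv, ← mul_assoc, mul_inv_cancel₀ (by positivity), one_mul]
    calc X ^ (k + 1 : ℕ) * T.pay κ 0 ≤ X ^ K * (2 * (τ * R)) :=
          mul_le_mul h1 ((hpu κ).trans hu0R) (hp0 κ) (by positivity)
      _ = 2 * R * (X ^ K * τ) := by ring
      _ = 2 * R * X⁻¹ := by rw [h2]
  -- what the contracts are worth in `I`
  set p : Fin K → Fin m → ℝ := fun k j => T.pay k.succ j.succ with hp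
  have hpn : ∀ k j, 0 ≤ p k j := fun k j => hT.2 _ _
  -- Incentive compatibility against actions of the type's own block, rescaled; the nonnegative
  -- payment for the null outcome is dropped.
  have hdev : ∀ k k' i, I.payment k i (p k') - I.c k i ≤ v k + s := by
    intro k k' i
    have h := hT.1 k.succ k'.succ (block i k)
    rw [agentUtility_eq, hJ, toSingle_payment_block, toSingle_cost_block_succ,
      mul_left_comm (X ^ (k : ℕ)), pow_scale hX] at h
    change δ k * I.payment k i (p k') + (1 - δ k) * T.pay k'.succ 0 - (I.c k i + s) * δ k ≤
      u k.succ at h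
    have h1 : 0 ≤ (1 - δ k) * T.pay k'.succ 0 :=
      mul_nonneg (by linarith [hδ1 k]) (hp0 _)
    have h2 : δ k * (I.payment k i (p k') - I.c k i - s) ≤ u k.succ := by linarith
    have h3 := mul_le_mul_of_nonneg_left h2 (by positivity : 0 ≤ X ^ (k + 1 : ℕ))
    rw [← mul_assoc, hδX, one_mul] at h3
    linarith
  -- The rescaled utility available from a later block, whose payments are at most C + W + s and
  -- shrink by X, plus that from the null outcome, 2R/X.
  set e₁ := (C + W + s + 2 * R) * X⁻¹ with he₁
  have he₁R : 2 * R * X⁻¹ ≤ e₁ := mul_le_mul_of_nonneg_right (by linarith) hXi.le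
  have he₁0 : 0 ≤ e₁ := by positivity
  have htype : ∀ k : Fin K, γ k - (R * X⁻¹ + (e₁ + s) / α) ≤
      I.reward k (S.act k) - I.payment k (S.act k) (p (σ k)) := by
    intro k
    set net := I.reward k (S.act k) - I.payment k (S.act k) (p (σ k)) with hnet
    have hbest : I.agentUtility k (p (σ k)) (S.act k) ≤ v k + s := hdev k (σ k) _
    have hRX : 0 ≤ R * X⁻¹ := by positivity
    -- Such a type contributes almost nothing in `J`. In `I` opting out is within e₁ + s of the best
    -- that it can get before mixing, so the mixture loses at most (e₁ + s)/α on it.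
    have hidle : v k ≤ e₁ → γ k ≤ R * X⁻¹ → γ k - (R * X⁻¹ + (e₁ + s) / α) ≤ net := by
      intro h1 h2
      have h3 := hS.profit_ge k k ⟨0, I.n_pos⟩
      rw [agentUtility_eq I k (p k), I.opt_out] at h3
      have h4 := I.payment_nonneg k ⟨0, I.n_pos⟩ (hpn k)
      have h5 := mul_nonneg hα.le (I.reward_nonneg k ⟨0, I.n_pos⟩)
      have h6 : α * I.payment k ⟨0, I.n_pos⟩ (p k) ≤ I.payment k ⟨0, I.n_pos⟩ (p k) :=
        mul_le_of_le_one_left h4 hα1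
      have h7 : -(e₁ + s) ≤ α * net := by linarith
      have h8 : -((e₁ + s) / α) ≤ net := by
        rw [← neg_div, div_le_iff₀ hα]
        linarith
      linarith
    have hact : ∀ a, T.act k.succ = a → γ k - (R * X⁻¹ + (e₁ + s) / α) ≤ net := by
      refine fun a => action_cases
        (Q := fun a => T.act k.succ = a → γ k - (R * X⁻¹ + (e₁ + s) / α) ≤ net) ?_
        (fun i k' => ?_) a
      · intro ha
        have hgk : g k.succ = -T.pay k.succ 0 := by
          simp only [hg, ha, hJ, toSingle_reward_zero, toSingle_payment_zero, zero_sub]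
        have huk : u k.succ = T.pay k.succ 0 := by
          simp only [hu, agentUtility_eq, ha, hJ, toSingle_cost_zero, toSingle_payment_zero,
            sub_zero]
        refine hidle ?_ ?_
        · simp only [hv, huk]
          exact (hpX _ k).trans he₁R
        · simp only [hγ, hgk, mul_neg]
          have := mul_nonneg (by positivity : 0 ≤ X ^ (k + 1 : ℕ)) (hp0 k.succ)
          linarith
      · intro ha
        have hgk : g k.succ = δ k' * I.reward k' i -
            (δ k' * I.payment k' i (p k) + (1 - δ k') * T.pay k.succ 0) := by
          simp only [hg, ha, hJ, toSingle_reward_block, toSingle_payment_block, hδ, hp]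
        have huk : u k.succ = δ k' * I.payment k' i (p k) + (1 - δ k') * T.pay k.succ 0 -
            X ^ (k : ℕ) * ((I.c k' i + s) * (X ^ (2 * k' + 1 : ℕ))⁻¹) := by
          simp only [hu, agentUtility_eq, ha, hJ, toSingle_cost_block_succ,
            toSingle_payment_block, hδ, hp]
        have hq0 : 0 ≤ (1 - δ k') * T.pay k.succ 0 :=
          mul_nonneg (by linarith [hδ1 k']) (hp0 _)
        have hq1 : (1 - δ k') * T.pay k.succ 0 ≤ T.pay k.succ 0 :=
          mul_le_of_le_one_left (hp0 _) (by linarith [hδ0 k'])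
        have hpay0 := I.payment_nonneg k' i (hpn k)
        rcases lt_trichotomy k' k with hk' | rfl | hk'
        -- An earlier block is never played: nonnegative utility would require X·(c + s) ≤ payment +
        -- 2R/X, while the earlier type's incentives bound the payment by c + W + s. This
        -- contradicts `hbig`.
        · exfalso
          have h1 := le_slow_cost hX (add_nonneg (I.c_nonneg k' i) hs) (k := k) (k' := k') hk'
          have h2 := hu0 k.succ
          rw [huk] at h2
          change δ k' * (X * (I.c k' i + s)) ≤ _ at h1
          have h3 : δ k' * (X * (I.c k' i + s)) ≤ δ k' * I.payment k' i (p k) + T.pay k.succ 0 := by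
            linarith
          have h4 := mul_le_mul_of_nonneg_left h3 (by positivity : 0 ≤ X ^ (k' + 1 : ℕ))
          rw [← mul_assoc, hδX, one_mul, mul_add (X ^ (k' + 1 : ℕ)),
            ← mul_assoc (X ^ (k' + 1 : ℕ)), hδX, one_mul] at h4
          have h5 := hpX k.succ k'
          have h6 := hdev k' k i
          have h7 := hvW k'
          have h8 := mul_le_mul_of_nonneg_right (by linarith : 1 ≤ X) (I.c_nonneg k' i)
          linarith
        -- In the type's own block the null payment enters profit and utility with opposite signs.
        -- It is at most e₁ after rescaling, so the action is nearly optimal for the type in `I` as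
        -- well.
        · have h1 : γ k' = I.reward k' i - I.payment k' i (p k') -
              X ^ (k' + 1 : ℕ) * ((1 - δ k') * T.pay k'.succ 0) := by
            simp only [hγ, hgk]
            linear_combination (I.reward k' i - I.payment k' i (p k')) * hδX k'
          have h2 : v k' = I.payment k' i (p k') - (I.c k' i + s) +
              X ^ (k' + 1 : ℕ) * ((1 - δ k') * T.pay k'.succ 0) := by
            have hps : X ^ (k' : ℕ) * (X ^ (2 * k' + 1 : ℕ))⁻¹ = δ k' := pow_scale hX
            simp only [hv, huk]
            linear_combination (I.payment k' i (p k') - (I.c k' i + s)) * hδX k' -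
              X ^ (k' + 1 : ℕ) * (I.c k' i + s) * hps
          have h3 : X ^ (k' + 1 : ℕ) * ((1 - δ k') * T.pay k'.succ 0) ≤ e₁ :=
            (mul_le_mul_of_nonneg_left hq1 (by positivity)).trans ((hpX _ _).trans he₁R)
          have h4 : 0 ≤ X ^ (k' + 1 : ℕ) * ((1 - δ k') * T.pay k'.succ 0) :=
            mul_nonneg (by positivity) hq0
          have h5 := hS.profit_ge k' k' i
          rw [agentUtility_eq I k' (p k')] at h5
          have h6 : α * γ k' ≤ α * (I.reward k' i - I.payment k' i (p k')) :=
            mul_le_mul_of_nonneg_left (by linarith) hα.le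
          have h7 : α * γ k' - (e₁ + s) ≤ α * net := by linarith
          have h8 : γ k' - (e₁ + s) / α ≤ net := by
            rw [sub_le_iff_le_add, ← sub_le_iff_le_add', le_div_iff₀ hα]
            linarith
          linarith
        · have hsc : X ^ (k + 1 : ℕ) * δ k' ≤ X⁻¹ := by
            have := mul_le_mul_of_nonneg_left (scale_le hX (k := k) (k' := k') hk')
              (by positivity : 0 ≤ X ^ (k + 1 : ℕ))
            rwa [← mul_assoc, mul_inv_cancel₀ (by positivity), one_mul] at this
          have hc0 : 0 ≤ X ^ (k : ℕ) * ((I.c k' i + s) * (X ^ (2 * k' + 1 : ℕ))⁻¹) := by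
            have := I.c_nonneg k' i
            positivity
          refine hidle ?_ ?_
          · have h1 : u k.succ ≤ δ k' * I.payment k' i (p k) + T.pay k.succ 0 := by linarith
            have h2 := mul_le_mul_of_nonneg_left h1 (by positivity : 0 ≤ X ^ (k + 1 : ℕ))
            have h3 : I.payment k' i (p k) ≤ C + W + s := by
              have := hdev k' k i
              have := hvW k'
              have := I.c_le_totalCost k' i
              linarith
            have h4 := mul_le_mul hsc h3 hpay0 hXi.le
            have h5 := hpX k.succ k
            simp only [hv, he₁]
            linarith
          · have h1 : g k.succ ≤ δ k' * I.reward k' i := by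
              have := mul_nonneg (hδ0 k').le hpay0
              linarith
            have h2 := mul_le_mul_of_nonneg_left h1 (by positivity : 0 ≤ X ^ (k + 1 : ℕ))
            have h4 := mul_le_mul hsc (I.reward_le k' i) (I.reward_nonneg k' i) hXi.le
            simp only [hγ]
            linarith
    exact hact _ rfl
  have := I.weighted_sum_mono htype
  rw [I.weighted_sum_sub] at this
  linarith

end MultiInstance

end BCD

namespace BCD

/-! ### Choice of the constants -/

namespace MultiInstance

variable {n m K : ℕ}

theorem two_le_pow {H : ℝ} (hH : 2 ≤ H) : 2 ≤ H ^ 40 :=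
  hH.trans (le_self_pow₀ (by linarith) (by norm_num))

/-- The constants of the reduction: `y = H ^ (-20)` is negligible. -/
theorem negligible_of_le {H E O x y z : ℝ} (hH : 2 ≤ H) (hE : 1 ≤ E) (hEH : E ≤ H)
    (hx : 8 * E * x = 1) (hx0 : 0 < x) (hyH : H ^ 20 * y = 1) (hO : 1 ≤ H ^ 8 * O)
    (hz0 : 0 ≤ z) (hz : z ≤ H ^ 2 * y) : z / x ≤ x * O := by
  have hH0 : 0 < H := by linarith
  have hy0 : 0 ≤ y := by
    by_contra! h
    have := mul_neg_of_pos_of_neg (by positivity : 0 < H ^ 20) h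
    linarith
  have h8E : 8 * E ≤ H ^ 4 := by
    have h8 : (8 : ℝ) ≤ H ^ 3 := by
      calc (8 : ℝ) = 2 ^ 3 := by norm_num
        _ ≤ H ^ 3 := pow_le_pow_left₀ (by norm_num) hH 3
    calc 8 * E ≤ H ^ 3 * H := mul_le_mul h8 hEH (by linarith) (by positivity)
      _ = H ^ 4 := by ring
  have h8E2 : (8 * E) ^ 2 ≤ H ^ 8 := by
    calc (8 * E) ^ 2 ≤ (H ^ 4) ^ 2 := pow_le_pow_left₀ (by linarith) h8E 2
      _ = H ^ 8 := by ring
  -- One factor H^8 stands for (8E)², the other for 1/O. Together with H² from z they give H^18,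
  -- still below 1/y = H^20.
  have h1 : H ^ 8 * (H ^ 8 * z) ≤ H ^ 8 * O := by
    refine le_trans ?_ hO
    calc H ^ 8 * (H ^ 8 * z) ≤ H ^ 8 * (H ^ 8 * (H ^ 2 * y)) := by gcongr
      _ = H ^ 18 * y := by ring
      _ ≤ H ^ 20 * y :=
        mul_le_mul_of_nonneg_right (pow_le_pow_right₀ (by linarith) (by norm_num)) hy0
      _ = 1 := hyH
  have h2 : H ^ 8 * z ≤ O := le_of_mul_le_mul_left h1 (by positivity)
  have h3 : (8 * E) ^ 2 * z ≤ O := (mul_le_mul_of_nonneg_right h8E2 hz0).trans h2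
  have h4 : z = x * (x * ((8 * E) ^ 2 * z)) := by
    calc z = (8 * E * x) ^ 2 * z := by rw [hx]; ring
      _ = _ := by ring
  rw [div_le_iff₀ hx0, h4]
  calc x * (x * ((8 * E) ^ 2 * z)) ≤ x * (x * O) := by gcongr
    _ = x * O * x := by ring

/-- The losses are three factors 1 - x and one additive x, together at most 4x because β ≤ 1; the
allowance 8x leaves slack. -/
theorem approx_arithmetic {x β O : ℝ} (hx0 : 0 < x) (hx1 : x ≤ 1 / 8) (hβ0 : 0 < β) (hβ1 : β ≤ 1)
    (hO : 0 < O) :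
    (β - 8 * x) * O ≤ (1 - x) * (β * ((1 - x) * ((1 - x) * O)) - x * O) := by
  have h1 : β - 8 * x ≤ (1 - x) * (β * ((1 - x) * (1 - x)) - x) := by
    have h2 : 0 ≤ (1 - β) * x := mul_nonneg (by linarith) hx0.le
    have h3 : 0 ≤ β * x * x * (3 - x) := by
      have : 0 ≤ 3 - x := by linarith
      positivity
    nlinarith [sq_nonneg x]
  calc (β - 8 * x) * O ≤ (1 - x) * (β * ((1 - x) * (1 - x)) - x) * O :=
        mul_le_mul_of_nonneg_right h1 hO.le
    _ = _ := by ring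

set_option maxHeartbeats 1000000 in
/-- If `H` exceeds all the relevant magnitudes of `I`, then approximate mechanisms for the
single-parameter instance with the parameters `H ^ 40` and `totalReward / H ^ 20` can be converted to
approximate mechanisms for `I`. -/
theorem approx_of_toSingle (I : MultiInstance n m K) {H E s : ℝ} (hH : 2 ≤ H) (hE : 1 ≤ E)
    (hEH : E ≤ H) (hμ : ∀ k, 1 ≤ H * I.μ k) (hF : ∀ k i j, I.F k i j ≠ 0 → 1 ≤ H * I.F k i j)
    (hRH : I.totalReward ≤ H) (hCH : I.totalCost ≤ H)
    (hgap : ∀ k i, I.c k i < I.reward k i → 1 ≤ H ^ 2 * (I.reward k i - I.c k i))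
    (hs : 0 ≤ s) (hsR : s = I.totalReward * (H ^ 20)⁻¹) {single : Prop} {β : ℝ}
    {T : Mechanism (n * K + 1) (m + 1) (K + 1)}
    (hT : (I.toSingle (H ^ 40) s (two_le_pow hH) hs).toMulti.Feasible single T)
    (hβ : β * (I.toSingle (H ^ 40) s (two_le_pow hH) hs).toMulti.opt single ≤
      (I.toSingle (H ^ 40) s (two_le_pow hH) hs).toMulti.principalUtility T)
    {σ : Fin K → Fin K} {S S' : Mechanism n m K}
    (hS : I.IsMix (1 / (8 * E)) (fun k j => T.pay k.succ j.succ) σ S)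
    (h0 : 0 ≤ I.principalUtility S') (hSS' : I.principalUtility S ≤ I.principalUtility S') :
    (β - 1 / E) * I.opt single ≤ I.principalUtility S' := by
  -- Without a profitable action the optimum is zero, and nonnegative utility is all that is needed.
  by_cases hex : ∃ k i, I.c k i < I.reward k i
  swap
  · push Not at hex
    rw [I.opt_eq_zero single hex, mul_zero]
    exact h0
  obtain ⟨k₀, i₀, hk₀⟩ := hex
  set x := 1 / (8 * E) with hx
  have hx0 : 0 < x := by positivity
  have hxE : 8 * E * x = 1 := by rw [hx]; field_simp
  have hx1 : x ≤ 1 / 8 := by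
    rw [hx]
    exact one_div_le_one_div_of_le (by norm_num) (by linarith)
  have hEx : 1 / E = 8 * x := by
    rw [hx]
    field_simp
  rw [hEx]
  set O := I.opt single with hO
  have hO0 : 0 ≤ O := I.opt_nonneg single
  -- For such β the required value is not positive. Afterwards β > 0, which makes the utility of `T`
  -- nonnegative.
  by_cases hβx : β ≤ 8 * x
  · exact (mul_nonpos_of_nonpos_of_nonneg (by linarith) hO0).trans h0
  push Not at hβx
  set R := I.totalReward with hR
  have hR0 : 0 ≤ R := I.totalReward_nonneg
  have hC0 := I.totalCost_nonneg
  have hH0 : 0 < H := by linarith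
  -- a lower bound on the optimum
  have hRO : 1 ≤ 4 * H ^ 5 * (R * O) := by
    have h1 := I.le_opt_of_cost_lt single k₀ i₀ hk₀
    have h2 := hgap k₀ i₀ hk₀
    have h3 : 1 ≤ (H * I.μ k₀) * (H ^ 2 * (I.reward k₀ i₀ - I.c k₀ i₀)) ^ 2 :=
      one_le_mul_of_one_le_of_one_le (hμ k₀) (one_le_pow₀ h2)
    have h4 := mul_le_mul_of_nonneg_left h1 (by positivity : 0 ≤ H ^ 5)
    calc (1 : ℝ) ≤ _ := h3
      _ = H ^ 5 * (I.μ k₀ * (I.reward k₀ i₀ - I.c k₀ i₀) ^ 2) := by ring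
      _ ≤ _ := h4
      _ = 4 * H ^ 5 * (R * O) := by ring
  have hRpos : 0 < R := by
    rcases eq_or_lt_of_le hR0 with h | h
    · rw [← h] at hRO
      norm_num at hRO
    · exact h
  have hOpos : 0 < O := by
    rcases eq_or_lt_of_le hO0 with h | h
    · rw [← h] at hRO
      norm_num at hRO
    · exact h
  have hOH : 1 ≤ H ^ 8 * O := by
    refine hRO.trans ?_
    have h1 : R * O ≤ H * O := mul_le_mul_of_nonneg_right hRH hO0
    have h2 : (4 : ℝ) ≤ H ^ 2 := by nlinarith
    calc 4 * H ^ 5 * (R * O) ≤ H ^ 2 * H ^ 5 * (H * O) :=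
          mul_le_mul (mul_le_mul_of_nonneg_right h2 (by positivity)) h1 (by positivity)
            (by positivity)
      _ = H ^ 8 * O := by ring
  -- the small quantities
  set y := (H ^ 20)⁻¹ with hy
  have hy0 : 0 < y := by positivity
  have hyH : H ^ 20 * y = 1 := mul_inv_cancel₀ (by positivity)
  have hXy : (H ^ 40)⁻¹ = y ^ 2 := by
    rw [hy, ← inv_pow]
    ring
  have hyp : ∀ j, j ≤ 20 → H ^ j * y ≤ 1 := by
    intro j hj
    rw [← hyH]
    exact mul_le_mul_of_nonneg_right (pow_le_pow_right₀ (by linarith) hj) hy0.le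
  have hXs : H ^ 40 * s = R * H ^ 20 := by
    rw [hsR]
    linear_combination (R * H ^ 20) * hyH
  have hpow : ∀ j, 1 ≤ j → 2 ≤ H ^ j := fun j hj =>
    hH.trans (le_self_pow₀ (by linarith) (by omega))
  have h1H : 1 + H ≤ H ^ 2 := by nlinarith
  have hpow20 : 1 + H + 4 ≤ H ^ 20 := by
    calc 1 + H + 4 ≤ H ^ 2 + H ^ 2 := by nlinarith
      _ = 2 * H ^ 2 := by ring
      _ ≤ H * H ^ 2 := mul_le_mul_of_nonneg_right hH (by positivity)
      _ = H ^ 3 := by ring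
      _ ≤ H ^ 20 := pow_le_pow_right₀ (by linarith) (by norm_num)
  have hP : R * (1 + H) * H ≤ H ^ 40 * s := by
    rw [hXs, mul_assoc]
    refine mul_le_mul_of_nonneg_left ?_ hR0
    calc (1 + H) * H ≤ H ^ 2 * H := mul_le_mul_of_nonneg_right h1H hH0.le
      _ = H ^ 3 := by ring
      _ ≤ H ^ 20 := pow_le_pow_right₀ (by linarith) (by norm_num)
  have hRs : R ≤ H ^ 40 * s := by
    rw [hXs]
    exact le_mul_of_one_le_right hR0 (by linarith)
  have hsH : s ≤ H * y := by
    rw [hsR]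
    exact mul_le_mul_of_nonneg_right hRH hy0.le
  have hy1 : y ≤ 1 := by simpa using hyp 0 (by norm_num)
  -- The product X·s equals R·H^20 and dominates the other multiples of R; strictness uses R > 0.
  have hbig : R * (1 + H) + 2 * R * (H ^ 40)⁻¹ < (H ^ 40 - 1) * s := by
    rw [hXy, sub_mul, hXs, one_mul, hsR]
    have h2 : y ^ 2 ≤ 1 := pow_le_one₀ hy0.le hy1
    have h3 : R * (1 + H + 2 * y ^ 2 + y) < R * H ^ 20 :=
      mul_lt_mul_of_pos_left (by linarith) hRpos
    linarith
  have hdiv : ∀ z, 0 ≤ z → z ≤ H ^ 2 * y → z / x ≤ x * O := fun z =>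
    negligible_of_le hH hE hEH hxE hx0 hyH hOH
  have hHy : H * y + y ≤ H ^ 2 * y := by
    rw [← add_one_mul, add_comm H]
    exact mul_le_mul_of_nonneg_right h1H hy0.le
  have hR3 : R * (1 + H) ≤ H ^ 3 := by
    calc R * (1 + H) ≤ H * H ^ 2 := mul_le_mul hRH h1H (by linarith) hH0.le
      _ = H ^ 3 := by ring
  have hyy : ∀ w, w ≤ H ^ 6 → w * y ^ 2 ≤ y := by
    intro w hw
    calc w * y ^ 2 ≤ H ^ 6 * y ^ 2 := mul_le_mul_of_nonneg_right hw (by positivity)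
      _ = H ^ 6 * y * y := by ring
      _ ≤ 1 * y := mul_le_mul_of_nonneg_right (hyp 6 (by norm_num)) hy0.le
      _ = y := one_mul y
  -- The surcharge is at most H·y, and the terms with 1/X = y² are at most y. Their sum is within
  -- the H²·y that `hdiv` tolerates.
  have heA : (s + R * (1 + H) * H * (H ^ 40)⁻¹) / x ≤ x * O := by
    refine hdiv _ (by positivity) ?_
    rw [hXy]
    have := hyy (R * (1 + H) * H) (by
      calc R * (1 + H) * H ≤ H ^ 3 * H := mul_le_mul_of_nonneg_right hR3 hH0.le
        _ = H ^ 4 := by ring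
        _ ≤ H ^ 6 := pow_le_pow_right₀ (by linarith) (by norm_num))
    linarith
  have heB : R * (H ^ 40)⁻¹ + ((I.totalCost + R * (1 + H) + s + 2 * R) * (H ^ 40)⁻¹ + s) / x ≤
      x * O := by
    have h1 : R * (H ^ 40)⁻¹ ≤ R * (H ^ 40)⁻¹ / x :=
      le_div_self (by positivity) hx0 (by linarith)
    have h2 := hdiv (R * (H ^ 40)⁻¹ + ((I.totalCost + R * (1 + H) + s + 2 * R) * (H ^ 40)⁻¹ + s))
      (by positivity) (by
        rw [hXy]
        have := hyy (R + (I.totalCost + R * (1 + H) + s + 2 * R)) (by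
          have h3 : s ≤ H := hsH.trans (mul_le_of_le_one_right hH0.le hy1)
          have h4 : 5 * H ≤ H ^ 5 := by
            calc 5 * H ≤ H ^ 4 * H := mul_le_mul_of_nonneg_right (by
                  calc (5 : ℝ) ≤ 2 ^ 4 := by norm_num
                    _ ≤ H ^ 4 := pow_le_pow_left₀ (by norm_num) hH 4) hH0.le
              _ = H ^ 5 := by ring
          have h5 : H ^ 3 ≤ H ^ 5 := pow_le_pow_right₀ (by linarith) (by norm_num)
          have h6 : 2 * H ^ 5 ≤ H * H ^ 5 := mul_le_mul_of_nonneg_right hH (by positivity)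
          have h7 : H * H ^ 5 = H ^ 6 := by ring
          linarith)
        linarith)
    rw [add_div] at h2
    linarith
  have hA := I.opt_toSingle_ge (two_le_pow hH) hs hx0 (by linarith) hH0.le hμ hF hP single
  have hTU := (I.toSingle (H ^ 40) s (two_le_pow hH) hs).toMulti.le_opt hT
  set OJ := (I.toSingle (H ^ 40) s (two_le_pow hH) hs).toMulti.opt single with hOJ
  set UT := (I.toSingle (H ^ 40) s (two_le_pow hH) hs).toMulti.principalUtility T with hUT
  set τ := ((H ^ 40) ^ (K + 1))⁻¹ with hτ
  have hτ0 : 0 < τ := by positivity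
  have hA' : τ * ((1 - x) * ((1 - x) * O)) ≤ OJ := by
    refine le_trans (mul_le_mul_of_nonneg_left (mul_le_mul_of_nonneg_left ?_ (by linarith))
      hτ0.le) hA
    linarith
  have hOJ0 : 0 < OJ := lt_of_lt_of_le
    (mul_pos hτ0 (mul_pos (by linarith) (mul_pos (by linarith) hOpos))) hA'
  have hβ0 : 0 < β := by linarith
  -- No menu beats the optimum, and the optimum of the single-parameter instance is positive here.
  have hβ1 : β ≤ 1 := by
    by_contra! h
    have := mul_lt_mul_of_pos_right h hOJ0
    linarith
  have hUT0 : 0 ≤ UT := (mul_pos hβ0 hOJ0).le.trans hβ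
  have hB := I.profit_of_toSingle (two_le_pow hH) hs hx0 (by linarith) hH0.le hμ hRs hbig hT.1 hUT0 hS
  rw [← hUT] at hB
  have hUS := hS.principalUtility_eq
  have h1 : β * ((1 - x) * ((1 - x) * O)) ≤ (H ^ 40) ^ (K + 1) * UT := by
    have h2 := (mul_le_mul_of_nonneg_left hA' hβ0.le).trans hβ
    rw [mul_left_comm, hτ, inv_mul_le_iff₀ (by positivity)] at h2
    exact h2
  have h2 : (1 - x) * (β * ((1 - x) * ((1 - x) * O)) - x * O) ≤ I.principalUtility S := by
    rw [hUS]
    refine mul_le_mul_of_nonneg_left ?_ (by linarith)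
    linarith
  refine le_trans ?_ (h2.trans hSS')
  exact approx_arithmetic hx0 hx1 hβ0 hβ1 hOpos

end MultiInstance

end BCD

namespace BCD

/-! ### Access to the fractions in the input -/

variable {Γ : Type} [Ctx Γ]

/-- Numerator of fraction `p` of the list of fractions that starts in cell `b`. -/
def num (cell : ℕ → ℤ) (b p : ℕ) : ℤ := cell (b + 2 * p)

/-- Denominator of fraction `p` of the list of fractions that starts in cell `b`. -/
def den (cell : ℕ → ℤ) (b p : ℕ) : ℤ := cell (b + 2 * p + 1)

theorem frac_eq (cell : ℕ → ℤ) (b p : ℕ) : frac cell b p = (num cell b p : ℝ) / den cell b p := rfl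

theorem Comp.num {b p : Γ → ℕ} (hb : Small b) (hp : Small p) :
    Comp (fun γ => num (Ctx.cell γ) (b γ) (p γ)) :=
  Comp.cell (hb.add ((small_const 2).mul hp)).1

theorem Comp.den {b p : Γ → ℕ} (hb : Small b) (hp : Small p) :
    Comp (fun γ => den (Ctx.cell γ) (b γ) (p γ)) :=
  Comp.cell ((hb.add ((small_const 2).mul hp)).add (small_const 1)).1

theorem Comp.cons {f : Γ → ℤ} {g : Γ → List ℤ} (hf : Comp f) (hg : Emits g) :
    Emits (fun γ => f γ :: g γ) :=
  (hf.emits.append hg).congr fun _ => rfl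

theorem Comp.pair {f g : Γ → ℤ} (hf : Comp f) (hg : Comp g) : Emits (fun γ => [f γ, g γ]) :=
  (hf.emits.append hg.emits).congr fun _ => rfl

theorem emits_frac {b p : Γ → ℕ} (hb : Small b) (hp : Small p) :
    Emits (fun γ => [num (Ctx.cell γ) (b γ) (p γ), den (Ctx.cell γ) (b γ) (p γ)]) :=
  (Comp.num hb hp).pair (Comp.den hb hp)

theorem small_header {h i : ℕ} (hi : i ≤ h) :
    Small (fun x : Input h => (x.entry i).toNat) :=
  Comp.small_toNat (Comp.cell (Γ := Input h) (g := fun _ => i) (comp_const _)) Polynomial.X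
    fun L x hL => by
      have := hL.2 i hi
      rw [Polynomial.eval_X]
      change (x.entry i).toNat ≤ L
      omega

theorem inputOf_succ (h : ℕ) (xs : List ℤ) (q : ℕ) :
    (inputOf h xs).entry (1 + q) = xs.getD q 0 := by
  rw [inputOf]
  simp only [Nat.add_sub_cancel_left, if_neg (by omega : ¬ 1 + q = 0)]

theorem inputOf_left {h : ℕ} {xs zs : List ℤ} {q : ℕ} (hq : q < xs.length) :
    (inputOf h (xs ++ zs)).entry (1 + q) = xs.getD q 0 := by
  rw [inputOf_succ, List.getD_append _ _ _ _ hq]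

theorem inputOf_right {h : ℕ} {xs zs : List ℤ} (q : ℕ) :
    (inputOf h (xs ++ zs)).entry (1 + xs.length + q) = zs.getD q 0 := by
  rw [Nat.add_assoc, inputOf_succ, List.getD_append_right _ _ _ _ (by omega),
    Nat.add_sub_cancel_left]

theorem length_le_bitLength (xs : List ℤ) : xs.length ≤ bitLength xs := by
  unfold bitLength
  induction xs with
  | nil => simp
  | cons x xs ih =>
    have := one_le_bits x
    simp only [List.length_cons, List.map_cons, List.sum_cons]
    omega

theorem bitLength_append (xs zs : List ℤ) :
    bitLength (xs ++ zs) = bitLength xs + bitLength zs := by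
  simp [bitLength]

theorem bitLength_cons (z : ℤ) (xs : List ℤ) : bitLength (z :: xs) = bits z + bitLength xs := by
  simp [bitLength]

theorem bits_le_bitLength {xs : List ℤ} {z : ℤ} (hz : z ∈ xs) : bits z ≤ bitLength xs := by
  unfold bitLength
  exact List.single_le_sum (by simp) _ (List.mem_map_of_mem hz)

theorem ok_inputOf {h L : ℕ} {xs : List ℤ} (hL : bitLength xs + 1 ≤ L)
    (hh : ∀ i, 1 ≤ i → i ≤ h → ((inputOf h xs).entry i).natAbs ≤ L) :
    Ctx.ok (inputOf h xs) L := by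
  have hlen := length_le_bitLength xs
  refine ⟨fun i => ?_, fun i hi => ?_⟩
  · rcases Nat.eq_zero_or_pos i with rfl | hi
    · have := bits_natCast_le xs.length
      simp only [inputOf, if_true]
      omega
    · obtain ⟨q, rfl⟩ : ∃ q, i = 1 + q := ⟨i - 1, by omega⟩
      rw [inputOf_succ]
      by_cases hq : q < xs.length
      · rw [List.getD_eq_getElem _ _ hq]
        have := bits_le_bitLength (List.getElem_mem hq)
        omega
      · rw [List.getD_eq_default _ _ (by omega)]
        have : bits 0 = 1 := rfl
        omega
  · rcases Nat.eq_zero_or_pos i with rfl | hi'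
    · simp only [inputOf, if_true, Int.natAbs_natCast]
      omega
    · exact hh i hi' hi

theorem flatMap_getD (zs : List ℤ) : ((List.range zs.length).flatMap fun i => [zs.getD i 0]) = zs := by
  rw [← List.map_eq_flatMap]
  refine List.ext_getElem (by simp) fun i h1 h2 => ?_
  simp only [List.getElem_map, List.getElem_range]
  rw [List.getD_eq_getElem _ _ h2]

/-! ## From single-parameter to multi-parameter instances -/

/-- The code of the multi-parameter version of the single-parameter instance in the input. -/
def toMultiCode (cell : ℕ → ℤ) (n m K : ℕ) : List ℤ :=
  (n : ℤ) :: (m : ℤ) :: (K : ℤ) ::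
    (((List.range K).flatMap fun _ => (List.range n).flatMap fun i => (List.range m).flatMap fun j =>
      [num cell 4 (i * m + j), den cell 4 (i * m + j)]) ++
    ((List.range K).flatMap fun k => (List.range n).flatMap fun i =>
      [num cell 4 (n * m + n + m + k) * num cell 4 (n * m + i),
        den cell 4 (n * m + n + m + k) * den cell 4 (n * m + i)]) ++
    ((List.range m).flatMap fun j => [num cell 4 (n * m + n + j), den cell 4 (n * m + n + j)]) ++
    ((List.range K).flatMap fun k =>
      [num cell 4 (n * m + n + m + K + k), den cell 4 (n * m + n + m + K + k)]))

theorem emits_toMultiCode {n m K : Γ → ℕ} (hn : Small n) (hm : Small m) (hK : Small K) :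
    Emits (fun γ => toMultiCode (Ctx.cell γ) (n γ) (m γ) (K γ)) := by
  refine hn.1.cons (hm.1.cons (hK.1.cons (((Emits.append ?_ ?_).append ?_).append ?_)))
  · refine Emits.flatMap hK (Emits.flatMap hn.fst (Emits.flatMap hm.fst.fst ?_))
    exact emits_frac (small_const 4) ((small_snd.fst.mul hm.fst.fst.fst).add small_snd)
  · refine Emits.flatMap hK (Emits.flatMap hn.fst ?_)
    have hi : Small fun x : (Γ × ℕ) × ℕ => n x.1.1 * m x.1.1 + x.2 :=
      (hn.fst.fst.mul hm.fst.fst).add small_snd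
    have hk : Small fun x : (Γ × ℕ) × ℕ => n x.1.1 * m x.1.1 + n x.1.1 + m x.1.1 + x.1.2 :=
      (((hn.fst.fst.mul hm.fst.fst).add hn.fst.fst).add hm.fst.fst).add small_snd.fst
    exact ((Comp.num (small_const 4) hk).mul (Comp.num (small_const 4) hi)).pair
      ((Comp.den (small_const 4) hk).mul (Comp.den (small_const 4) hi))
  · refine Emits.flatMap hm ?_
    exact emits_frac (small_const 4) (((hn.fst.mul hm.fst).add hn.fst).add small_snd)
  · refine Emits.flatMap hK ?_
    exact emits_frac (small_const 4)
      (((((hn.fst.mul hm.fst).add hn.fst).add hm.fst).add hK.fst).add small_snd)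

theorem SingleInstance.At.codes_toMulti {n m K : ℕ} {J : SingleInstance n m K} {cell : ℕ → ℤ}
    (h : J.At cell 1) : J.toMulti.Codes (toMultiCode cell n m K) := by
  have hden : ∀ p, p < n * m + n + m + K + K → 0 < den cell 4 p := h.den_pos
  refine ⟨_, ?_, rfl⟩
  refine CodesReals.append (CodesReals.append (CodesReals.append ?_ ?_) ?_) ?_
  · refine codesReals_flatten_ofFn fun k => codesReals_matrixEntries fun i j => ?_
    have := mul_add_lt i.2 j.2
    exact codesReals_singleton (hden _ (by omega)) (h.F_eq i j)
  · refine codesReals_matrixEntries fun k i => ?_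
    have h1 := k.2
    have h2 := i.2
    refine codesReals_singleton (mul_pos (hden _ (by omega)) (hden _ (by omega))) ?_
    change J.θ k * J.c i = _
    rw [h.θ_eq, h.c_eq, frac_eq, frac_eq, div_mul_div_comm]
    push_cast
    rfl
  · refine codesReals_ofFn fun j => ?_
    have := j.2
    exact codesReals_singleton (hden _ (by omega)) (h.r_eq j)
  · refine codesReals_ofFn fun k => ?_
    have := k.2
    exact codesReals_singleton (hden _ (by omega)) (h.μ_eq k)

/-- The dimensions are coded in binary but are bounded by the length of the code, hence usable as
loop bounds. The bound for the number of actions uses that there is an outcome. -/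
theorem SingleInstance.Codes.ok {n m K : ℕ} {J : SingleInstance n m K} {xs : List ℤ}
    (h : J.Codes xs) (zs : List ℤ) :
    Ctx.ok (inputOf 3 (xs ++ zs)) (bitLength (xs ++ zs) + 1) ∧ J.At (inputOf 3 (xs ++ zs)).entry 1 := by
  have hat := h.at (cell := (inputOf 3 (xs ++ zs)).entry) (b := 1) fun q hq => inputOf_left hq
  have hl := h.length_eq
  have hb := length_le_bitLength xs
  have hn := Nat.le_mul_of_pos_right n J.toMulti.m_pos
  refine ⟨ok_inputOf le_rfl fun i h1 h3 => ?_, hat⟩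
  rw [bitLength_append]
  have e1 := hat.n_eq
  have e2 := hat.m_eq
  have e3 := hat.K_eq
  interval_cases i
  · rw [e1]
    omega
  · rw [show (2 : ℕ) = 1 + 1 from rfl, e2]
    omega
  · rw [show (3 : ℕ) = 1 + 2 from rfl, e3]
    omega

/-- Both conversions are the same program, which skips the instance and copies the solution behind
it. -/
theorem single_to_multi :
    ∃ (reduce convertMenu convertSingle : Program) (q : Polynomial ℕ),
      ∀ (n m K : ℕ) (J : SingleInstance n m K) (xs : List ℤ), J.Codes xs →
      ∃ (I : MultiInstance n m K) (ys : List ℤ),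
        I.Codes ys ∧
        RunsInTime reduce xs ys (q.eval (bitLength xs)) ∧
        ∀ (β : ℝ) (S : Mechanism n m K) (zs : List ℤ), S.Codes zs →
          (I.IsApproxMenu β S →
            ∃ (S' : Mechanism n m K) (ws : List ℤ), S'.Codes ws ∧
              RunsInTime convertMenu (xs ++ zs) ws (q.eval (bitLength xs + bitLength zs)) ∧
              J.toMulti.IsApproxMenu β S') ∧
          (I.IsApproxSingle β S →
            ∃ (S' : Mechanism n m K) (ws : List ℤ), S'.Codes ws ∧
              RunsInTime convertSingle (xs ++ zs) ws (q.eval (bitLength xs + bitLength zs)) ∧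
              J.toMulti.IsApproxSingle β S') := by
  have hn : Small (fun x : Input 3 => (x.entry 1).toNat) := small_header (by norm_num)
  have hm : Small (fun x : Input 3 => (x.entry 2).toNat) := small_header (by norm_num)
  have hK : Small (fun x : Input 3 => (x.entry 3).toNat) := small_header (by norm_num)
  obtain ⟨p, q, hp⟩ := (emits_toMultiCode hn hm hK).runsInTime
  -- The length of a coded mechanism: one cell per recommended action and two per payment.
  have hN : Small (fun x : Input 3 => (x.entry 3).toNat + 2 * ((x.entry 3).toNat * (x.entry 2).toNat)) :=
    hK.add ((small_const 2).mul (hK.mul hm))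
  have hT : Small (fun x : Input 3 => 1 + (3 + 2 * ((x.entry 1).toNat * (x.entry 2).toNat +
      (x.entry 1).toNat + (x.entry 2).toNat + (x.entry 3).toNat + (x.entry 3).toNat))) :=
    (small_const 1).add ((small_const 3).add ((small_const 2).mul
      (((((hn.mul hm).add hn).add hm).add hK).add hK)))
  have hE : Emits (fun x : Input 3 => (List.range ((x.entry 3).toNat +
      2 * ((x.entry 3).toNat * (x.entry 2).toNat))).flatMap fun i => [Ctx.cell x (1 + (3 + 2 *
        ((x.entry 1).toNat * (x.entry 2).toNat + (x.entry 1).toNat + (x.entry 2).toNat +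
          (x.entry 3).toNat + (x.entry 3).toNat)) + i)]) :=
    Emits.flatMap hN (Comp.cell (hT.fst.add small_snd).1).emits
  obtain ⟨p', q', hp'⟩ := hE.runsInTime
  have hrun : ∀ (n m K : ℕ) (J : SingleInstance n m K) (xs : List ℤ), J.Codes xs →
      ∀ (S : Mechanism n m K) (zs : List ℤ), S.Codes zs → RunsInTime p' (xs ++ zs) zs
        ((q.comp (Polynomial.X + 1) + q'.comp (Polynomial.X + 1)).eval
          (bitLength xs + bitLength zs)) := by
    intro n m K J xs hxs S zs hzs
    obtain ⟨hok, hat⟩ := hxs.ok zs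
    have h1 := hp' (xs ++ zs) _ hok
    have e1 : (inputOf 3 (xs ++ zs)).entry 1 = n := hat.n_eq
    have e2 : (inputOf 3 (xs ++ zs)).entry 2 = m := hat.m_eq
    have e3 : (inputOf 3 (xs ++ zs)).entry 3 = K := hat.K_eq
    have e4 : ∀ i, Ctx.cell (inputOf 3 (xs ++ zs)) (1 + (3 + 2 * (n * m + n + m + K + K)) + i) =
        zs.getD i 0 := by
      intro i
      rw [← hxs.length_eq]
      exact inputOf_right i
    have hval : ((List.range (K + 2 * (K * m))).flatMap fun i =>
        [Ctx.cell (inputOf 3 (xs ++ zs)) (1 + (3 + 2 * (n * m + n + m + K + K)) + i)]) = zs := by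
      simp only [e4]
      rw [← hzs.length_eq]
      exact flatMap_getD zs
    simp only [e1, e2, e3, Int.toNat_natCast] at h1
    obtain ⟨t, M, hx, hM, ht⟩ := h1
    rw [show (List.range (K + 2 * (K * m))).flatMap _ = zs from hval] at hM ht
    refine ⟨t, M, hx, hM, ht.trans ?_⟩
    rw [bitLength_append]
    simp
  refine ⟨p, p', p', q.comp (Polynomial.X + 1) + q'.comp (Polynomial.X + 1),
    fun n m K J xs hxs => ?_⟩
  obtain ⟨hok, hat⟩ := hxs.ok []
  rw [List.append_nil] at hok hat
  refine ⟨J.toMulti, toMultiCode (inputOf 3 xs).entry n m K, hat.codes_toMulti, ?_,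
    fun β S zs hzs => ⟨fun h => ⟨S, zs, hzs, hrun n m K J xs hxs S zs hzs, h⟩,
      fun h => ⟨S, zs, hzs, hrun n m K J xs hxs S zs hzs, h⟩⟩⟩
  have h1 := hp xs _ hok
  have e1 : (inputOf 3 xs).entry 1 = n := hat.n_eq
  have e2 : (inputOf 3 xs).entry 2 = m := hat.m_eq
  have e3 : (inputOf 3 xs).entry 3 = K := hat.K_eq
  simp only [e1, e2, e3, Int.toNat_natCast] at h1
  obtain ⟨t, M, hx, hM, ht⟩ := h1
  exact ⟨t, M, hx, hM, ht.trans (by simp)⟩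

end BCD

namespace BCD

/-! ## Common denominators -/

/-- The common denominator of the first `N` fractions of the list that starts in cell `b`. -/
def common (cell : ℕ → ℤ) (b N : ℕ) : ℤ := ∏ p ∈ Finset.range N, den cell b p

/-- The numerator of fraction `p` with respect to the common denominator. -/
def scaled (cell : ℕ → ℤ) (b N p : ℕ) : ℤ := num cell b p * (common cell b N / den cell b p)

theorem common_pos {cell : ℕ → ℤ} {b N : ℕ} (h : ∀ p, p < N → 0 < den cell b p) :
    0 < common cell b N :=
  Finset.prod_pos fun p hp => h p (Finset.mem_range.1 hp)

/-- Each denominator divides the product of all of them, so the integer division in `scaled` is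
exact. -/
theorem frac_eq_scaled {cell : ℕ → ℤ} {b N p : ℕ} (h : ∀ p, p < N → 0 < den cell b p)
    (hp : p < N) : frac cell b p = (scaled cell b N p : ℝ) / common cell b N := by
  obtain ⟨c, hc⟩ : den cell b p ∣ common cell b N :=
    Finset.dvd_prod_of_mem _ (Finset.mem_range.2 hp)
  have h1 : (den cell b p : ℝ) ≠ 0 := by exact_mod_cast (h p hp).ne'
  have h2 : (common cell b N : ℝ) ≠ 0 := by exact_mod_cast (common_pos h).ne'
  rw [frac_eq, scaled, hc, Int.mul_ediv_cancel_left _ (h p hp).ne', div_eq_div_iff h1 (by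
    rw [← hc]
    exact h2)]
  push_cast
  ring

/-- The number of fractions in the code of a multi-parameter instance. -/
def codeSize (n m K : ℕ) : ℕ := K * (n * m) + K * n + m + K

/-- The common denominator of the input. -/
def comD (cell : ℕ → ℤ) (n m K : ℕ) : ℤ := common cell 5 (codeSize n m K)

/-- Numerators of the transition probabilities. -/
def numF (cell : ℕ → ℤ) (n m K k i j : ℕ) : ℤ :=
  scaled cell 5 (codeSize n m K) (k * (n * m) + (i * m + j))

/-- Numerators of the costs. -/
def numC (cell : ℕ → ℤ) (n m K q : ℕ) : ℤ :=
  scaled cell 5 (codeSize n m K) (K * (n * m) + q)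

/-- Numerators of the rewards. -/
def numR (cell : ℕ → ℤ) (n m K j : ℕ) : ℤ :=
  scaled cell 5 (codeSize n m K) (K * (n * m) + K * n + j)

/-- Numerators of the type probabilities. -/
def numM (cell : ℕ → ℤ) (n m K k : ℕ) : ℤ :=
  scaled cell 5 (codeSize n m K) (K * (n * m) + K * n + m + k)

/-- The numerator of the sum of the rewards. -/
def sumR (cell : ℕ → ℤ) (n m K : ℕ) : ℤ := ∑ j ∈ Finset.range m, numR cell n m K j

/-- An integer that exceeds all relevant magnitudes of the instance. -/
def bound (cell : ℕ → ℤ) (n m K ℓ : ℕ) : ℤ :=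
  2 + comD cell n m K + sumR cell n m K + ∑ q ∈ Finset.range (K * n), numC cell n m K q +
    2 ^ ℓ + m

section

variable {Γ : Type} [Ctx Γ] {n m K ℓ : Γ → ℕ}

theorem comp_common {b N : Γ → ℕ} (hb : Small b) (hN : Small N) :
    Comp (fun γ => common (Ctx.cell γ) (b γ) (N γ)) :=
  Comp.prod (b := fun γ p => den (Ctx.cell γ) (b γ) p) hN (Comp.den (Γ := Γ × ℕ) hb.fst small_snd)

theorem comp_scaled {b N p : Γ → ℕ} (hb : Small b) (hN : Small N) (hp : Small p) :
    Comp (fun γ => scaled (Ctx.cell γ) (b γ) (N γ) (p γ)) :=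
  (Comp.num hb hp).mul ((comp_common hb hN).div (Comp.den hb hp))

theorem small_codeSize (hn : Small n) (hm : Small m) (hK : Small K) :
    Small (fun γ => codeSize (n γ) (m γ) (K γ)) :=
  (((hK.mul (hn.mul hm)).add (hK.mul hn)).add hm).add hK

theorem comp_comD (hn : Small n) (hm : Small m) (hK : Small K) :
    Comp (fun γ => comD (Ctx.cell γ) (n γ) (m γ) (K γ)) :=
  comp_common (small_const 5) (small_codeSize hn hm hK)

theorem comp_numF (hn : Small n) (hm : Small m) (hK : Small K) {k i j : Γ → ℕ} (hk : Small k)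
    (hi : Small i) (hj : Small j) :
    Comp (fun γ => numF (Ctx.cell γ) (n γ) (m γ) (K γ) (k γ) (i γ) (j γ)) :=
  comp_scaled (small_const 5) (small_codeSize hn hm hK)
    ((hk.mul (hn.mul hm)).add ((hi.mul hm).add hj))

theorem comp_numC (hn : Small n) (hm : Small m) (hK : Small K) {q : Γ → ℕ} (hq : Small q) :
    Comp (fun γ => numC (Ctx.cell γ) (n γ) (m γ) (K γ) (q γ)) :=
  comp_scaled (small_const 5) (small_codeSize hn hm hK) ((hK.mul (hn.mul hm)).add hq)

theorem comp_numR (hn : Small n) (hm : Small m) (hK : Small K) {j : Γ → ℕ} (hj : Small j) :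
    Comp (fun γ => numR (Ctx.cell γ) (n γ) (m γ) (K γ) (j γ)) :=
  comp_scaled (small_const 5) (small_codeSize hn hm hK)
    (((hK.mul (hn.mul hm)).add (hK.mul hn)).add hj)

theorem comp_numM (hn : Small n) (hm : Small m) (hK : Small K) {k : Γ → ℕ} (hk : Small k) :
    Comp (fun γ => numM (Ctx.cell γ) (n γ) (m γ) (K γ) (k γ)) :=
  comp_scaled (small_const 5) (small_codeSize hn hm hK)
    ((((hK.mul (hn.mul hm)).add (hK.mul hn)).add hm).add hk)

theorem comp_sumR (hn : Small n) (hm : Small m) (hK : Small K) :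
    Comp (fun γ => sumR (Ctx.cell γ) (n γ) (m γ) (K γ)) :=
  Comp.sum (b := fun γ j => numR (Ctx.cell γ) (n γ) (m γ) (K γ) j) hm
    (comp_numR (Γ := Γ × ℕ) hn.fst hm.fst hK.fst small_snd)

theorem comp_two_pow (hℓ : Small ℓ) : Comp (fun γ => (2 : ℤ) ^ ℓ γ) := (comp_const 2).pow hℓ

theorem comp_bound (hn : Small n) (hm : Small m) (hK : Small K) (hℓ : Small ℓ) :
    Comp (fun γ => bound (Ctx.cell γ) (n γ) (m γ) (K γ) (ℓ γ)) :=
  (((((comp_const 2).add (comp_comD hn hm hK)).add (comp_sumR hn hm hK)).add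
    (Comp.sum (b := fun γ q => numC (Ctx.cell γ) (n γ) (m γ) (K γ) q) (hK.mul hn)
      (comp_numC (Γ := Γ × ℕ) hn.fst hm.fst hK.fst small_snd))).add (comp_two_pow hℓ)).add hm.1

end

namespace MultiInstance.At

variable {n m K : ℕ} {I : MultiInstance n m K} {cell : ℕ → ℤ}

theorem pos_den (h : I.At cell 2) : ∀ p, p < codeSize n m K → 0 < den cell 5 p := h.den_pos

theorem comD_pos (h : I.At cell 2) : 0 < comD cell n m K := common_pos h.pos_den

theorem comD_pos' (h : I.At cell 2) : (0 : ℝ) < comD cell n m K := by exact_mod_cast h.comD_pos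

theorem lt_codeSize_F (k : Fin K) (i : Fin n) (j : Fin m) :
    k * (n * m) + (i * m + j) < codeSize n m K := by
  have := mul_add_lt k.2 (mul_add_lt i.2 j.2)
  unfold codeSize
  omega

theorem lt_codeSize_c {q : ℕ} (hq : q < K * n) : K * (n * m) + q < codeSize n m K := by
  unfold codeSize
  omega

theorem lt_codeSize_r (j : Fin m) : K * (n * m) + K * n + j < codeSize n m K := by
  have := j.2
  unfold codeSize
  omega

theorem lt_codeSize_μ (k : Fin K) : K * (n * m) + K * n + m + k < codeSize n m K := by
  have := k.2
  unfold codeSize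
  omega

theorem F_eq_numF (h : I.At cell 2) (k : Fin K) (i : Fin n) (j : Fin m) :
    I.F k i j = (numF cell n m K k i j : ℝ) / comD cell n m K :=
  (h.F_eq k i j).trans (frac_eq_scaled h.pos_den (lt_codeSize_F k i j))

theorem c_eq_numC (h : I.At cell 2) (k : Fin K) (i : Fin n) :
    I.c k i = (numC cell n m K (k * n + i) : ℝ) / comD cell n m K :=
  (h.c_eq k i).trans (frac_eq_scaled h.pos_den (lt_codeSize_c (mul_add_lt k.2 i.2)))

theorem r_eq_numR (h : I.At cell 2) (j : Fin m) :
    I.r j = (numR cell n m K j : ℝ) / comD cell n m K :=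
  (h.r_eq j).trans (frac_eq_scaled h.pos_den (lt_codeSize_r j))

theorem μ_eq_numM (h : I.At cell 2) (k : Fin K) :
    I.μ k = (numM cell n m K k : ℝ) / comD cell n m K :=
  (h.μ_eq k).trans (frac_eq_scaled h.pos_den (lt_codeSize_μ k))

theorem totalReward_eq (h : I.At cell 2) :
    I.totalReward = (sumR cell n m K : ℝ) / comD cell n m K := by
  rw [totalReward, sumR, Finset.sum_range]
  push_cast
  rw [Finset.sum_div]
  exact Finset.sum_congr rfl fun j _ => h.r_eq_numR j

theorem totalCost_eq (h : I.At cell 2) : I.totalCost =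
    ((∑ q ∈ Finset.range (K * n), numC cell n m K q : ℤ) : ℝ) / comD cell n m K := by
  rw [totalCost, Finset.sum_range, ← finProdFinEquiv.sum_comp, Fintype.sum_prod_type]
  push_cast
  rw [Finset.sum_div]
  refine Finset.sum_congr rfl fun k _ => ?_
  rw [Finset.sum_div]
  refine Finset.sum_congr rfl fun i _ => ?_
  rw [h.c_eq_numC]
  congr 3
  simp only [finProdFinEquiv_apply_val]
  ring

theorem nonneg_of_div (h : I.At cell 2) {z : ℤ} (hz : 0 ≤ (z : ℝ) / comD cell n m K) : 0 ≤ z := by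
  have h1 := h.comD_pos'
  rw [le_div_iff₀ h1, zero_mul] at hz
  exact_mod_cast hz

theorem div_le_self (h : I.At cell 2) {z : ℤ} (hz : 0 ≤ z) :
    (z : ℝ) / comD cell n m K ≤ z := by
  have h1 : (1 : ℝ) ≤ comD cell n m K := by exact_mod_cast h.comD_pos
  exact _root_.div_le_self (by exact_mod_cast hz) h1

theorem sumR_nonneg (h : I.At cell 2) : 0 ≤ sumR cell n m K :=
  h.nonneg_of_div (by rw [← h.totalReward_eq]; exact I.totalReward_nonneg)

theorem sumC_nonneg (h : I.At cell 2) :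
    0 ≤ ∑ q ∈ Finset.range (K * n), numC cell n m K q :=
  h.nonneg_of_div (by rw [← h.totalCost_eq]; exact I.totalCost_nonneg)

/-- The bounds that are guaranteed by the choice of `bound`. -/
theorem bound_spec (h : I.At cell 2) (ℓ : ℕ) :
    2 ≤ bound cell n m K ℓ ∧ comD cell n m K ≤ bound cell n m K ℓ ∧
      sumR cell n m K ≤ bound cell n m K ℓ ∧
      ∑ q ∈ Finset.range (K * n), numC cell n m K q ≤ bound cell n m K ℓ ∧
      2 ^ ℓ ≤ bound cell n m K ℓ ∧ (m : ℤ) ≤ bound cell n m K ℓ := by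
  have h1 := h.comD_pos
  have h2 := h.sumR_nonneg
  have h3 := h.sumC_nonneg
  have h4 : (0 : ℤ) < 2 ^ ℓ := by positivity
  have h5 : (0 : ℤ) ≤ m := by positivity
  unfold bound
  refine ⟨by linarith, by linarith, by linarith, by linarith, by linarith, by linarith⟩

theorem two_le_bound (h : I.At cell 2) (ℓ : ℕ) : (2 : ℝ) ≤ bound cell n m K ℓ := by
  exact_mod_cast (h.bound_spec ℓ).1

/-- A positive fraction with the common denominator D is at least 1/D, and the bound exceeds D. -/
theorem one_le_bound_mul (h : I.At cell 2) (ℓ : ℕ) {z : ℤ} (hz : 0 < (z : ℝ) / comD cell n m K) :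
    1 ≤ (bound cell n m K ℓ : ℝ) * (z / comD cell n m K) := by
  have h1 := h.comD_pos'
  have h2 : (comD cell n m K : ℝ) ≤ bound cell n m K ℓ := by exact_mod_cast (h.bound_spec ℓ).2.1
  have h3 : 0 < (z : ℝ) := by
    rwa [lt_div_iff₀ h1, zero_mul] at hz
  have h4 : (1 : ℝ) ≤ z := by exact_mod_cast h3
  calc (1 : ℝ) ≤ z := h4
    _ = comD cell n m K * (z / comD cell n m K) := by field_simp
    _ ≤ _ := mul_le_mul_of_nonneg_right h2 hz.le

theorem one_le_bound_mul_μ (h : I.At cell 2) (ℓ : ℕ) (k : Fin K) :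
    1 ≤ (bound cell n m K ℓ : ℝ) * I.μ k := by
  have h1 := I.μ_pos k
  rw [h.μ_eq_numM] at h1 ⊢
  exact h.one_le_bound_mul ℓ h1

theorem one_le_bound_mul_F (h : I.At cell 2) (ℓ : ℕ) (k : Fin K) (i : Fin n) (j : Fin m)
    (hF : I.F k i j ≠ 0) : 1 ≤ (bound cell n m K ℓ : ℝ) * I.F k i j := by
  have h1 := lt_of_le_of_ne (I.F_nonneg k i j) hF.symm
  rw [h.F_eq_numF] at h1 ⊢
  exact h.one_le_bound_mul ℓ h1

theorem totalReward_le_bound (h : I.At cell 2) (ℓ : ℕ) : I.totalReward ≤ bound cell n m K ℓ := by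
  rw [h.totalReward_eq]
  refine (h.div_le_self h.sumR_nonneg).trans ?_
  exact_mod_cast (h.bound_spec ℓ).2.2.1

theorem totalCost_le_bound (h : I.At cell 2) (ℓ : ℕ) : I.totalCost ≤ bound cell n m K ℓ := by
  rw [h.totalCost_eq]
  refine (h.div_le_self h.sumC_nonneg).trans ?_
  exact_mod_cast (h.bound_spec ℓ).2.2.2.1

/-- Times D², the difference is a positive integer: rewards times probabilities have denominator D²,
costs have D. -/
theorem gap (h : I.At cell 2) (ℓ : ℕ) (k : Fin K) (i : Fin n) (hlt : I.c k i < I.reward k i) :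
    1 ≤ (bound cell n m K ℓ : ℝ) ^ 2 * (I.reward k i - I.c k i) := by
  have h1 := h.comD_pos'
  have h2 : (comD cell n m K : ℝ) ≤ bound cell n m K ℓ := by exact_mod_cast (h.bound_spec ℓ).2.1
  have h3 : (comD cell n m K : ℝ) ^ 2 * (I.reward k i - I.c k i) =
      ((∑ j : Fin m, numF cell n m K k i j * numR cell n m K j -
        numC cell n m K (k * n + i) * comD cell n m K : ℤ) : ℝ) := by
    push_cast
    rw [reward, h.c_eq_numC, mul_sub, Finset.mul_sum]
    congr 1
    · refine Finset.sum_congr rfl fun j _ => ?_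
      rw [h.F_eq_numF, h.r_eq_numR]
      field_simp
    · field_simp
  have h4 : 0 < (comD cell n m K : ℝ) ^ 2 * (I.reward k i - I.c k i) :=
    mul_pos (by positivity) (by linarith)
  have h5 : 1 ≤ (comD cell n m K : ℝ) ^ 2 * (I.reward k i - I.c k i) := by
    rw [h3] at h4 ⊢
    exact_mod_cast h4
  refine h5.trans (mul_le_mul_of_nonneg_right (pow_le_pow_left₀ h1.le h2 2) (by linarith))

end MultiInstance.At

/-! ## From multi-parameter to single-parameter instances -/

/-- The base of the powers in the single-parameter instance. -/
def powBase (cell : ℕ → ℤ) (n m K ℓ : ℕ) : ℤ := bound cell n m K ℓ ^ 40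

/-- The additional cost of the old actions. -/
noncomputable def extraCost (cell : ℕ → ℤ) (n m K ℓ : ℕ) : ℝ :=
  (sumR cell n m K : ℝ) / comD cell n m K * ((bound cell n m K ℓ : ℝ) ^ 20)⁻¹

/-- The code of the single-parameter instance that simulates the instance in the input. -/
def toSingleCode (cell : ℕ → ℤ) (n m K ℓ : ℕ) : List ℤ :=
  ((n * K + 1 : ℕ) : ℤ) :: ((m + 1 : ℕ) : ℤ) :: ((K + 1 : ℕ) : ℤ) ::
    ((([1, 1] ++ (List.range m).flatMap fun _ => [0, 1]) ++
      (List.range n).flatMap fun i => (List.range K).flatMap fun k =>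
        [powBase cell n m K ℓ ^ (k + 1) - 1, powBase cell n m K ℓ ^ (k + 1)] ++
          (List.range m).flatMap fun j => [num cell 5 (k * (n * m) + (i * m + j)),
            den cell 5 (k * (n * m) + (i * m + j)) * powBase cell n m K ℓ ^ (k + 1)]) ++
    ([0, 1] ++ (List.range n).flatMap fun i => (List.range K).flatMap fun k =>
      [numC cell n m K (k * n + i) * bound cell n m K ℓ ^ 20 + sumR cell n m K,
        comD cell n m K * bound cell n m K ℓ ^ 20 * powBase cell n m K ℓ ^ (2 * k + 1)]) ++
    ([0, 1] ++ (List.range m).flatMap fun j =>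
      [num cell 5 (K * (n * m) + K * n + j), den cell 5 (K * (n * m) + K * n + j)]) ++
    ([powBase cell n m K ℓ ^ (2 * K + 1), 1] ++ (List.range K).flatMap fun k =>
      [powBase cell n m K ℓ ^ k, 1]) ++
    ([comD cell n m K * powBase cell n m K ℓ ^ K -
        ∑ k ∈ Finset.range K, numM cell n m K k * powBase cell n m K ℓ ^ k,
      comD cell n m K * powBase cell n m K ℓ ^ K] ++ (List.range K).flatMap fun k =>
        [num cell 5 (K * (n * m) + K * n + m + k),
          den cell 5 (K * (n * m) + K * n + m + k) * powBase cell n m K ℓ ^ (K - k)]))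

theorem emits_toSingleCode {Γ : Type} [Ctx Γ] {n m K ℓ : Γ → ℕ} (hn : Small n) (hm : Small m)
    (hK : Small K) (hℓ : Small ℓ) :
    Emits (fun γ => toSingleCode (Ctx.cell γ) (n γ) (m γ) (K γ) (ℓ γ)) := by
  have hB := comp_bound hn hm hK hℓ
  have hX : Comp fun γ => powBase (Ctx.cell γ) (n γ) (m γ) (K γ) (ℓ γ) := hB.pow (small_const 40)
  have h5 {Δ : Type} [Ctx Δ] : Small fun _ : Δ => 5 := small_const 5
  have h1 {Δ : Type} [Ctx Δ] : Small fun _ : Δ => 1 := small_const 1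
  have c1 {Δ : Type} [Ctx Δ] : Comp fun _ : Δ => 1 := comp_const 1
  have c0 {Δ : Type} [Ctx Δ] : Comp fun _ : Δ => 0 := comp_const 0
  have hD := comp_comD hn hm hK
  refine ((hn.mul hK).add h1).1.cons ((hm.add h1).1.cons ((hK.add h1).1.cons
    (((((?_ : Emits _).append ?_).append ?_).append ?_).append ?_)))
  · refine ((c1.pair c1).append (Emits.flatMap hm (c0.pair c1))).append
      (Emits.flatMap hn (Emits.flatMap hK.fst (Emits.append ?_ (Emits.flatMap hm.fst.fst ?_))))
    · have := hX.fst.fst.pow (small_snd.add h1)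
      exact (this.sub c1).pair this
    · have hp : Small fun x : ((Γ × ℕ) × ℕ) × ℕ => x.1.2 * (n x.1.1.1 * m x.1.1.1) +
          (x.1.1.2 * m x.1.1.1 + x.2) :=
        (small_snd.fst.mul (hn.fst.fst.fst.mul hm.fst.fst.fst)).add
          ((small_snd.fst.fst.mul hm.fst.fst.fst).add small_snd)
      exact (Comp.num h5 hp).pair
        ((Comp.den h5 hp).mul (hX.fst.fst.fst.pow (small_snd.fst.add h1)))
  · refine (c0.pair c1).append (Emits.flatMap hn (Emits.flatMap hK.fst ?_))
    have hY := hB.fst.fst.pow (small_const 20)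
    exact (((comp_numC hn.fst.fst hm.fst.fst hK.fst.fst
      ((small_snd.mul hn.fst.fst).add small_snd.fst)).mul hY).add
        (comp_sumR hn hm hK).fst.fst).pair
      ((hD.fst.fst.mul hY).mul (hX.fst.fst.pow (((small_const 2).mul small_snd).add h1)))
  · refine (c0.pair c1).append (Emits.flatMap hm ?_)
    exact emits_frac h5 (((hK.fst.mul (hn.fst.mul hm.fst)).add (hK.fst.mul hn.fst)).add small_snd)
  · exact ((hX.pow (((small_const 2).mul hK).add h1)).pair c1).append
      (Emits.flatMap hK ((hX.fst.pow small_snd).pair c1))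
  · have hDX := hD.mul (hX.pow hK)
    refine ((hDX.sub (Comp.sum (b := fun γ k => numM (Ctx.cell γ) (n γ) (m γ) (K γ) k *
      powBase (Ctx.cell γ) (n γ) (m γ) (K γ) (ℓ γ) ^ k) hK ?_)).pair hDX).append
      (Emits.flatMap hK ?_)
    · exact (comp_numM (Γ := Γ × ℕ) hn.fst hm.fst hK.fst small_snd).mul (hX.fst.pow small_snd)
    · have hp : Small fun x : Γ × ℕ => K x.1 * (n x.1 * m x.1) + K x.1 * n x.1 + m x.1 + x.2 :=
        (((hK.fst.mul (hn.fst.mul hm.fst)).add (hK.fst.mul hn.fst)).add hm.fst).add small_snd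
      exact (Comp.num h5 hp).pair ((Comp.den h5 hp).mul (hX.fst.pow (hK.fst.sub small_snd)))

theorem codesReals_flatten_ofFn_cons {a : ℕ} {f : Fin (a + 1) → List ℝ} {g g' : List ℤ}
    (h0 : CodesReals (f 0) g) (h1 : CodesReals (List.ofFn fun i : Fin a => f i.succ).flatten g') :
    CodesReals (List.ofFn f).flatten (g ++ g') := by
  rw [List.ofFn_succ, List.flatten_cons]
  exact h0.append h1

theorem codesReals_ofFn_cons {a : ℕ} {f : Fin (a + 1) → ℝ} {g g' : List ℤ}
    (h0 : CodesReals [f 0] g) (h1 : CodesReals (List.ofFn fun i : Fin a => f i.succ) g') :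
    CodesReals (List.ofFn f) (g ++ g') := by
  rw [List.ofFn_succ]
  exact h0.append h1

/-- `finProdFinEquiv` enumerates pairs lexicographically with the first component leading, matching
the order of the nested loops. -/
theorem codesReals_flatten_ofFn_mul {a b : ℕ} {f : Fin (a * b) → List ℝ} {g : ℕ → ℕ → List ℤ}
    (h : ∀ (i : Fin a) (k : Fin b), CodesReals (f (finProdFinEquiv (i, k))) (g i k)) :
    CodesReals (List.ofFn f).flatten
      ((List.range a).flatMap fun i => (List.range b).flatMap (g i)) := by
  rw [List.ofFn_mul, List.flatten_flatten, List.map_ofFn]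
  refine codesReals_flatten_ofFn fun i => codesReals_flatten_ofFn fun k => ?_
  have := h i k
  convert this using 2
  ext
  simp only [finProdFinEquiv_apply_val]
  ring

theorem codesReals_ofFn_mul {a b : ℕ} {f : Fin (a * b) → ℝ} {g : ℕ → ℕ → List ℤ}
    (h : ∀ (i : Fin a) (k : Fin b), CodesReals [f (finProdFinEquiv (i, k))] (g i k)) :
    CodesReals (List.ofFn f)
      ((List.range a).flatMap fun i => (List.range b).flatMap (g i)) := by
  rw [← flatten_ofFn_singleton]
  exact codesReals_flatten_ofFn_mul h

namespace MultiInstance.At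

variable {n m K : ℕ} {I : MultiInstance n m K} {cell : ℕ → ℤ}

theorem extraCost_eq (h : I.At cell 2) (ℓ : ℕ) :
    extraCost cell n m K ℓ = I.totalReward * ((bound cell n m K ℓ : ℝ) ^ 20)⁻¹ := by
  rw [extraCost, h.totalReward_eq]

theorem extraCost_nonneg (h : I.At cell 2) (ℓ : ℕ) : 0 ≤ extraCost cell n m K ℓ := by
  rw [h.extraCost_eq]
  have h1 := I.totalReward_nonneg
  have h2 := h.two_le_bound ℓ
  positivity

/-- The single-parameter instance that is computed for the accuracy `2 ^ (-ℓ)`. -/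
noncomputable def single (h : I.At cell 2) (ℓ : ℕ) : SingleInstance (n * K + 1) (m + 1) (K + 1) :=
  I.toSingle ((bound cell n m K ℓ : ℝ) ^ 40) (extraCost cell n m K ℓ)
    (two_le_pow (h.two_le_bound ℓ)) (h.extraCost_nonneg ℓ)

theorem codes_single (h : I.At cell 2) (ℓ : ℕ) :
    (h.single ℓ).Codes (toSingleCode cell n m K ℓ) := by
  have hd := h.pos_den
  have hH : 0 < bound cell n m K ℓ := by linarith [(h.bound_spec ℓ).1]
  have hD := h.comD_pos
  set X := powBase cell n m K ℓ with hX
  have hX0 : 0 < X := pow_pos hH 40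
  have hXr : ((bound cell n m K ℓ : ℝ) ^ 40) = (X : ℝ) := by rw [hX, powBase]; push_cast; rfl
  have hXr0 : (X : ℝ) ≠ 0 := by exact_mod_cast hX0.ne'
  have hDr0 : (comD cell n m K : ℝ) ≠ 0 := by exact_mod_cast hD.ne'
  have hHr0 : (bound cell n m K ℓ : ℝ) ≠ 0 := by exact_mod_cast hH.ne'
  have c1 : CodesReals [1] [1, 1] := codesReals_singleton one_pos (by norm_num)
  have c0 : CodesReals [0] [0, 1] := codesReals_singleton one_pos (by norm_num)
  refine ⟨_, CodesReals.append (CodesReals.append (CodesReals.append (CodesReals.append ?_ ?_) ?_)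
    ?_) ?_, rfl⟩
  · refine codesReals_flatten_ofFn_cons (codesReals_ofFn_cons ?_ (codesReals_ofFn fun j => ?_))
      (codesReals_flatten_ofFn_mul fun i k => codesReals_ofFn_cons ?_ (codesReals_ofFn fun j => ?_))
    · exact c1
    · exact c0
    · refine codesReals_singleton (pow_pos hX0 _) ?_
      simp only [single, toSingle, Fin.cons_succ, Fin.cons_zero, Equiv.symm_apply_apply, hXr, ← hX]
      push_cast
      field_simp
    · refine codesReals_singleton (mul_pos (hd _ (lt_codeSize_F k i j)) (pow_pos hX0 _)) ?_
      simp only [single, toSingle, Fin.cons_succ, Equiv.symm_apply_apply, hXr, h.F_eq, frac_eq]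
      push_cast
      rw [inv_mul_eq_div, div_div]
  · refine codesReals_ofFn_cons c0 (codesReals_ofFn_mul fun i k => ?_)
    refine codesReals_singleton (mul_pos (mul_pos hD (pow_pos hH _)) (pow_pos hX0 _)) ?_
    simp only [single, toSingle, Fin.cons_succ, Equiv.symm_apply_apply, hXr, h.c_eq_numC, extraCost,
      ← hX]
    push_cast
    field_simp
  · refine codesReals_ofFn_cons c0 (codesReals_ofFn fun j => ?_)
    exact codesReals_singleton (hd _ (lt_codeSize_r j)) (h.r_eq j)
  · refine codesReals_ofFn_cons ?_ (codesReals_ofFn fun k => ?_)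
    · refine codesReals_singleton one_pos ?_
      simp only [single, toSingle, Fin.cons_zero, hXr]
      push_cast
      rw [div_one]
    · refine codesReals_singleton one_pos ?_
      simp only [single, toSingle, Fin.cons_succ, hXr]
      push_cast
      rw [div_one]
  · refine codesReals_ofFn_cons ?_ (codesReals_ofFn fun k => ?_)
    · refine codesReals_singleton (mul_pos hD (pow_pos hX0 _)) ?_
      simp only [single, toSingle, Fin.cons_zero, hXr]
      rw [Finset.sum_range, ← hX]
      push_cast
      rw [sub_div, div_self (by positivity), Finset.sum_div]
      congr 1
      refine Finset.sum_congr rfl fun k _ => ?_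
      -- Over the denominator D·X^K, the weight of type k has numerator M_k·X^k; this is how the sum
      -- is emitted.
      have hk : (X : ℝ) ^ K = X ^ (K - k : ℕ) * X ^ (k : ℕ) := by
        rw [← pow_add]
        congr 1
        have := k.2
        omega
      rw [h.μ_eq_numM, hk]
      field_simp
    · refine codesReals_singleton (mul_pos (hd _ (lt_codeSize_μ k)) (pow_pos hX0 _)) ?_
      simp only [single, toSingle, Fin.cons_succ, hXr, h.μ_eq, frac_eq]
      push_cast
      rw [← div_eq_mul_inv, div_div]

/-- The surcharge is at most B because `bound` also exceeds the number of outcomes, and so R ≤ H·B.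
The doubled cost is then halved by the negative power of X. -/
theorem single_boundedBy (h : I.At cell 2) (ℓ : ℕ) {B : ℝ} (hB : I.BoundedBy B) :
    (h.single ℓ).BoundedBy B := by
  have hB0 : 0 ≤ B := (I.c_nonneg ⟨0, I.K_pos⟩ ⟨0, I.n_pos⟩).trans (hB.2 _ _)
  have hH := h.two_le_bound ℓ
  set H : ℝ := ((bound cell n m K ℓ : ℤ) : ℝ) with hHdef
  have hX := two_le_pow hH
  refine ⟨fun j => ?_, fun a => ?_⟩
  · cases j using Fin.cases with
    | zero => exact hB0
    | succ j => exact hB.1 j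
  · cases a using Fin.cases with
    | zero => exact hB0
    | succ x =>
      have h1 := hB.2 (finProdFinEquiv.symm x).2 (finProdFinEquiv.symm x).1
      have h2 : extraCost cell n m K ℓ ≤ B := by
        rw [h.extraCost_eq, ← hHdef]
        have h3 : I.totalReward ≤ H * B := by
          calc I.totalReward ≤ ∑ _j : Fin m, B := Finset.sum_le_sum fun j _ => hB.1 j
            _ = m * B := by simp
            _ ≤ H * B := mul_le_mul_of_nonneg_right (by
                rw [hHdef]
                exact_mod_cast (h.bound_spec ℓ).2.2.2.2.2) hB0
        have h4 : H ≤ H ^ 20 := le_self_pow₀ (by linarith) (by norm_num)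
        rw [← div_eq_mul_inv, div_le_iff₀ (by positivity)]
        calc I.totalReward ≤ H * B := h3
          _ ≤ H ^ 20 * B := mul_le_mul_of_nonneg_right h4 hB0
          _ = B * H ^ 20 := mul_comm _ _
      have h3 : ((H ^ 40) ^ (2 * (finProdFinEquiv.symm x).2 + 1 : ℕ))⁻¹ ≤ 1 / 2 := by
        rw [one_div]
        exact inv_anti₀ (by norm_num) (hX.trans (le_self_pow₀ (by linarith) (by omega)))
      change (_ + _) * _ ≤ B
      calc _ ≤ (B + B) * (1 / 2) := mul_le_mul (add_le_add h1 h2) h3 (by positivity) (by linarith)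
        _ = B := by ring

end MultiInstance.At

end BCD

namespace BCD

/-! ## Searching -/

/-- The first index below `N` at which `e` is positive (and `N` if there is none). -/
def search (N : ℕ) (e : ℕ → ℤ) : ℕ :=
  ∑ o ∈ Finset.range N, ∏ o' ∈ Finset.range (o + 1), if 0 < e o' then 0 else 1

theorem search_le (N : ℕ) (e : ℕ → ℤ) : search N e ≤ N := by
  calc search N e ≤ ∑ _o ∈ Finset.range N, 1 := Finset.sum_le_sum fun o _ =>
        Finset.prod_le_one (fun _ _ => Nat.zero_le _) fun _ _ => by split_ifs <;> omega
    _ = N := by simp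

/-- The product up to `o` is one exactly as long as there has been no hit, so the sum counts the
indices before the first hit. -/
theorem search_spec {N : ℕ} {e : ℕ → ℤ} (h : ∃ o, o < N ∧ 0 < e o) :
    search N e < N ∧ 0 < e (search N e) := by
  classical
  have hs := Nat.find_spec h
  set o₀ := Nat.find h with ho₀
  have hmin : ∀ o, o < o₀ → ¬ 0 < e o := fun o ho he =>
    Nat.find_min h ho ⟨ho.trans hs.1, he⟩
  have : search N e = o₀ := by
    unfold search
    rw [← Finset.sum_range_add_sum_Ico _ hs.1.le]
    have h1 : ∀ o ∈ Finset.range o₀,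
        (∏ o' ∈ Finset.range (o + 1), if 0 < e o' then 0 else 1) = 1 := by
      intro o ho
      rw [Finset.mem_range] at ho
      refine Finset.prod_eq_one fun o' ho' => ?_
      rw [Finset.mem_range] at ho'
      rw [if_neg (hmin o' (by omega))]
    have h2 : ∀ o ∈ Finset.Ico o₀ N,
        (∏ o' ∈ Finset.range (o + 1), if 0 < e o' then 0 else 1) = 0 := by
      intro o ho
      rw [Finset.mem_Ico] at ho
      refine Finset.prod_eq_zero (i := o₀) (Finset.mem_range.2 (by omega)) ?_
      rw [if_pos hs.2]
    rw [Finset.sum_congr rfl h1, Finset.sum_congr rfl h2]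
    simp
  rw [this]
  exact hs

theorem small_search {Γ : Type} [Ctx Γ] {N : Γ → ℕ} {e : Γ → ℕ → ℤ} (hN : Small N)
    (he : Comp fun x : (Γ × ℕ) × ℕ => e x.1.1 x.2) : Small (fun γ => search (N γ) (e γ)) := by
  have hN1 : Small fun x : Γ × ℕ => x.2 + 1 := small_snd.add (small_const 1)
  have h0 : Comp fun x : (Γ × ℕ) × ℕ => if 0 < e x.1.1 x.2 then (0 : ℤ) else 1 :=
    he.ite_pos (comp_const 0) (comp_const 1)
  have h1 : Comp fun x : Γ × ℕ => ∏ o' ∈ Finset.range (x.2 + 1),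
      if 0 < e x.1 o' then (0 : ℤ) else 1 :=
    Comp.prod (b := fun (x : Γ × ℕ) o' => if 0 < e x.1 o' then (0 : ℤ) else 1) hN1 h0
  have h2 := Comp.sum (b := fun γ o => ∏ o' ∈ Finset.range (o + 1),
    if 0 < e γ o' then (0 : ℤ) else 1) hN h1
  obtain ⟨-, q, hq⟩ := hN
  refine ⟨h2.congr fun γ => ?_, q, fun L γ h => (search_le _ _).trans (hq L γ h)⟩
  unfold search
  rw [Nat.cast_sum]
  refine Finset.sum_congr rfl fun o _ => ?_
  rw [Nat.cast_prod]
  exact Finset.prod_congr rfl fun o' _ => by split_ifs <;> rfl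

/-! ## Converting mechanisms -/

/-- The first cell of the payments of a mechanism for the single-parameter instance, which follows the
code of the multi-parameter instance. -/
def payBase (n m K : ℕ) : ℕ := 5 + 2 * codeSize n m K + (K + 1)

/-- The common denominator of the payments. -/
def comP (cell : ℕ → ℤ) (n m K : ℕ) : ℤ := common cell (payBase n m K) ((K + 1) * (m + 1))

/-- Numerators of the payments. -/
def numP (cell : ℕ → ℤ) (n m K k j : ℕ) : ℤ :=
  scaled cell (payBase n m K) ((K + 1) * (m + 1)) (k * (m + 1) + j)

/-- The common denominator of the mixed contracts. -/
def mixDen (cell : ℕ → ℤ) (n m K ℓ : ℕ) : ℤ :=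
  8 * 2 ^ ℓ * comD cell n m K * comP cell n m K

/-- Numerators of the mixed contracts. -/
def mixNum (cell : ℕ → ℤ) (n m K ℓ k j : ℕ) : ℤ :=
  (8 * 2 ^ ℓ - 1) * numP cell n m K (k + 1) (j + 1) * comD cell n m K +
    numR cell n m K j * comP cell n m K

/-- The utility of type `k` from option `o`: contract `o / n` and action `o % n`. -/
def optionValue (cell : ℕ → ℤ) (n m K ℓ k o : ℕ) : ℤ :=
  ∑ j ∈ Finset.range m, numF cell n m K k (o % n) j * mixNum cell n m K ℓ (o / n) j -
    numC cell n m K (k * n + o % n) * mixDen cell n m K ℓ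

/-- Positive if option `o` is optimal for type `k`. -/
def isBest (cell : ℕ → ℤ) (n m K ℓ k o : ℕ) : ℤ :=
  ∏ o' ∈ Finset.range (K * n),
    if 0 < optionValue cell n m K ℓ k o' - optionValue cell n m K ℓ k o then 0 else 1

/-- An optimal option for type `k`. -/
def best (cell : ℕ → ℤ) (n m K ℓ k : ℕ) : ℕ := search (K * n) (isBest cell n m K ℓ k)

/-- The utility of the principal if every type gets an optimal option. -/
def profit (cell : ℕ → ℤ) (n m K ℓ : ℕ) : ℤ :=
  ∑ k ∈ Finset.range K, numM cell n m K k * ∑ j ∈ Finset.range m,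
    numF cell n m K k (best cell n m K ℓ k % n) j * (numR cell n m K j * mixDen cell n m K ℓ -
      mixNum cell n m K ℓ (best cell n m K ℓ k / n) j * comD cell n m K)

/-- The code of the converted mechanism. -/
def convertCode (cell : ℕ → ℤ) (n m K ℓ : ℕ) : List ℤ :=
  ((List.range K).flatMap fun k =>
    [if 0 < profit cell n m K ℓ then ((best cell n m K ℓ k % n : ℕ) : ℤ) else 0]) ++
  (List.range K).flatMap fun k => (List.range m).flatMap fun j =>
    [if 0 < profit cell n m K ℓ then mixNum cell n m K ℓ (best cell n m K ℓ k / n) j else 0,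
      mixDen cell n m K ℓ]

section

variable {Γ : Type} [Ctx Γ] {n m K ℓ : Γ → ℕ}

theorem small_payBase (hn : Small n) (hm : Small m) (hK : Small K) :
    Small (fun γ => payBase (n γ) (m γ) (K γ)) :=
  ((small_const 5).add ((small_const 2).mul (small_codeSize hn hm hK))).add (hK.add (small_const 1))

theorem comp_comP (hn : Small n) (hm : Small m) (hK : Small K) :
    Comp (fun γ => comP (Ctx.cell γ) (n γ) (m γ) (K γ)) :=
  comp_common (small_payBase hn hm hK) ((hK.add (small_const 1)).mul (hm.add (small_const 1)))

theorem comp_numP (hn : Small n) (hm : Small m) (hK : Small K) {k j : Γ → ℕ} (hk : Small k)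
    (hj : Small j) :
    Comp (fun γ => numP (Ctx.cell γ) (n γ) (m γ) (K γ) (k γ) (j γ)) :=
  comp_scaled (small_payBase hn hm hK) ((hK.add (small_const 1)).mul (hm.add (small_const 1)))
    ((hk.mul (hm.add (small_const 1))).add hj)

theorem comp_mixDen (hn : Small n) (hm : Small m) (hK : Small K) (hℓ : Small ℓ) :
    Comp (fun γ => mixDen (Ctx.cell γ) (n γ) (m γ) (K γ) (ℓ γ)) :=
  (((comp_const 8).mul (comp_two_pow hℓ)).mul (comp_comD hn hm hK)).mul (comp_comP hn hm hK)

theorem comp_mixNum (hn : Small n) (hm : Small m) (hK : Small K) (hℓ : Small ℓ) {k j : Γ → ℕ}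
    (hk : Small k) (hj : Small j) :
    Comp (fun γ => mixNum (Ctx.cell γ) (n γ) (m γ) (K γ) (ℓ γ) (k γ) (j γ)) :=
  (((((comp_const 8).mul (comp_two_pow hℓ)).sub (comp_const 1)).mul
    (comp_numP hn hm hK (hk.add (small_const 1)) (hj.add (small_const 1)))).mul
      (comp_comD hn hm hK)).add ((comp_numR hn hm hK hj).mul (comp_comP hn hm hK))

theorem comp_optionValue (hn : Small n) (hm : Small m) (hK : Small K) (hℓ : Small ℓ) {k o : Γ → ℕ}
    (hk : Small k) (ho : Small o) :
    Comp (fun γ => optionValue (Ctx.cell γ) (n γ) (m γ) (K γ) (ℓ γ) (k γ) (o γ)) :=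
  (Comp.sum (b := fun γ j => numF (Ctx.cell γ) (n γ) (m γ) (K γ) (k γ) (o γ % n γ) j *
      mixNum (Ctx.cell γ) (n γ) (m γ) (K γ) (ℓ γ) (o γ / n γ) j) hm
    ((comp_numF (Γ := Γ × ℕ) hn.fst hm.fst hK.fst hk.fst (ho.mod hn).fst small_snd).mul
      (comp_mixNum (Γ := Γ × ℕ) hn.fst hm.fst hK.fst hℓ.fst (ho.div hn).fst small_snd))).sub
  ((comp_numC hn hm hK ((hk.mul hn).add (ho.mod hn))).mul (comp_mixDen hn hm hK hℓ))

theorem comp_isBest (hn : Small n) (hm : Small m) (hK : Small K) (hℓ : Small ℓ) {k o : Γ → ℕ}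
    (hk : Small k) (ho : Small o) :
    Comp (fun γ => isBest (Ctx.cell γ) (n γ) (m γ) (K γ) (ℓ γ) (k γ) (o γ)) :=
  Comp.prod (b := fun γ o' => if 0 < optionValue (Ctx.cell γ) (n γ) (m γ) (K γ) (ℓ γ) (k γ) o' -
      optionValue (Ctx.cell γ) (n γ) (m γ) (K γ) (ℓ γ) (k γ) (o γ) then 0 else 1) (hK.mul hn)
    (((comp_optionValue (Γ := Γ × ℕ) hn.fst hm.fst hK.fst hℓ.fst hk.fst small_snd).sub
      (comp_optionValue hn hm hK hℓ hk ho).fst).ite_pos (comp_const 0) (comp_const 1))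

theorem small_best (hn : Small n) (hm : Small m) (hK : Small K) (hℓ : Small ℓ) {k : Γ → ℕ}
    (hk : Small k) : Small (fun γ => best (Ctx.cell γ) (n γ) (m γ) (K γ) (ℓ γ) (k γ)) :=
  small_search (e := fun γ => isBest (Ctx.cell γ) (n γ) (m γ) (K γ) (ℓ γ) (k γ)) (hK.mul hn)
    (comp_isBest (Γ := (Γ × ℕ) × ℕ) hn.fst.fst hm.fst.fst hK.fst.fst hℓ.fst.fst hk.fst.fst
      small_snd)

theorem comp_profit (hn : Small n) (hm : Small m) (hK : Small K) (hℓ : Small ℓ) :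
    Comp (fun γ => profit (Ctx.cell γ) (n γ) (m γ) (K γ) (ℓ γ)) := by
  have hb := small_best (Γ := Γ × ℕ) hn.fst hm.fst hK.fst hℓ.fst small_snd
  refine Comp.sum (b := fun γ k => numM (Ctx.cell γ) (n γ) (m γ) (K γ) k *
    ∑ j ∈ Finset.range (m γ), numF (Ctx.cell γ) (n γ) (m γ) (K γ) k
      (best (Ctx.cell γ) (n γ) (m γ) (K γ) (ℓ γ) k % n γ) j *
        (numR (Ctx.cell γ) (n γ) (m γ) (K γ) j * mixDen (Ctx.cell γ) (n γ) (m γ) (K γ) (ℓ γ) -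
          mixNum (Ctx.cell γ) (n γ) (m γ) (K γ) (ℓ γ)
            (best (Ctx.cell γ) (n γ) (m γ) (K γ) (ℓ γ) k / n γ) j *
              comD (Ctx.cell γ) (n γ) (m γ) (K γ))) hK ?_
  refine (comp_numM (Γ := Γ × ℕ) hn.fst hm.fst hK.fst small_snd).mul (Comp.sum
    (b := fun (x : Γ × ℕ) j => numF (Ctx.cell x.1) (n x.1) (m x.1) (K x.1) x.2
      (best (Ctx.cell x.1) (n x.1) (m x.1) (K x.1) (ℓ x.1) x.2 % n x.1) j *
        (numR (Ctx.cell x.1) (n x.1) (m x.1) (K x.1) j *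
          mixDen (Ctx.cell x.1) (n x.1) (m x.1) (K x.1) (ℓ x.1) -
          mixNum (Ctx.cell x.1) (n x.1) (m x.1) (K x.1) (ℓ x.1)
            (best (Ctx.cell x.1) (n x.1) (m x.1) (K x.1) (ℓ x.1) x.2 / n x.1) j *
              comD (Ctx.cell x.1) (n x.1) (m x.1) (K x.1))) hm.fst ?_)
  exact (comp_numF (Γ := (Γ × ℕ) × ℕ) hn.fst.fst hm.fst.fst hK.fst.fst small_snd.fst
    (hb.mod hn.fst).fst small_snd).mul
    (((comp_numR (Γ := (Γ × ℕ) × ℕ) hn.fst.fst hm.fst.fst hK.fst.fst small_snd).mul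
      (comp_mixDen hn hm hK hℓ).fst.fst).sub
      ((comp_mixNum (Γ := (Γ × ℕ) × ℕ) hn.fst.fst hm.fst.fst hK.fst.fst hℓ.fst.fst
        (hb.div hn.fst).fst small_snd).mul (comp_comD hn hm hK).fst.fst))

theorem emits_convertCode (hn : Small n) (hm : Small m) (hK : Small K) (hℓ : Small ℓ) :
    Emits (fun γ => convertCode (Ctx.cell γ) (n γ) (m γ) (K γ) (ℓ γ)) := by
  have hb := small_best (Γ := Γ × ℕ) hn.fst hm.fst hK.fst hℓ.fst small_snd
  have hp := comp_profit hn hm hK hℓ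
  refine (Emits.flatMap hK (Comp.emits ?_)).append
    (Emits.flatMap hK (Emits.flatMap hm.fst (Comp.pair ?_ ?_)))
  · exact hp.fst.ite_pos (hb.mod hn.fst).1 (comp_const 0)
  · exact hp.fst.fst.ite_pos (comp_mixNum (Γ := (Γ × ℕ) × ℕ) hn.fst.fst hm.fst.fst hK.fst.fst
      hℓ.fst.fst (hb.div hn.fst).fst small_snd) (comp_const 0)
  · exact (comp_mixDen hn hm hK hℓ).fst.fst

end

end BCD

namespace BCD

/-! ### Correctness of the conversion -/

theorem isBest_pos {cell : ℕ → ℤ} {n m K ℓ k o : ℕ} : 0 < isBest cell n m K ℓ k o ↔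
    ∀ o', o' < K * n → optionValue cell n m K ℓ k o' ≤ optionValue cell n m K ℓ k o := by
  constructor
  · intro h o' ho'
    by_contra! hlt
    have : isBest cell n m K ℓ k o = 0 :=
      Finset.prod_eq_zero (Finset.mem_range.2 ho') (if_pos (by omega))
    omega
  · intro h
    have : isBest cell n m K ℓ k o = 1 := Finset.prod_eq_one fun o' ho' =>
      if_neg (by have := h o' (Finset.mem_range.1 ho'); omega)
    omega

theorem best_spec {cell : ℕ → ℤ} {n m K : ℕ} (ℓ k : ℕ) (h : 0 < K * n) :
    best cell n m K ℓ k < K * n ∧ ∀ o, o < K * n →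
      optionValue cell n m K ℓ k o ≤ optionValue cell n m K ℓ k (best cell n m K ℓ k) := by
  obtain ⟨o, ho, hmax⟩ := Finset.exists_max_image (Finset.range (K * n))
    (optionValue cell n m K ℓ k) ⟨0, Finset.mem_range.2 h⟩
  have := search_spec (e := isBest cell n m K ℓ k) ⟨o, Finset.mem_range.1 ho,
    isBest_pos.2 fun o' ho' => hmax o' (Finset.mem_range.2 ho')⟩
  exact ⟨this.1, isBest_pos.1 this.2⟩

namespace MultiInstance.At

variable {n m K : ℕ} {I : MultiInstance n m K} {cell : ℕ → ℤ}
  {T : Mechanism (n * K + 1) (m + 1) (K + 1)}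

theorem comP_pos (hT : T.At cell (5 + 2 * codeSize n m K)) : 0 < comP cell n m K :=
  common_pos hT.den_pos

theorem pay_eq_numP (hT : T.At cell (5 + 2 * codeSize n m K)) (k : Fin (K + 1)) (j : Fin (m + 1)) :
    T.pay k j = (numP cell n m K k j : ℝ) / comP cell n m K :=
  (hT.pay_eq k j).trans (frac_eq_scaled hT.den_pos (mul_add_lt k.2 j.2))

theorem mixDen_pos (h : I.At cell 2) (hT : T.At cell (5 + 2 * codeSize n m K)) (ℓ : ℕ) :
    0 < mixDen cell n m K ℓ :=
  mul_pos (mul_pos (by positivity) h.comD_pos) (comP_pos hT)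

theorem mix_eq (h : I.At cell 2) (hT : T.At cell (5 + 2 * codeSize n m K)) (ℓ : ℕ) (k : Fin K)
    (j : Fin m) : (1 - 1 / (8 * 2 ^ ℓ)) * T.pay k.succ j.succ + 1 / (8 * 2 ^ ℓ) * I.r j =
      (mixNum cell n m K ℓ k j : ℝ) / mixDen cell n m K ℓ := by
  have h1 := h.comD_pos'
  have h2 : (0 : ℝ) < comP cell n m K := by exact_mod_cast comP_pos hT
  rw [pay_eq_numP hT, h.r_eq_numR, mixNum, mixDen, Fin.val_succ, Fin.val_succ]
  push_cast
  field_simp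

/-- The positive denominator is the same for all options, so comparing the integers is comparing the
utilities. -/
theorem optionValue_eq (h : I.At cell 2) (hT : T.At cell (5 + 2 * codeSize n m K)) (ℓ : ℕ)
    (k k' : Fin K) (i : Fin n) :
    (1 - 1 / (8 * 2 ^ ℓ)) * I.payment k i (fun j => T.pay k'.succ j.succ) +
        1 / (8 * 2 ^ ℓ) * I.reward k i - I.c k i =
      (optionValue cell n m K ℓ k (k' * n + i) : ℝ) /
        (comD cell n m K * mixDen cell n m K ℓ) := by
  have h1 := h.comD_pos'
  have h2 : (0 : ℝ) < mixDen cell n m K ℓ := by exact_mod_cast h.mixDen_pos hT ℓ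
  have e1 : (k' * n + i) / n = (k' : ℕ) := by
    rw [mul_comm, Nat.mul_add_div I.n_pos, Nat.div_eq_of_lt i.2, add_zero]
  have e2 : (k' * n + i) % n = (i : ℕ) := by
    rw [mul_comm, Nat.mul_add_mod, Nat.mod_eq_of_lt i.2]
  rw [← payment_mix, payment, optionValue, e1, e2, Finset.sum_range, h.c_eq_numC]
  push_cast
  rw [sub_div, Finset.sum_div]
  congr 1
  · refine Finset.sum_congr rfl fun j _ => ?_
    rw [h.mix_eq hT, h.F_eq_numF]
    field_simp
  · field_simp

/-- The contract of type `k` in the converted mechanism. -/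
def bestContract (I : MultiInstance n m K) (cell : ℕ → ℤ) (ℓ : ℕ) (k : Fin K) : Fin K :=
  ⟨best cell n m K ℓ k / n, Nat.div_lt_of_lt_mul (by
    rw [mul_comm n]
    exact (best_spec ℓ k (Nat.mul_pos I.K_pos I.n_pos)).1)⟩

/-- The action of type `k` in the converted mechanism. -/
def bestAction (I : MultiInstance n m K) (cell : ℕ → ℤ) (ℓ : ℕ) (k : Fin K) : Fin n :=
  ⟨best cell n m K ℓ k % n, Nat.mod_lt _ I.n_pos⟩

/-- The mixed mechanism. -/
noncomputable def mixed (I : MultiInstance n m K) (cell : ℕ → ℤ) (ℓ : ℕ)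
    (T : Mechanism (n * K + 1) (m + 1) (K + 1)) : Mechanism n m K where
  pay k j := (1 - 1 / (8 * 2 ^ ℓ)) * T.pay (bestContract I cell ℓ k).succ j.succ +
    1 / (8 * 2 ^ ℓ) * I.r j
  act := bestAction I cell ℓ

theorem isMix_mixed (h : I.At cell 2) (hT : T.At cell (5 + 2 * codeSize n m K)) (ℓ : ℕ) :
    I.IsMix (1 / (8 * 2 ^ ℓ)) (fun k j => T.pay k.succ j.succ) (bestContract I cell ℓ)
      (mixed I cell ℓ T) := by
  refine ⟨fun k j => rfl, fun k k' i => ?_⟩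
  rw [h.optionValue_eq hT, h.optionValue_eq hT]
  have h1 := h.comD_pos'
  have h2 : (0 : ℝ) < mixDen cell n m K ℓ := by exact_mod_cast h.mixDen_pos hT ℓ
  have h3 := (best_spec (cell := cell) (m := m) ℓ k (Nat.mul_pos I.K_pos I.n_pos)).2 _
    (mul_add_lt k'.2 i.2)
  have e : ((bestContract I cell ℓ k : ℕ) * n + ((mixed I cell ℓ T).act k : ℕ)) =
      best cell n m K ℓ k := Nat.div_add_mod' _ _
  rw [e]
  exact div_le_div_of_nonneg_right (by exact_mod_cast h3) (by positivity)

/-- Allows the program to decide by the sign of an integer whether the mixed mechanism is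
profitable. -/
theorem principalUtility_mixed (h : I.At cell 2) (hT : T.At cell (5 + 2 * codeSize n m K))
    (ℓ : ℕ) : I.principalUtility (mixed I cell ℓ T) =
      (profit cell n m K ℓ : ℝ) / (comD cell n m K ^ 3 * mixDen cell n m K ℓ) := by
  have h1 := h.comD_pos'
  have h2 : (0 : ℝ) < mixDen cell n m K ℓ := by exact_mod_cast h.mixDen_pos hT ℓ
  rw [principalUtility, profit, Finset.sum_range]
  push_cast
  rw [Finset.sum_div]
  refine Finset.sum_congr rfl fun k _ => ?_
  rw [Finset.sum_range, Finset.mul_sum, Finset.mul_sum, Finset.sum_div]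
  refine Finset.sum_congr rfl fun j _ => ?_
  have e1 : (mixed I cell ℓ T).pay k j =
      (mixNum cell n m K ℓ (best cell n m K ℓ k / n) j : ℝ) / mixDen cell n m K ℓ :=
    h.mix_eq hT ℓ (bestContract I cell ℓ k) j
  have e2 : I.F k ((mixed I cell ℓ T).act k) j =
      (numF cell n m K k (best cell n m K ℓ k % n) j : ℝ) / comD cell n m K :=
    h.F_eq_numF k (bestAction I cell ℓ k) j
  rw [e1, e2, h.μ_eq_numM, h.r_eq_numR]
  field_simp

/-- The mixed mechanism if it is profitable, and the zero mechanism otherwise. -/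
noncomputable def converted (I : MultiInstance n m K) (cell : ℕ → ℤ) (ℓ : ℕ)
    (T : Mechanism (n * K + 1) (m + 1) (K + 1)) : Mechanism n m K :=
  if 0 < profit cell n m K ℓ then mixed I cell ℓ T else I.zeroMechanism

theorem codes_converted (h : I.At cell 2) (hT : T.At cell (5 + 2 * codeSize n m K)) (ℓ : ℕ) :
    (converted I cell ℓ T).Codes (convertCode cell n m K ℓ) := by
  refine ⟨_, codesReals_matrixEntries (g := fun k j => [if 0 < profit cell n m K ℓ then
    mixNum cell n m K ℓ (best cell n m K ℓ k / n) j else 0, mixDen cell n m K ℓ])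
    fun k j => codesReals_singleton (h.mixDen_pos hT ℓ) ?_, ?_⟩
  · unfold converted
    split_ifs
    · exact h.mix_eq hT ℓ (bestContract I cell ℓ k) j
    · simp [zeroMechanism]
  · unfold convertCode
    congr 1
    rw [← List.map_eq_flatMap]
    refine List.ext_getElem (by simp) fun q h1 h2 => ?_
    simp only [List.getElem_map, List.getElem_range, List.getElem_ofFn]
    unfold converted
    split_ifs
    · rfl
    · rfl

theorem converted_spec (h : I.At cell 2) (hT : T.At cell (5 + 2 * codeSize n m K)) (ℓ : ℕ) :
    0 ≤ I.principalUtility (converted I cell ℓ T) ∧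
      I.principalUtility (mixed I cell ℓ T) ≤ I.principalUtility (converted I cell ℓ T) := by
  have h1 := h.comD_pos'
  have h2 : (0 : ℝ) < mixDen cell n m K ℓ := by exact_mod_cast h.mixDen_pos hT ℓ
  have hU := h.principalUtility_mixed hT ℓ
  have hz := I.principalUtility_zeroMechanism_nonneg
  unfold converted
  split_ifs with hp
  · refine ⟨?_, le_rfl⟩
    rw [hU]
    have : (0 : ℝ) < profit cell n m K ℓ := by exact_mod_cast hp
    positivity
  · refine ⟨hz, le_trans ?_ hz⟩
    rw [hU]
    have : (profit cell n m K ℓ : ℝ) ≤ 0 := by exact_mod_cast not_lt.1 hp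
    exact div_nonpos_of_nonpos_of_nonneg this (by positivity)

/-- The converter recomputes the constants from an input with the solution appended. Given I, they
depend on the cells only through the common denominator. -/
theorem single_congr (h : I.At cell 2) {cell' : ℕ → ℤ} (h' : I.At cell' 2)
    (hD : comD cell n m K = comD cell' n m K) (ℓ : ℕ) : h.single ℓ = h'.single ℓ := by
  have h0 := h.comD_pos'.ne'
  have hR : sumR cell n m K = sumR cell' n m K := by
    have e := h.totalReward_eq.symm.trans h'.totalReward_eq
    rw [← hD, div_left_inj' h0] at e
    exact_mod_cast e
  have hC : ∑ q ∈ Finset.range (K * n), numC cell n m K q =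
      ∑ q ∈ Finset.range (K * n), numC cell' n m K q := by
    have e := h.totalCost_eq.symm.trans h'.totalCost_eq
    rw [← hD, div_left_inj' h0] at e
    exact_mod_cast e
  have hB : bound cell n m K ℓ = bound cell' n m K ℓ := by
    rw [bound, bound, hD, hR, hC]
  have hE : extraCost cell n m K ℓ = extraCost cell' n m K ℓ := by
    rw [extraCost, extraCost, hB, hD, hR]
  unfold single
  simp only [hB, hE]

theorem one_div_two_pow_logInv_le {ξ : ℝ} (hξ : 0 < ξ) : 1 / 2 ^ logInv ξ ≤ ξ := by
  have h1 : 1 / ξ ≤ (2 : ℝ) ^ logInv ξ := by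
    have h2 := Nat.le_ceil (Real.logb 2 (1 / ξ))
    rw [Real.logb_le_iff_le_rpow (by norm_num) (by positivity)] at h2
    rwa [← Real.rpow_natCast]
  rw [div_le_iff₀ hξ] at h1
  rw [div_le_iff₀ (by positivity)]
  linarith

/-- Taking E = 2^ℓ gives loss at most 2^-ℓ ≤ ξ. The fallback to the zero mechanism supplies the
nonnegative utility needed when the claimed bound is trivial. -/
theorem feasible_converted (h : I.At cell 2) (hT : T.At cell (5 + 2 * codeSize n m K)) {ξ : ℝ}
    (hξ : 0 < ξ) {single : Prop} {β : ℝ}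
    (hf : (h.single (logInv ξ)).toMulti.Feasible single T)
    (hβ : β * (h.single (logInv ξ)).toMulti.opt single ≤
      (h.single (logInv ξ)).toMulti.principalUtility T) :
    I.Feasible single (converted I cell (logInv ξ) T) ∧
      (β - ξ) * I.opt single ≤ I.principalUtility (converted I cell (logInv ξ) T) := by
  set ℓ := logInv ξ with hℓ
  have hmix := h.isMix_mixed hT ℓ
  have hE : (1 : ℝ) ≤ 2 ^ ℓ := one_le_pow₀ (by norm_num)
  have hEH : (2 : ℝ) ^ ℓ ≤ bound cell n m K ℓ := by exact_mod_cast (h.bound_spec ℓ).2.2.2.2.1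
  obtain ⟨h0, h1⟩ := h.converted_spec hT ℓ
  constructor
  · unfold converted
    split_ifs
    · refine hmix.feasible (by positivity) ?_ (fun k j => hf.1.2 _ _) fun hs k k' => ?_
      · rw [div_le_one (by positivity)]
        linarith
      · funext j
        exact congrFun (hf.2 hs k.succ k'.succ) j.succ
    · exact I.feasible_zeroMechanism single
  · have := I.approx_of_toSingle (h.two_le_bound ℓ) hE hEH (h.one_le_bound_mul_μ ℓ)
      (h.one_le_bound_mul_F ℓ) (h.totalReward_le_bound ℓ) (h.totalCost_le_bound ℓ) (h.gap ℓ)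
      (h.extraCost_nonneg ℓ) (h.extraCost_eq ℓ) hf hβ hmix h0 h1
    refine le_trans (mul_le_mul_of_nonneg_right ?_ (I.opt_nonneg single)) this
    linarith [one_div_two_pow_logInv_le hξ]

end MultiInstance.At

/-- The accuracy occupies cell 1 and counts with its value, not its bit length, so 2^ℓ is
affordable; the instance starts in cell 2. -/
theorem MultiInstance.Codes.ok {n m K : ℕ} {I : MultiInstance n m K} {xs : List ℤ}
    (h : I.Codes xs) (ℓ : ℕ) (zs : List ℤ) :
    Ctx.ok (inputOf 4 ((ℓ : ℤ) :: (xs ++ zs))) (bitLength xs + ℓ + bitLength zs + 2) ∧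
      I.At (inputOf 4 ((ℓ : ℤ) :: (xs ++ zs))).entry 2 ∧
      (inputOf 4 ((ℓ : ℤ) :: (xs ++ zs))).entry 1 = ℓ := by
  have hat := h.at (cell := (inputOf 4 ((ℓ : ℤ) :: (xs ++ zs))).entry) (b := 2) fun q hq => by
    rw [show 2 + q = 1 + (q + 1) by ring, inputOf_succ, List.getD_cons_succ,
      List.getD_append _ _ _ _ hq]
  have h1 : (inputOf 4 ((ℓ : ℤ) :: (xs ++ zs))).entry 1 = ℓ := by
    rw [show (1 : ℕ) = 1 + 0 from rfl, inputOf_succ, List.getD_cons_zero]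
  have hl := h.length_eq
  have hb := length_le_bitLength xs
  have hn : n ≤ K * n := Nat.le_mul_of_pos_left n I.K_pos
  have e1 := hat.n_eq
  have e2 := hat.m_eq
  have e3 := hat.K_eq
  refine ⟨ok_inputOf ?_ fun i hi1 hi4 => ?_, hat, h1⟩
  · rw [bitLength_cons, bitLength_append]
    have := bits_natCast_le ℓ
    omega
  · interval_cases i
    · rw [h1]
      omega
    · rw [e1]
      omega
    · rw [show (3 : ℕ) = 2 + 1 from rfl, e2]
      omega
    · rw [show (4 : ℕ) = 2 + 2 from rfl, e3]
      omega

theorem MultiInstance.Codes.at_solution {n m K : ℕ} {I : MultiInstance n m K} {xs : List ℤ}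
    (h : I.Codes xs) (ℓ : ℕ) {T : Mechanism (n * K + 1) (m + 1) (K + 1)} {zs : List ℤ}
    (hT : T.Codes zs) :
    T.At (inputOf 4 ((ℓ : ℤ) :: (xs ++ zs))).entry (5 + 2 * codeSize n m K) := by
  refine hT.at fun q _ => ?_
  have hl := h.length_eq
  rw [show 5 + 2 * codeSize n m K + q = 1 + (xs.length + q + 1) by unfold codeSize; omega,
    inputOf_succ, List.getD_cons_succ, List.getD_append_right _ _ _ _ (by omega),
    Nat.add_sub_cancel_left]

/-- One converter serves both versions: mixtures of equal contracts with the rewards are equal. -/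
theorem multi_to_single :
    ∃ (reduce convertMenu convertSingle : Program) (q : Polynomial ℕ),
      ∀ (n m K : ℕ) (I : MultiInstance n m K) (xs : List ℤ), I.Codes xs →
      ∀ ξ : ℝ, 0 < ξ →
      ∃ (J : SingleInstance (n * K + 1) (m + 1) (K + 1)) (ys : List ℤ),
        J.Codes ys ∧
        RunsInTime reduce ((logInv ξ : ℤ) :: xs) ys (q.eval (bitLength xs + logInv ξ)) ∧
        (∀ B : ℝ, I.BoundedBy B → J.BoundedBy B) ∧
        ∀ (β : ℝ) (S : Mechanism (n * K + 1) (m + 1) (K + 1)) (zs : List ℤ), S.Codes zs →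
          (J.toMulti.IsApproxMenu β S →
            ∃ (S' : Mechanism n m K) (ws : List ℤ), S'.Codes ws ∧
              RunsInTime convertMenu ((logInv ξ : ℤ) :: (xs ++ zs)) ws
                (q.eval (bitLength xs + logInv ξ + bitLength zs)) ∧
              I.IsApproxMenu (β - ξ) S') ∧
          (J.toMulti.IsApproxSingle β S →
            ∃ (S' : Mechanism n m K) (ws : List ℤ), S'.Codes ws ∧
              RunsInTime convertSingle ((logInv ξ : ℤ) :: (xs ++ zs)) ws
                (q.eval (bitLength xs + logInv ξ + bitLength zs)) ∧
              I.IsApproxSingle (β - ξ) S') := by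
  have hℓ : Small (fun x : Input 4 => (x.entry 1).toNat) := small_header (by norm_num)
  have hn : Small (fun x : Input 4 => (x.entry 2).toNat) := small_header (by norm_num)
  have hm : Small (fun x : Input 4 => (x.entry 3).toNat) := small_header (by norm_num)
  have hK : Small (fun x : Input 4 => (x.entry 4).toNat) := small_header (by norm_num)
  obtain ⟨p, q, hp⟩ := (emits_toSingleCode hn hm hK hℓ).runsInTime
  obtain ⟨p', q', hp'⟩ := (emits_convertCode hn hm hK hℓ).runsInTime
  refine ⟨p, p', p', q.comp (Polynomial.X + 2) + q'.comp (Polynomial.X + 2),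
    fun n m K I xs hxs ξ hξ => ?_⟩
  obtain ⟨hok, hat, e1⟩ := hxs.ok (logInv ξ) []
  rw [List.append_nil] at hok hat e1
  have hb : bitLength [] = 0 := rfl
  rw [hb, add_zero] at hok
  refine ⟨hat.single (logInv ξ), _, hat.codes_single (logInv ξ), ?_,
    fun B hB => hat.single_boundedBy _ hB, fun β S zs hzs => ?_⟩
  · have h1 := hp _ _ hok
    have e2 : (inputOf 4 ((logInv ξ : ℤ) :: xs)).entry 2 = n := hat.n_eq
    have e3 : (inputOf 4 ((logInv ξ : ℤ) :: xs)).entry 3 = m := hat.m_eq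
    have e4 : (inputOf 4 ((logInv ξ : ℤ) :: xs)).entry 4 = K := hat.K_eq
    simp only [e1, e2, e3, e4, Int.toNat_natCast] at h1
    obtain ⟨t, M, hx, hM, ht⟩ := h1
    exact ⟨t, M, hx, hM, ht.trans (by simp)⟩
  obtain ⟨hok', hat', e1'⟩ := hxs.ok (logInv ξ) zs
  have hS := hxs.at_solution (logInv ξ) hzs
  have hrun : RunsInTime p' ((logInv ξ : ℤ) :: (xs ++ zs))
      (convertCode (inputOf 4 ((logInv ξ : ℤ) :: (xs ++ zs))).entry n m K (logInv ξ))
      ((q.comp (Polynomial.X + 2) + q'.comp (Polynomial.X + 2)).eval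
        (bitLength xs + logInv ξ + bitLength zs)) := by
    have h1 := hp' _ _ hok'
    have e2 : (inputOf 4 ((logInv ξ : ℤ) :: (xs ++ zs))).entry 2 = n := hat'.n_eq
    have e3 : (inputOf 4 ((logInv ξ : ℤ) :: (xs ++ zs))).entry 3 = m := hat'.m_eq
    have e4 : (inputOf 4 ((logInv ξ : ℤ) :: (xs ++ zs))).entry 4 = K := hat'.K_eq
    simp only [e1', e2, e3, e4, Int.toNat_natCast] at h1
    obtain ⟨t, M, hx, hM, ht⟩ := h1
    exact ⟨t, M, hx, hM, ht.trans (by simp)⟩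
  -- The reduction sees the instance alone and the converter sees it followed by a solution. The
  -- denominators agree, since the appended cells come after them.
  have hJ : hat.single (logInv ξ) = hat'.single (logInv ξ) := by
    refine hat.single_congr hat' ?_ _
    unfold comD common
    refine Finset.prod_congr rfl fun p hp => ?_
    have hp := Finset.mem_range.1 hp
    have hl := hxs.length_eq
    unfold codeSize at hp
    rw [den, den, show 5 + 2 * p + 1 = 1 + (2 * p + 4 + 1) by ring, inputOf_succ, inputOf_succ,
      List.getD_cons_succ, List.getD_cons_succ, List.getD_append _ _ _ _ (by omega)]
  rw [hJ]
  constructor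
  · intro h
    rw [MultiInstance.isApproxMenu_iff] at h
    obtain ⟨h1, h2⟩ := hat'.feasible_converted hS hξ h.1 h.2
    exact ⟨_, _, hat'.codes_converted hS _, hrun, (I.isApproxMenu_iff _ _).2 ⟨h1, h2⟩⟩
  · intro h
    rw [MultiInstance.isApproxSingle_iff] at h
    obtain ⟨h1, h2⟩ := hat'.feasible_converted hS hξ h.1 h.2
    exact ⟨_, _, hat'.codes_converted hS _, hrun, (I.isApproxSingle_iff _ _).2 ⟨h1, h2⟩⟩

end BCD

theorem theorem4p1 :
    -- from multi-parameter to single-parameter instances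
    (∃ (reduce convertMenu convertSingle : BCD.Program) (q : Polynomial ℕ),
      ∀ (n m K : ℕ) (I : BCD.MultiInstance n m K) (xs : List ℤ), I.Codes xs →
      ∀ ξ : ℝ, 0 < ξ →
      ∃ (J : BCD.SingleInstance (n * K + 1) (m + 1) (K + 1)) (ys : List ℤ),
        J.Codes ys ∧
        BCD.RunsInTime reduce ((BCD.logInv ξ : ℤ) :: xs) ys
          (q.eval (BCD.bitLength xs + BCD.logInv ξ)) ∧
        (∀ B : ℝ, I.BoundedBy B → J.BoundedBy B) ∧
        ∀ (β : ℝ) (S : BCD.Mechanism (n * K + 1) (m + 1) (K + 1)) (zs : List ℤ), S.Codes zs →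
          (J.toMulti.IsApproxMenu β S →
            ∃ (S' : BCD.Mechanism n m K) (ws : List ℤ), S'.Codes ws ∧
              BCD.RunsInTime convertMenu ((BCD.logInv ξ : ℤ) :: (xs ++ zs)) ws
                (q.eval (BCD.bitLength xs + BCD.logInv ξ + BCD.bitLength zs)) ∧
              I.IsApproxMenu (β - ξ) S') ∧
          (J.toMulti.IsApproxSingle β S →
            ∃ (S' : BCD.Mechanism n m K) (ws : List ℤ), S'.Codes ws ∧
              BCD.RunsInTime convertSingle ((BCD.logInv ξ : ℤ) :: (xs ++ zs)) ws
                (q.eval (BCD.bitLength xs + BCD.logInv ξ + BCD.bitLength zs)) ∧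
              I.IsApproxSingle (β - ξ) S')) ∧
    -- from single-parameter to multi-parameter instances
    (∃ (reduce convertMenu convertSingle : BCD.Program) (q : Polynomial ℕ),
      ∀ (n m K : ℕ) (J : BCD.SingleInstance n m K) (xs : List ℤ), J.Codes xs →
      ∃ (I : BCD.MultiInstance n m K) (ys : List ℤ),
        I.Codes ys ∧
        BCD.RunsInTime reduce xs ys (q.eval (BCD.bitLength xs)) ∧
        ∀ (β : ℝ) (S : BCD.Mechanism n m K) (zs : List ℤ), S.Codes zs →
          (I.IsApproxMenu β S →
            ∃ (S' : BCD.Mechanism n m K) (ws : List ℤ), S'.Codes ws ∧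
              BCD.RunsInTime convertMenu (xs ++ zs) ws
                (q.eval (BCD.bitLength xs + BCD.bitLength zs)) ∧
              J.toMulti.IsApproxMenu β S') ∧
          (I.IsApproxSingle β S →
            ∃ (S' : BCD.Mechanism n m K) (ws : List ℤ), S'.Codes ws ∧
              BCD.RunsInTime convertSingle (xs ++ zs) ws
                (q.eval (BCD.bitLength xs + BCD.bitLength zs)) ∧
              J.toMulti.IsApproxSingle β S')) :=
  ⟨BCD.multi_to_single, BCD.single_to_multi⟩
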